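/- Let $d\ge 3$ and $m\in\mathbb N$. Let $\Gamma=\{\sum_j n_j\gamma_j: n\in\mathbb Z^d\}$ be the lattice generated by a basis $\gamma_1,\dots,\gamma_d$ of $\mathbb R^d$, $\Gamma^*=\{k: k\cdot\gamma\in2\pi\mathbb Z\ \forall\gamma\in\Gamma\}$ its dual lattice, $\mathbb T_d^*=\mathbb R^d/\Gamma^*$, $\mathcal H_{\rm f}=L^2(\mathbb R^d/\Gamma)$, and $(\tau(\lambda)\varphi)(y)=e^{i\lambda\cdot y}\varphi(y)$ for $\lambda\in\Gamma^*$. Let $P(k)$, $k\in\mathbb R^d$, be a family of orthogonal projectors of rank $m$ on $\mathcal H_{\rm f}$, smooth in operator norm, with $P(k+\lambda)=\tau(\lambda)^{-1}P(k)\tau(\lambda)$ for $\lambda\in\Gamma^*$, and let $\chi=\{\chi_1,\dots,\chi_m\}$ be a real-analytic Bloch frame for it, i.e. $\chi_a:\mathbb R^d\to\mathcal H_{\rm f}$ is real-analytic, $\chi_a(k-\lambda)=\tau(\lambda)\chi_a(k)$ for $\lambda\in\Gamma^*$, and $\chi_1(k),\dots,\chi_m(k)$ is an orthonormal basis of $\operatorname{Ran}P(k)$.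 Put $[A_j(k)]_{cb}=\langle\chi_c(k),\partial_{k_j}\chi_b(k)\rangle$. For $U\in W^{1,2}(\mathbb T_d^*;\mathcal U(m))$ let $$\tilde F_{MV}(U;\chi)=\sum_{j}\int_{\mathbb T_d^*}\Big[\operatorname{tr}\Big(\frac{\partial U^*}{\partial k_j}\frac{\partial U}{\partial k_j}\Big)+m\sum_{a}\Big\|\frac{\partial\chi_a}{\partial k_j}\Big\|^2\Big]d\mu+\sum_j\int_{\mathbb T_d^*}\operatorname{tr}\Big[\Big(U\frac{\partial U^*}{\partial k_j}-\frac{\partial U}{\partial k_j}U^*\Big)A_j\Big]d\mu+\sum_{a,j}\Big(\int_{\mathbb T_d^*}\Big[U^*\Big(\frac{\partial U}{\partial k_j}+A_jU\Big)\Big]_{aa}d\mu\Big)^2,$$ where $\mu=c\,dk$ is Lebesgue measure $dk$ multiplied by a fixed constant $c>0$ (for instance $c=1$, or $\mu$ normalized to be a probability measure). Let $U\in W^{1,2}(\mathbb T_d^*;\mathcal U(m))$ be a minimizer of $\tilde F_{MV}(\cdot;\chi)$ on $W^{1,2}(\mathbb T_d^*;\mathcal U(m))$. Write $|\nabla U|^2=\sum_j\operatorname{tr}(\partial_{k_j}U^*\partial_{k_j}U)$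 and, for given $k_0$, $\partial_rU=\sum_j\frac{(k-k_0)_j}{|k-k_0|}\partial_{k_j}U$ and $|\partial_rU|^2=\operatorname{tr}((\partial_rU)^*\partial_rU)$, where $U$ is regarded as a $\Gamma^*$-periodic map on $\mathbb R^d$ and $B_R(k_0)$ is the Euclidean ball. Then there exist $C>0$ and $\bar R>0$ such that for all $k_0$ and all $0<R_1\le R_2\le\bar R$ $$\frac1{R_1^{d-2}}\int_{B_{R_1}(k_0)}|\nabla U|^2\,dk+\int_{R_1<|k-k_0|<R_2}\frac{2}{|k-k_0|^{d-2}}|\partial_rU|^2\,dk\le 2CR_2+(1+2CR_2)\frac1{R_2^{d-2}}\int_{B_{R_2}(k_0)}|\nabla U|^2\,dk .$$ Consequently, for every $k_0$, the scaled energy $R^{2-d}\int_{B_R(k_0)}|\nabla U|^2\,dk$ has a finite limit as $R\to0^+$, and $\int_{B_R(k_0)}|\partial_rU|^2|k-k_0|^{2-d}\,dk$ is finite for every $R>0$ and tends to $0$ as $R\to0^+$. -/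

import Mathlib

open MeasureTheory Filter Topology
open scoped ContDiff ENNReal InnerProductSpace Matrix

namespace MarzariVanderbilt

noncomputable section

/-- The Euclidean space `ℝᵈ`. -/
abbrev E (d : ℕ) : Type := EuclideanSpace ℝ (Fin d)

/-- The `j`-th standard unit vector of `ℝᵈ`. -/
def unitVec {d : ℕ} (j : Fin d) : E d := EuclideanSpace.single j (1 : ℝ)

/-! ### The lattice, its dual, and the fundamental domains -/

/-- The lattice `Γ` of all integer combinations of `γ₁, …, γ_d`. -/
def lattice {d : ℕ} (γ : Module.Basis (Fin d) ℝ (E d)) : Set (E d) :=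
  {g | ∃ n : Fin d → ℤ, g = ∑ j, (n j : ℝ) • γ j}

/-- The dual lattice `Γ* = {k : k · g ∈ 2πℤ for all g ∈ Γ}`. -/
def dualLattice {d : ℕ} (γ : Module.Basis (Fin d) ℝ (E d)) : Set (E d) :=
  {l | ∀ g ∈ lattice γ, ∃ n : ℤ, ⟪l, g⟫_ℝ = 2 * Real.pi * n}

/-- The centered fundamental domain `Y` of `Γ`. -/
def cell {d : ℕ} (γ : Module.Basis (Fin d) ℝ (E d)) : Set (E d) :=
  {x | ∃ α : Fin d → ℝ, (∀ j, α j ∈ Set.Icc (-(1 / 2) : ℝ) (1 / 2)) ∧ x = ∑ j, α j • γ j}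

/-- The centered fundamental domain `Y*` of `Γ*`.  If `k = ∑ k'ⱼ γ*ⱼ`, where `γ*` is the dual basis,
`γ*ⱼ · γᵢ = 2π δⱼᵢ`, then `k'ᵢ = (k · γᵢ) / 2π`; the condition is `k'ᵢ ∈ [-1/2, 1/2]`. -/
def dualCell {d : ℕ} (γ : Module.Basis (Fin d) ℝ (E d)) : Set (E d) :=
  {k | ∀ i, ⟪k, γ i⟫_ℝ / (2 * Real.pi) ∈ Set.Icc (-(1 / 2) : ℝ) (1 / 2)}

/-! ### The fibre space `H_f = L²(𝕋ᵈ)` and the representation `τ` of `Γ*` -/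

/-- `H_f = L²(𝕋ᵈ)` with `𝕋ᵈ = ℝᵈ/Γ`: a `Γ`-periodic function is represented by its restriction
to the fundamental domain `Y`. -/
abbrev Hf {d : ℕ} (γ : Module.Basis (Fin d) ℝ (E d)) : Type :=
  Lp ℂ 2 ((volume : Measure (E d)).restrict (cell γ))

/-- The character `y ↦ e^{i l·y}`. -/
def character {d : ℕ} (l : E d) (y : E d) : ℂ := Complex.exp (Complex.I * (⟪l, y⟫_ℝ : ℝ))

theorem memLp_character {d : ℕ} (γ : Module.Basis (Fin d) ℝ (E d)) (l : E d) :
    MemLp (character l) ∞ ((volume : Measure (E d)).restrict (cell γ)) := by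
  refine memLp_top_of_bound (C := 1) ?_ ?_
  · apply Continuous.aestronglyMeasurable
    unfold character
    fun_prop
  · refine Eventually.of_forall fun y => ?_
    unfold character
    rw [mul_comm, Complex.norm_exp_ofReal_mul_I]

/-- The operator `τ(l)` on `H_f`, `(τ(l)φ)(y) = e^{i l·y} φ(y)`. -/
def tau {d : ℕ} (γ : Module.Basis (Fin d) ℝ (E d)) (l : E d) : Hf γ →L[ℂ] Hf γ :=
  (ContinuousLinearMap.mul ℂ ℂ).holderL ((volume : Measure (E d)).restrict (cell γ)) ∞ 2 2
    (memLp_character γ l).toLp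

theorem coeFn_tau {d : ℕ} (γ : Module.Basis (Fin d) ℝ (E d)) (l : E d) (φ : Hf γ) :
    tau γ l φ =ᵐ[(volume : Measure (E d)).restrict (cell γ)] fun y => character l y * φ y := by
  have h1 := (ContinuousLinearMap.mul ℂ ℂ).coeFn_holder (r := 2) (memLp_character γ l).toLp φ
  have h2 := (memLp_character γ l).coeFn_toLp
  refine EventuallyEq.trans h1 ?_
  filter_upwards [h2] with y hy
  simp [hy]

/-- Membership in `H_τ`: a function in `L²_loc(ℝᵈ; H_f)` with `φ(k - l) = τ(l) φ(k)` for all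
`l ∈ Γ*` and a.e. `k`. -/
def MemHTau {d : ℕ} (γ : Module.Basis (Fin d) ℝ (E d)) (φ : E d → Hf γ) : Prop :=
  (∀ K : Set (E d), IsCompact K → MemLp φ 2 (volume.restrict K)) ∧
    ∀ l ∈ dualLattice γ, ∀ᵐ k : E d, φ (k - l) = tau γ l (φ k)

/-! ### Families of projectors and Bloch frames -/

/-- A family `P(k)`, `k ∈ ℝᵈ`, of orthogonal projectors of rank `m` on `H_f`, smooth in operator
norm and `τ`-covariant, `P(k + l) = τ(l)⁻¹ P(k) τ(l)`; here `τ(l)⁻¹ = τ(-l)`. -/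
structure IsProjectorFamily {d : ℕ} (γ : Module.Basis (Fin d) ℝ (E d)) (m : ℕ)
    (P : E d → (Hf γ →L[ℂ] Hf γ)) : Prop where
  isStarProjection : ∀ k, IsStarProjection (P k)
  rank_eq : ∀ k, Module.rank ℂ (LinearMap.range (P k).toLinearMap) = m
  smooth : ContDiff ℝ ∞ P
  covariant : ∀ k, ∀ l ∈ dualLattice γ, P (k + l) = (tau γ (-l)).comp ((P k).comp (tau γ l))

/-- A Bloch frame for `P`: functions `χ₁, …, χ_m ∈ H_τ` forming, at a.e. `k`, an orthonormal basis
of `Ran P(k)`. -/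
structure IsBlochFrame {d : ℕ} (γ : Module.Basis (Fin d) ℝ (E d)) {m : ℕ}
    (P : E d → (Hf γ →L[ℂ] Hf γ)) (χ : Fin m → E d → Hf γ) : Prop where
  mem_HTau : ∀ a, MemHTau γ (χ a)
  orthonormal : ∀ᵐ k : E d, Orthonormal ℂ (fun a => χ a k)
  span_eq : ∀ᵐ k : E d,
    Submodule.span ℂ (Set.range fun a => χ a k) = LinearMap.range (P k).toLinearMap

/-- The partial derivative `∂χ_a/∂k_j`. -/
def frameDeriv {d m : ℕ} {γ : Module.Basis (Fin d) ℝ (E d)} (χ : Fin m → E d → Hf γ)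
    (j : Fin d) (a : Fin m) (k : E d) : Hf γ :=
  fderiv ℝ (χ a) k (unitVec j)

/-- The Berry connection matrices, `[A_j(k)]_{cb} = ⟨χ_c(k), ∂χ_b/∂k_j(k)⟩` (the inner product is
conjugate-linear in the first argument). -/
def berry {d m : ℕ} {γ : Module.Basis (Fin d) ℝ (E d)} (χ : Fin m → E d → Hf γ)
    (j : Fin d) (k : E d) : Matrix (Fin m) (Fin m) ℂ :=
  Matrix.of fun c b => ⟪χ c k, frameDeriv χ j b k⟫_ℂ

/-! ### The space `W^{1,2}(𝕋*_d; 𝒰(m))` -/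

/-- `g` is the weak `j`-th partial derivative on `ℝᵈ` of the function `f` (for locally integrable
`f` and `g`). -/
def IsWeakPartialDeriv {d : ℕ} (j : Fin d) (f g : E d → ℂ) : Prop :=
  ∀ φ : E d → ℝ, ContDiff ℝ ∞ φ → HasCompactSupport φ →
    ∫ k, ((fderiv ℝ φ k (unitVec j) : ℝ) : ℂ) * f k = -∫ k, ((φ k : ℝ) : ℂ) * g k

/-- An element of `W^{1,2}(𝕋*_d; 𝒰(m))`, `𝕋*_d = ℝᵈ/Γ*`: a `Γ*`-periodic map from `ℝᵈ` to the unitary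
group `𝒰(m) ⊂ M_m(ℂ)`, together with its weak partial derivatives `grad j = ∂U/∂k_j`, all entries
being locally square integrable.  The derivatives are determined a.e. by the map. -/
structure SobolevMap {d : ℕ} (γ : Module.Basis (Fin d) ℝ (E d)) (m : ℕ) where
  toFun : E d → Matrix (Fin m) (Fin m) ℂ
  grad : Fin d → E d → Matrix (Fin m) (Fin m) ℂ
  unitary : ∀ᵐ k : E d, toFun k ∈ Matrix.unitaryGroup (Fin m) ℂ
  periodic : ∀ l ∈ dualLattice γ, ∀ᵐ k : E d, toFun (k + l) = toFun k
  memLp : ∀ a b, ∀ K : Set (E d), IsCompact K →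
    MemLp (fun k => toFun k a b) 2 (volume.restrict K)
  memLp_grad : ∀ j a b, ∀ K : Set (E d), IsCompact K →
    MemLp (fun k => grad j k a b) 2 (volume.restrict K)
  isWeakPartialDeriv : ∀ j a b,
    IsWeakPartialDeriv j (fun k => toFun k a b) (fun k => grad j k a b)

/-! ### The localization functional -/

/-- Integral over the torus `𝕋*_d` of a `Γ*`-periodic function, with respect to `c` times Lebesgue
measure. -/
def torusIntegral {d : ℕ} (γ : Module.Basis (Fin d) ℝ (E d)) (c : ℝ) (f : E d → ℂ) : ℂ :=
  (c : ℂ) * ∫ k in dualCell γ, f k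

/-- The Marzari–Vanderbilt localization functional `F̃_MV(U; χ)`.  All three complex sums below are
in fact real, since `A_j` and `U* ∂U/∂k_j` are antihermitian. -/
def localizationFunctional {d m : ℕ} {γ : Module.Basis (Fin d) ℝ (E d)} (c : ℝ)
    (χ : Fin m → E d → Hf γ) (U : SobolevMap γ m) : ℝ :=
  ((∑ j, torusIntegral γ c fun k =>
      ((U.grad j k)ᴴ * U.grad j k).trace + m * ∑ a, ((‖frameDeriv χ j a k‖ ^ 2 : ℝ) : ℂ))
    + (∑ j, torusIntegral γ c fun k =>
      ((U.toFun k * (U.grad j k)ᴴ - U.grad j k * (U.toFun k)ᴴ) * berry χ j k).trace)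
    + ∑ a, ∑ j, (torusIntegral γ c fun k =>
      ((U.toFun k)ᴴ * (U.grad j k + berry χ j k * U.toFun k)) a a) ^ 2).re

/-- `U` minimizes `F̃_MV(·; χ)` over `W^{1,2}(𝕋*_d; 𝒰(m))`. -/
def IsMinimizer {d m : ℕ} {γ : Module.Basis (Fin d) ℝ (E d)} (c : ℝ)
    (χ : Fin m → E d → Hf γ) (U : SobolevMap γ m) : Prop :=
  ∀ V : SobolevMap γ m, localizationFunctional c χ U ≤ localizationFunctional c χ V

/-! ### The scaled energy -/

/-- `|M|² = tr(M* M)`, the squared Euclidean norm on `M_m(ℂ)`. -/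
def matNormSq {m : ℕ} (M : Matrix (Fin m) (Fin m) ℂ) : ℝ := ((Mᴴ * M).trace).re

/-- `|∇U|² = ∑_j |∂U/∂k_j|²`. -/
def gradNormSq {d m : ℕ} {γ : Module.Basis (Fin d) ℝ (E d)} (U : SobolevMap γ m) (k : E d) : ℝ :=
  ∑ j, matNormSq (U.grad j k)

/-- The radial derivative `∂U/∂r = ∑_j ((k - k₀)_j / |k - k₀|) ∂U/∂k_j` with respect to `k₀`. -/
def radialDeriv {d m : ℕ} {γ : Module.Basis (Fin d) ℝ (E d)} (U : SobolevMap γ m)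
    (k₀ k : E d) : Matrix (Fin m) (Fin m) ℂ :=
  ∑ j, ((((k - k₀) j / ‖k - k₀‖ : ℝ)) : ℂ) • U.grad j k

/-- The scaled energy `R^{2-d} ∫_{B_R(k₀)} |∇U|² dk`. -/
def scaledEnergy {d m : ℕ} {γ : Module.Basis (Fin d) ℝ (E d)} (U : SobolevMap γ m)
    (k₀ : E d) (R : ℝ) : ℝ :=
  R ^ (2 - (d : ℤ)) * ∫ k in Metric.ball k₀ R, gradNormSq U k

/-- The weighted radial energy density `|∂U/∂r|² |k - k₀|^{2-d}`. -/
def radialDensity {d m : ℕ} {γ : Module.Basis (Fin d) ℝ (E d)} (U : SobolevMap γ m)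
    (k₀ k : E d) : ℝ :=
  matNormSq (radialDeriv U k₀ k) * ‖k - k₀‖ ^ (2 - (d : ℤ))

end

end MarzariVanderbilt

/-!
Deforming a minimizer to `U ∘ Φ⁻¹` with a periodic diffeomorphism `Φ = id + s X` keeps its values
in `𝒰(m)`. To first order in `s` the Dirichlet energy changes by
`∫ (div X |∇U|² - 2 ∑ᵢⱼ ∂ⱼXᵢ ⟨∂ᵢU, ∂ⱼU⟩)`. All other terms depend on `U` only through integrals of
expressions affine in `∇U`, which change by at most `K ∫ (|DX| + |X|) (1 + |∇U|)`. So the minimizer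
is stationary for the Dirichlet energy up to an error of lower order.

Test this with `X = -h(r) (k - k₀)`, where `r = |k - k₀|` and `h` is a decreasing function of `r`,
made constant for `r ≤ R₁` and shifted so as to vanish for `r ≥ R₂`. For `h = r^{2-d}` the
coefficient `(d - 2) h + r h'` of `|∇U|²` vanishes in the shell before the shift; what remains is
the scaled energies of the two balls and `2 r h' |∂ᵣU|²`, the weighted radial energy. Bounding
`|∇U|` by `r |∇U|² + r⁻¹`, the error is absorbed by the perturbed profile `h = r^{2-d} (1 + Λ r)`.

In the resulting inequality `R₁ → 0` shows that the upper limit of the scaled energy at `0` is at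
most its lower limit, and that the radial energies of the shells `r < |k - k₀| < R` are bounded
uniformly in `r`.
-/

namespace MarzariVanderbilt

noncomputable section

/-! ### Lattices and periodic functions -/

theorem setIntegral_eq_of_ae_invariant {G α F : Type*} [AddGroup G] [Countable G] [AddAction G α]
    [MeasurableSpace α] [MeasurableConstVAdd G α] {μ : Measure α} [VAddInvariantMeasure G α μ]
    [NormedAddCommGroup F] [NormedSpace ℝ F] {s t : Set α}
    (hs : IsAddFundamentalDomain G s μ) (ht : IsAddFundamentalDomain G t μ) {f : α → F}
    (hf : ∀ g : G, ∀ᵐ x ∂μ, f (g +ᵥ x) = f x) : ∫ x in s, f x ∂μ = ∫ x in t, f x ∂μ := by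
  let N : Set α := {x | ∀ g : G, f (g +ᵥ x) = f x}
  have hN_ae : ∀ᵐ x ∂μ, x ∈ N := ae_all_iff.2 hf
  have hN_vadd : ∀ (g : G) x, g +ᵥ x ∈ N ↔ x ∈ N := by
    suffices h : ∀ (g : G) x, x ∈ N → g +ᵥ x ∈ N from
      fun g x => ⟨fun hx => by simpa using h (-g) _ hx, h g x⟩
    intro g x hx g'
    rw [← add_vadd, hx, hx]
  have h_inv : ∀ (g : G) x, N.indicator f (g +ᵥ x) = N.indicator f x := fun g x => by
    by_cases hx : x ∈ N
    · rw [Set.indicator_of_mem hx, Set.indicator_of_mem ((hN_vadd g x).2 hx), hx]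
    · rw [Set.indicator_of_notMem hx, Set.indicator_of_notMem (mt (hN_vadd g x).1 hx)]
  have h_ae : f =ᵐ[μ] N.indicator f := by
    filter_upwards [hN_ae] with x hx
    rw [Set.indicator_of_mem hx]
  rw [integral_congr_ae (ae_restrict_of_ae h_ae), hs.setIntegral_eq ht h_inv,
    integral_congr_ae (ae_restrict_of_ae h_ae)]

section CenteredCell

variable {ι V : Type*} [NormedAddCommGroup V] [NormedSpace ℝ V]
  (b : Module.Basis ι ℝ V) (k₀ : V)

/-- The half-open fundamental domain, centered at `k₀`, of the lattice spanned by the basis `b`. -/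
def centeredCell : Set V := {k | ∀ i, b.repr (k - k₀) i ∈ Set.Ico (-(1 / 2) : ℝ) (1 / 2)}

open scoped Pointwise in
theorem centeredCell_eq_vadd_fundamentalDomain [Fintype ι] :
    centeredCell b k₀ = (k₀ - (1 / 2 : ℝ) • ∑ i, b i) +ᵥ ZSpan.fundamentalDomain b := by
  ext k
  rw [Set.mem_vadd_set_iff_neg_vadd_mem, ZSpan.mem_fundamentalDomain]
  refine forall_congr' fun i => ?_
  have h_repr : b.repr (-(k₀ - (1 / 2 : ℝ) • ∑ i, b i) +ᵥ k) i = b.repr (k - k₀) i + 1 / 2 := by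
    rw [vadd_eq_add, show -(k₀ - (1 / 2 : ℝ) • ∑ i, b i) + k = k - k₀ + (1 / 2 : ℝ) • ∑ i, b i by
      abel, map_add, map_smul, map_sum]
    simp
  rw [h_repr, Set.mem_Ico, Set.mem_Ico]
  constructor <;> rintro ⟨h_left, h_right⟩ <;> constructor <;> linarith

theorem measurableSet_centeredCell [Finite ι] [MeasurableSpace V] [BorelSpace V] :
    MeasurableSet (centeredCell b k₀) := by
  cases nonempty_fintype ι
  have := b.finiteDimensional_of_finite
  rw [centeredCell_eq_vadd_fundamentalDomain]
  exact (ZSpan.fundamentalDomain_measurableSet b).const_vadd _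

theorem isAddFundamentalDomain_centeredCell [Finite ι] [MeasurableSpace V] [BorelSpace V]
    (μ : Measure V) [μ.IsAddLeftInvariant] :
    IsAddFundamentalDomain (Submodule.span ℤ (Set.range b)).toAddSubgroup
      (centeredCell b k₀) μ := by
  cases nonempty_fintype ι
  rw [centeredCell_eq_vadd_fundamentalDomain]
  exact (ZSpan.isAddFundamentalDomain' b μ).vadd_of_comm _

theorem isBounded_centeredCell [Finite ι] : Bornology.IsBounded (centeredCell b k₀) := by
  cases nonempty_fintype ι
  rw [centeredCell_eq_vadd_fundamentalDomain]
  exact (ZSpan.fundamentalDomain_isBounded b).vadd _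

theorem ae_eq_centeredCell [Finite ι] [MeasurableSpace V] [BorelSpace V] (μ : Measure V)
    [μ.IsAddHaarMeasure] :
    {k | ∀ i, b.repr k i ∈ Set.Icc (-(1 / 2) : ℝ) (1 / 2)} =ᵐ[μ] centeredCell b 0 := by
  have := b.finiteDimensional_of_finite
  have h_hyperplane : ∀ i, ∀ᵐ k ∂μ, b.repr k i ≠ 1 / 2 := fun i =>
    (ae_comp_linearMap_mem_iff (b.coord i) μ volume (fun t => ⟨t • b i, by simp⟩)
      (measurableSet_singleton (1 / 2 : ℝ)).compl).2 (volume.ae_ne _)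
  filter_upwards [ae_all_iff.2 h_hyperplane] with k hk
  refine propext (forall_congr' fun i => ?_)
  rw [sub_zero]
  exact ⟨fun h => ⟨h.1, h.2.lt_of_ne (hk i)⟩, fun h => ⟨h.1, h.2.le⟩⟩

theorem eq_zero_of_add_mem_centeredCell {x l : V} (hl : l ∈ Submodule.span ℤ (Set.range b))
    (hx : x ∈ centeredCell b k₀) (hxl : x + l ∈ centeredCell b k₀) : l = 0 := by
  refine b.ext_elem_iff.2 fun i => ?_
  obtain ⟨n, hn⟩ := (b.mem_span_iff_repr_mem ℤ l).1 hl i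
  have h_sub := hxl i
  rw [add_sub_right_comm, map_add, Finsupp.add_apply, ← hn, algebraMap_int_eq, eq_intCast] at h_sub
  have hn0 : n = 0 := by
    have h_lt : (n : ℝ) < 1 := by linarith [(hx i).1, h_sub.2]
    have h_gt : (-1 : ℝ) < n := by linarith [(hx i).2, h_sub.1]
    have h_lt' : n < 1 := by exact_mod_cast h_lt
    have h_gt' : -1 < n := by exact_mod_cast h_gt
    omega
  rw [← hn, hn0]
  simp

theorem exists_closedBall_subset_centeredCell [Finite ι] :
    ∃ ρ : ℝ, 0 < ρ ∧ (∀ l ∈ Submodule.span ℤ (Set.range b), l ≠ 0 → 4 * ρ < ‖l‖) ∧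
      ∀ k₀, Metric.closedBall k₀ ρ ⊆ centeredCell b k₀ := by
  have h_cont : ∀ i, Continuous fun v => b.repr v i := fun i =>
    haveI := b.finiteDimensional_of_finite
    LinearMap.continuous_of_finiteDimensional (b.coord i)
  have h_nhds : ∀ᶠ v in 𝓝 (0 : V), ∀ i, b.repr v i ∈ Set.Ioo (-(1 / 2) : ℝ) (1 / 2) :=
    eventually_all.2 fun i => (h_cont i).continuousAt.eventually_mem
      (isOpen_Ioo.mem_nhds (by simp))
  obtain ⟨ε, hε, h_ball⟩ := Metric.eventually_nhds_iff_ball.1 h_nhds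
  refine ⟨ε / 5, by positivity, fun l hl hl0 => ?_, fun k₀ k hk i => ?_⟩
  · by_contra! hle
    refine hl0 (b.ext_elem fun i => ?_)
    obtain ⟨n, hn⟩ := (b.mem_span_iff_repr_mem ℤ l).1 hl i
    have h_lt := h_ball l (by rw [mem_ball_zero_iff]; linarith) i
    rw [← hn, algebraMap_int_eq, eq_intCast, Set.mem_Ioo, ← abs_lt] at h_lt
    have hn0 : |n| < 1 := by exact_mod_cast h_lt.trans one_half_lt_one
    rw [← hn, Int.abs_lt_one_iff.1 hn0]
    simp
  · rw [mem_closedBall_iff_norm] at hk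
    exact Set.Ioo_subset_Ico_self (h_ball _ (by rw [mem_ball_zero_iff]; linarith) i)

omit k₀ in
theorem exists_norm_le_of_continuous_of_periodic [Finite ι] {F : Type*}
    [SeminormedAddCommGroup F] {f : V → F} (hf : Continuous f)
    (hper : ∀ l ∈ Submodule.span ℤ (Set.range b), ∀ k, f (k + l) = f k) :
    ∃ M, ∀ k, ‖f k‖ ≤ M := by
  cases nonempty_fintype ι
  have := b.finiteDimensional_of_finite
  have := FiniteDimensional.proper ℝ V
  obtain ⟨M, hM⟩ := (ZSpan.fundamentalDomain_isBounded b).isCompact_closure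
    |>.exists_bound_of_continuousOn hf.continuousOn
  refine ⟨M, fun k => ?_⟩
  have h_fract : f (ZSpan.fract b k) = f k := by
    rw [ZSpan.fract_apply, sub_eq_add_neg]
    exact hper _ (neg_mem (ZSpan.floor b k).2) k
  exact h_fract ▸ hM _ (subset_closure (ZSpan.fract_mem_fundamentalDomain b k))

omit k₀ in
theorem exists_norm_sub_le_of_contDiff_of_periodic [Finite ι] {F : Type*} [NormedAddCommGroup F]
    [NormedSpace ℝ F] {f : V → F} (hf : ContDiff ℝ 1 f)
    (hper : ∀ l ∈ Submodule.span ℤ (Set.range b), ∀ k, f (k + l) = f k) :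
    ∃ C, ∀ x y, ‖f x - f y‖ ≤ C * ‖x - y‖ := by
  obtain ⟨C, hC⟩ := exists_norm_le_of_continuous_of_periodic b
    (hf.continuous_fderiv one_ne_zero) fun l hl k => by
      rw [← fderiv_comp_add_right, funext (hper l hl)]
  exact ⟨C, fun x y => convex_univ.norm_image_sub_le_of_norm_fderiv_le (𝕜 := ℝ)
    (fun z _ => hf.differentiable one_ne_zero z) (fun z _ => hC z) (Set.mem_univ y)
    (Set.mem_univ x)⟩

end CenteredCell

section DualLattice

variable {d : ℕ} (γ : Module.Basis (Fin d) ℝ (E d))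

theorem nondegenerate_smul_innerₗ {V : Type*} [NormedAddCommGroup V] [InnerProductSpace ℝ V]
    {c : ℝ} (hc : c ≠ 0) : (c • innerₗ V).Nondegenerate := by
  refine ⟨fun x hx => ?_, fun x hx => ?_⟩ <;>
    simpa [hc] using hx x

/-- The basis `γ*` of `Γ*`, dual to `γ` for the form `⟪·, ·⟫ / 2π`. -/
def dualBasis : Module.Basis (Fin d) ℝ (E d) :=
  LinearMap.BilinForm.dualBasis ((2 * Real.pi)⁻¹ • innerₗ (E d))
    (nondegenerate_smul_innerₗ (by positivity)) γ

theorem dualBasis_repr_apply (k : E d) (i : Fin d) :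
    (dualBasis γ).repr k i = ⟪k, γ i⟫_ℝ / (2 * Real.pi) := by
  rw [dualBasis, LinearMap.BilinForm.dualBasis_repr_apply]
  simp [div_eq_inv_mul]

variable {γ}

theorem mem_dualLattice_iff_mem_span {l : E d} :
    l ∈ dualLattice γ ↔ l ∈ Submodule.span ℤ (Set.range (dualBasis γ)) := by
  rw [Module.Basis.mem_span_iff_repr_mem]
  simp only [dualBasis_repr_apply]
  constructor
  · intro h i
    obtain ⟨n, hn⟩ := h (γ i) ⟨Pi.single i 1, by simp [Pi.single_apply]⟩
    refine ⟨n, ?_⟩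
    rw [hn, algebraMap_int_eq, eq_intCast]
    field_simp
  · rintro h _ ⟨m, rfl⟩
    choose n hn using h
    refine ⟨∑ j, m j * n j, ?_⟩
    have h_inner : ∀ i, ⟪l, γ i⟫_ℝ = 2 * Real.pi * n i := fun i => by
      rw [← eq_intCast (algebraMap ℤ ℝ), hn]
      field_simp
    simp only [inner_sum, inner_smul_right, h_inner]
    push_cast
    rw [Finset.mul_sum]
    exact Finset.sum_congr rfl fun j _ => by ring

theorem dualCell_ae_eq_centeredCell : dualCell γ =ᵐ[volume] centeredCell (dualBasis γ) 0 := by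
  have h := ae_eq_centeredCell (dualBasis γ) volume
  simp only [dualBasis_repr_apply] at h
  exact h

theorem setIntegral_dualCell_eq_setIntegral_centeredCell {F : Type*} [NormedAddCommGroup F]
    [NormedSpace ℝ F] (k₀ : E d) {f : E d → F}
    (hf : ∀ l ∈ dualLattice γ, ∀ᵐ k : E d, f (k + l) = f k) :
    ∫ k in dualCell γ, f k = ∫ k in centeredCell (dualBasis γ) k₀, f k := by
  rw [setIntegral_congr_set dualCell_ae_eq_centeredCell]
  have : Countable (Submodule.span ℤ (Set.range (dualBasis γ))).toAddSubgroup :=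
    inferInstanceAs (Countable (Submodule.span ℤ (Set.range (dualBasis γ))))
  refine setIntegral_eq_of_ae_invariant (isAddFundamentalDomain_centeredCell _ 0 volume)
    (isAddFundamentalDomain_centeredCell _ k₀ volume) fun l => ?_
  filter_upwards [hf l (mem_dualLattice_iff_mem_span.2 l.2)] with k hk
  rwa [AddSubgroup.vadd_def, vadd_eq_add, add_comm]

end DualLattice

section Periodize

variable {V F : Type*} [NormedAddCommGroup V] [NormedAddCommGroup F] {L : AddSubgroup V} {X : V → F}
  {k₀ : V} {ρ : ℝ}

/-- The sum of the translates of `X` by the elements of the subgroup `L`; it is used when the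
translates of the support of `X` are disjoint. -/
def periodize (L : AddSubgroup V) (X : V → F) (x : V) : F := ∑ᶠ l : L, X (x + l)

theorem periodize_add (X : V → F) {l : V} (hl : l ∈ L) (x : V) :
    periodize L X (x + l) = periodize L X x := by
  unfold periodize
  rw [← finsum_comp_equiv (Equiv.addLeft (⟨l, hl⟩ : L)) (f := fun k : L => X (x + k))]
  simp [add_assoc]

variable (hX : ∀ x ∉ Metric.closedBall k₀ ρ, X x = 0)
include hX

theorem periodize_eq_zero {x : V} (h : ∀ l ∈ L, x + l ∉ Metric.closedBall k₀ ρ) :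
    periodize L X x = 0 :=
  finsum_eq_zero_of_forall_eq_zero fun l => hX _ (h l l.2)

variable (hL : ∀ l ∈ L, l ≠ 0 → 4 * ρ < ‖l‖)
include hL

theorem exists_forall_ball_periodize_eq (x : V) :
    ∃ l : L, ∀ y ∈ Metric.ball x ρ, periodize L X y = X (y + l) := by
  by_cases! h : ∃ l : L, ∃ y ∈ Metric.ball x ρ, y + l ∈ Metric.closedBall k₀ ρ
  · obtain ⟨l, y, hy, hyl⟩ := h
    refine ⟨l, fun z hz => finsum_eq_single _ l fun l' hl' => hX _ fun hzl => ?_⟩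
    have h_sep := hL _ (l' - l).2 (by simpa [sub_eq_zero] using hl')
    have h_triangle : dist (l' : V) l ≤ dist (z + l') (y + l) + dist y z := by
      have h_split : (l' : V) - l = z + l' - (y + l) + (y - z) := by abel
      rw [dist_eq_norm, dist_eq_norm, dist_eq_norm, h_split]
      exact norm_add_le _ _
    rw [AddSubgroup.coe_sub, ← dist_eq_norm] at h_sep
    linarith [dist_triangle_right (z + (l' : V)) (y + l) k₀, dist_triangle_right y z x,
      Metric.mem_closedBall.1 hyl, Metric.mem_closedBall.1 hzl, Metric.mem_ball.1 hy,
      Metric.mem_ball.1 hz]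
  · refine ⟨0, fun y hy => ?_⟩
    rw [hX _ (h 0 y hy), periodize_eq_zero hX fun l hl => h ⟨l, hl⟩ y hy]

theorem periodize_eq_self {y : V} (hy : y ∈ Metric.ball k₀ (2 * ρ)) : periodize L X y = X y := by
  have h_zero : ∀ l : L, l ≠ 0 → X (y + l) = 0 := fun l hl => hX _ fun hyl => by
    have h_triangle := dist_triangle_right (y + (l : V)) y k₀
    rw [dist_self_add_left] at h_triangle
    rw [Metric.mem_ball] at hy
    linarith [hL _ l.2 (by simpa using hl), Metric.mem_closedBall.1 hyl,
      dist_nonneg (x := y) (y := k₀)]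
  simpa [periodize] using finsum_eq_single (fun l : L => X (y + l)) 0 h_zero

theorem periodize_eventuallyEq (hρ : 0 < ρ) (x : V) :
    ∃ l : L, periodize L X =ᶠ[𝓝 x] fun y => X (y + l) := by
  obtain ⟨l, hl⟩ := exists_forall_ball_periodize_eq hX hL x
  exact ⟨l, Filter.eventually_of_mem (Metric.ball_mem_nhds x hρ) hl⟩

variable [NormedSpace ℝ V] [NormedSpace ℝ F]

theorem contDiff_periodize (hρ : 0 < ρ) {n : WithTop ℕ∞} (hXn : ContDiff ℝ n X) :
    ContDiff ℝ n (periodize L X) := by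
  refine contDiff_iff_contDiffAt.2 fun x => ?_
  obtain ⟨l, hl⟩ := periodize_eventuallyEq hX hL hρ x
  exact (hXn.comp (contDiff_id.add contDiff_const)).contDiffAt.congr_of_eventuallyEq hl

theorem norm_fderiv_periodize_le (hρ : 0 < ρ) {b : ℝ} (hb : ∀ x, ‖fderiv ℝ X x‖ ≤ b) (x : V) :
    ‖fderiv ℝ (periodize L X) x‖ ≤ b := by
  obtain ⟨l, hl⟩ := periodize_eventuallyEq hX hL hρ x
  rw [hl.fderiv_eq, fderiv_comp_add_right]
  exact hb _

end Periodize

/-! ### Diffeomorphisms and the divergence -/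

section Diffeomorphism

variable {V : Type*} [NormedAddCommGroup V] [NormedSpace ℝ V]

theorem exists_homeomorph_id_add [CompleteSpace V] {n : WithTop ℕ∞} (hn : n ≠ 0) {Z : V → V}
    (hZ : ContDiff ℝ n Z) {c : NNReal} (hc : c < 1) (hZc : ∀ x, ‖fderiv ℝ Z x‖ ≤ c) :
    ∃ Φ : V ≃ₜ V, (∀ x, Φ x = x + Z x) ∧ ContDiff ℝ n Φ ∧ ContDiff ℝ n Φ.symm := by
  have hdiff : Differentiable ℝ Z := hZ.differentiable hn
  have h_approx : ApproximatesLinearOn (fun x => x + Z x)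
      (ContinuousLinearEquiv.refl ℝ V : V →L[ℝ] V) Set.univ c := by
    intro x _ y _
    have h_lip := convex_univ.norm_image_sub_le_of_norm_fderiv_le (𝕜 := ℝ) (fun x _ => hdiff x)
      (fun x _ => hZc x) (Set.mem_univ y) (Set.mem_univ x)
    convert! h_lip using 2
    simp only [ContinuousLinearEquiv.coe_refl, ContinuousLinearMap.coe_id', id_eq]
    abel
  have h_small : Subsingleton V ∨
      c < ‖((ContinuousLinearEquiv.refl ℝ V).symm : V →L[ℝ] V)‖₊⁻¹ := by
    refine (subsingleton_or_nontrivial V).imp_right fun (_ : Nontrivial V) => ?_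
    rwa [ContinuousLinearEquiv.refl_symm, ContinuousLinearEquiv.coe_refl,
      ContinuousLinearMap.nnnorm_id, inv_one]
  let Φ := h_approx.toHomeomorph _ h_small
  have hΦ : ContDiff ℝ n Φ := contDiff_id.add hZ
  have h_inv : ∀ x, ∃ e : V ≃L[ℝ] V, HasFDerivAt Φ (e : V →L[ℝ] V) x := by
    intro x
    have hlt : ‖-fderiv ℝ Z x‖ < 1 := by
      rw [norm_neg]
      exact (hZc x).trans_lt hc
    refine ⟨ContinuousLinearEquiv.unitsEquiv ℝ V (Units.oneSub _ hlt), ?_⟩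
    convert! (hasFDerivAt_id x).add (hdiff x).hasFDerivAt using 1
    ext v
    change ((Units.oneSub _ hlt : (V →L[ℝ] V)ˣ) : V →L[ℝ] V) v = _
    simp
  choose e he using h_inv
  exact ⟨Φ, fun _ => rfl, hΦ, Φ.contDiff_symm he hΦ⟩

theorem fderiv_symm_apply_fderiv {Φ : V ≃ₜ V} {x : V} (hΦ : DifferentiableAt ℝ Φ x)
    (hΨ : DifferentiableAt ℝ Φ.symm (Φ x)) (v : V) :
    fderiv ℝ Φ.symm (Φ x) (fderiv ℝ Φ x v) = v := by
  have h_comp := fderiv_comp x hΨ hΦ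
  rw [Φ.symm_comp_self, fderiv_id] at h_comp
  exact (congr($h_comp v)).symm

variable [FiniteDimensional ℝ V]

theorem contDiff_continuousLinearMap_det {n : WithTop ℕ∞} :
    ContDiff ℝ n (fun A : V →L[ℝ] V => A.det) := by
  let b := Module.finBasis ℝ V
  have h_det : ∀ A : V →L[ℝ] V, A.det = Matrix.det (LinearMap.toMatrix b b A) := fun A =>
    (LinearMap.det_toMatrix b _).symm
  have h_entry : ∀ i j, ContDiff ℝ n fun A : V →L[ℝ] V => LinearMap.toMatrix b b A i j := by
    intro i j
    simp only [LinearMap.toMatrix_apply]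
    exact (LinearMap.toContinuousLinearMap (b.coord i)).contDiff.comp
      (ContinuousLinearMap.apply ℝ V (b j)).contDiff
  simp only [h_det, Matrix.det_apply]
  exact ContDiff.sum fun σ _ => (contDiff_prod fun i _ => h_entry _ i).const_smul _

theorem contDiff_det_fderiv {Φ : V → V} (hΦ : ContDiff ℝ ∞ Φ) :
    ContDiff ℝ ∞ fun x => (fderiv ℝ Φ x).det :=
  contDiff_continuousLinearMap_det.comp (hΦ.fderiv_right (m := ∞) (by simp))

variable [MeasurableSpace V] [BorelSpace V] {μ : Measure V} [μ.IsAddHaarMeasure]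
  {Φ : V ≃ₜ V} (hΦ : Differentiable ℝ Φ)
include hΦ

theorem integral_eq_integral_det_smul_comp {F : Type*} [NormedAddCommGroup F] [NormedSpace ℝ F]
    (hJ : ∀ x, 0 < (fderiv ℝ Φ x).det) (h : V → F) :
    ∫ y, h y ∂μ = ∫ x, (fderiv ℝ Φ x).det • h (Φ x) ∂μ := by
  have h_cov := integral_image_eq_integral_abs_det_fderiv_smul μ MeasurableSet.univ
    (fun x _ => (hΦ x).hasFDerivAt.hasFDerivWithinAt) Φ.injective.injOn h
  simpa only [Set.image_univ, Φ.surjective.range_eq, Measure.restrict_univ, abs_of_pos (hJ _)]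
    using h_cov

theorem measure_preimage_symm {S : Set V} (hS : MeasurableSet S) :
    μ (Φ.symm ⁻¹' S) = ∫⁻ x in S, ENNReal.ofReal |(fderiv ℝ Φ x).det| ∂μ := by
  rw [lintegral_abs_det_fderiv_eq_addHaar_image μ hS
    (fun x _ => (hΦ x).hasFDerivAt.hasFDerivWithinAt) Φ.injective.injOn]
  exact congrArg μ (Φ.image_eq_preimage_symm S).symm

theorem quasiMeasurePreserving_symm : Measure.QuasiMeasurePreserving Φ.symm μ μ := by
  refine ⟨Φ.symm.continuous.measurable, Measure.AbsolutelyContinuous.mk fun S hS h0 => ?_⟩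
  rw [Measure.map_apply Φ.symm.continuous.measurable hS, measure_preimage_symm hΦ hS,
    Measure.restrict_eq_zero.2 h0, lintegral_zero_measure]

end Diffeomorphism

section Divergence

variable {d : ℕ}

theorem sum_smul_unitVec (v : E d) : ∑ i, v i • (unitVec i : E d) = v := by
  simpa [unitVec] using (EuclideanSpace.basisFun (Fin d) ℝ).sum_repr v

theorem apply_eq_sum_smul_unitVec {F : Type*} [NormedAddCommGroup F] [NormedSpace ℝ F]
    (L : E d →L[ℝ] F) (v : E d) : L v = ∑ i, v i • L (unitVec i) := by
  conv_lhs => rw [← sum_smul_unitVec v]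
  simp

theorem contDiff_fderiv_apply {F : Type*} [NormedAddCommGroup F] [NormedSpace ℝ F]
    {f : E d → F} (hf : ContDiff ℝ ∞ f) (v : E d) : ContDiff ℝ ∞ fun x => fderiv ℝ f x v :=
  (hf.fderiv_right (m := ∞) (by simp)).clm_apply contDiff_const

theorem fderiv_coord {X : E d → E d} {x : E d} (hX : DifferentiableAt ℝ X x) (i : Fin d)
    (v : E d) : fderiv ℝ (fun x => X x i) x v = fderiv ℝ X x v i := by
  have h_comp := ((EuclideanSpace.proj i : E d →L[ℝ] ℝ).hasFDerivAt.comp x hX.hasFDerivAt).fderiv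
  exact congr($h_comp v)

theorem contDiff_coord {n : WithTop ℕ∞} {X : E d → E d} (hX : ContDiff ℝ n X) (i : Fin d) :
    ContDiff ℝ n fun x => X x i :=
  (EuclideanSpace.proj i : E d →L[ℝ] ℝ).contDiff.comp hX

theorem hasCompactSupport_coord {X : E d → E d} (hX : HasCompactSupport X) (i : Fin d) :
    HasCompactSupport fun x => X x i :=
  hX.comp_left (g := fun v : E d => v i) rfl

/-- The trace on `End(ℝᵈ)`, as a continuous linear functional. -/
def traceCLM : (E d →L[ℝ] E d) →L[ℝ] ℝ :=
  ∑ i, (EuclideanSpace.proj i : E d →L[ℝ] ℝ) ∘L ContinuousLinearMap.apply ℝ (E d) (unitVec i)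

theorem traceCLM_apply (A : E d →L[ℝ] E d) : traceCLM A = ∑ i, A (unitVec i) i := by
  simp [traceCLM]

/-- The divergence of a vector field on `ℝᵈ`. -/
def divergence (X : E d → E d) (x : E d) : ℝ := traceCLM (fderiv ℝ X x)

theorem continuous_divergence {X : E d → E d} (hX : ContDiff ℝ ∞ X) :
    Continuous (divergence X) :=
  traceCLM.continuous.comp (hX.continuous_fderiv (by simp))

theorem integral_mul_divergence {h : E d → ℝ} {X : E d → E d} (hh : ContDiff ℝ ∞ h)
    (hX : ContDiff ℝ ∞ X) (hXs : HasCompactSupport X) :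
    ∫ x, h x * divergence X x = -∫ x, fderiv ℝ h x (X x) := by
  have hXd := hX.differentiable (by simp)
  have h_int : ∀ i, Integrable fun x => h x * fderiv ℝ (fun x => X x i) x (unitVec i) := fun i =>
    (hh.continuous.mul (contDiff_fderiv_apply (contDiff_coord hX i) _).continuous)
      |>.integrable_of_hasCompactSupport
        ((hasCompactSupport_coord hXs i).fderiv_apply ℝ _).mul_left
  have h_int' : ∀ i, Integrable fun x => fderiv ℝ h x (unitVec i) * X x i := fun i =>
    ((contDiff_fderiv_apply hh _).continuous.mul (contDiff_coord hX i).continuous)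
      |>.integrable_of_hasCompactSupport (hasCompactSupport_coord hXs i).mul_left
  have h_parts : ∀ i, ∫ x, h x * fderiv ℝ (fun x => X x i) x (unitVec i)
      = -∫ x, fderiv ℝ h x (unitVec i) * X x i := fun i =>
    integral_mul_fderiv_eq_neg_fderiv_mul_of_integrable (h_int' i) (h_int i)
      ((hh.continuous.mul (contDiff_coord hX i).continuous).integrable_of_hasCompactSupport
        (hasCompactSupport_coord hXs i).mul_left)
      (fun x _ => hh.differentiable (by simp) x)
      (fun x _ => (contDiff_coord hX i).differentiable (by simp) x)
  calc ∫ x, h x * divergence X x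
      = ∫ x, ∑ i, h x * fderiv ℝ (fun x => X x i) x (unitVec i) := by
        simp only [divergence, traceCLM_apply, Finset.mul_sum, fderiv_coord (hXd _)]
    _ = -∫ x, ∑ i, fderiv ℝ h x (unitVec i) * X x i := by
        rw [integral_finsetSum _ fun i _ => h_int i, integral_finsetSum _ fun i _ => h_int' i,
          ← Finset.sum_neg_distrib]
        exact Finset.sum_congr rfl fun i _ => h_parts i
    _ = -∫ x, fderiv ℝ h x (X x) := by
        simp only [apply_eq_sum_smul_unitVec (fderiv ℝ h _) (X _), smul_eq_mul, mul_comm]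

/-- The Piola transform of the vector field `X` under `Φ`, i.e. the pullback of the
`(d - 1)`-form `X ⌟ dx`. -/
def piola (Φ : E d ≃ₜ E d) (X : E d → E d) (x : E d) : E d :=
  (fderiv ℝ Φ x).det • fderiv ℝ Φ.symm (Φ x) (X (Φ x))

section Piola

variable {Φ : E d ≃ₜ E d} {X : E d → E d} (hΦ : ContDiff ℝ ∞ Φ) (hΨ : ContDiff ℝ ∞ Φ.symm)
  (hX : ContDiff ℝ ∞ X)

theorem hasCompactSupport_piola (hXs : HasCompactSupport X) : HasCompactSupport (piola Φ X) :=
  (hXs.comp_homeomorph Φ).mono fun x hx hX0 => hx <| by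
    simp only [piola, show X (Φ x) = 0 from hX0, map_zero, smul_zero]

include hΦ hΨ hX

theorem contDiff_piola : ContDiff ℝ ∞ (piola Φ X) :=
  (contDiff_det_fderiv hΦ).smul
    (((hΨ.fderiv_right (m := ∞) (by simp)).comp hΦ).clm_apply (hX.comp hΦ))

theorem divergence_piola (hXs : HasCompactSupport X) (hJ : ∀ x, 0 < (fderiv ℝ Φ x).det) (x : E d) :
    divergence (piola Φ X) x = (fderiv ℝ Φ x).det * divergence X (Φ x) := by
  have h_left := continuous_divergence (contDiff_piola hΦ hΨ hX)
  have h_right : Continuous fun x => (fderiv ℝ Φ x).det * divergence X (Φ x) :=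
    (contDiff_det_fderiv hΦ).continuous.mul ((continuous_divergence hX).comp Φ.continuous)
  suffices h_ae : ∀ᵐ x, divergence (piola Φ X) x = (fderiv ℝ Φ x).det * divergence X (Φ x) from
    congrFun (h_left.ae_eq_iff_eq volume h_right |>.1 h_ae) x
  refine ae_eq_of_integral_contDiff_smul_eq h_left.locallyIntegrable h_right.locallyIntegrable
    fun h hh _ => ?_
  have hΦd := hΦ.differentiable (by simp)
  have h_chain : ∀ x v, fderiv ℝ (h ∘ Φ.symm) (Φ x) v
      = fderiv ℝ h x (fderiv ℝ Φ.symm (Φ x) v) := fun x v => by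
    rw [fderiv_comp _ (hh.differentiable (by simp) _) (hΨ.differentiable (by simp) _),
      Φ.symm_apply_apply, ContinuousLinearMap.comp_apply]
  calc ∫ x, h x * divergence (piola Φ X) x
      = -∫ x, fderiv ℝ h x (piola Φ X x) :=
        integral_mul_divergence hh (contDiff_piola hΦ hΨ hX) (hasCompactSupport_piola hXs)
    _ = -∫ x, (fderiv ℝ Φ x).det • fderiv ℝ (h ∘ Φ.symm) (Φ x) (X (Φ x)) := by
        simp only [piola, map_smul, h_chain]
    _ = -∫ y, fderiv ℝ (h ∘ Φ.symm) y (X y) := by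
        rw [← integral_eq_integral_det_smul_comp hΦd hJ fun y => fderiv ℝ (h ∘ Φ.symm) y (X y)]
    _ = ∫ y, h (Φ.symm y) * divergence X y := (integral_mul_divergence (hh.comp hΨ) hX hXs).symm
    _ = ∫ x, h x * ((fderiv ℝ Φ x).det * divergence X (Φ x)) := by
        rw [integral_eq_integral_det_smul_comp hΦd hJ]
        simp only [Φ.symm_apply_apply, smul_eq_mul, mul_left_comm]

end Piola

end Divergence

/-! ### Weak derivatives -/

section WeakDerivative

variable {d : ℕ} {j : Fin d} {f g : E d → ℂ}

theorem integrable_ofReal_mul {V : Type*} [TopologicalSpace V] [T2Space V] [MeasurableSpace V]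
    [OpensMeasurableSpace V] {μ : Measure V} {φ : V → ℝ} {f : V → ℂ} (hφ : Continuous φ)
    (hφs : HasCompactSupport φ) (hf : LocallyIntegrable f μ) :
    Integrable (fun k => (φ k : ℂ) * f k) μ := by
  simpa using hf.integrable_smul_left_of_hasCompactSupport hφ hφs

theorem IsWeakPartialDeriv.ae_eq {f' g' : E d → ℂ} (hfg : IsWeakPartialDeriv j f g)
    (hfg' : IsWeakPartialDeriv j f' g') (hf : f =ᵐ[volume] f') (hg : LocallyIntegrable g)
    (hg' : LocallyIntegrable g') : g =ᵐ[volume] g' := by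
  refine ae_eq_of_integral_contDiff_smul_eq hg hg' fun φ hφ hφs => ?_
  have h_test : ∫ k, (fderiv ℝ φ k (unitVec j) : ℂ) * f k
      = ∫ k, (fderiv ℝ φ k (unitVec j) : ℂ) * f' k :=
    integral_congr_ae (hf.mono fun k hk => congrArg _ hk)
  simp only [Complex.real_smul]
  rw [← neg_inj, ← hfg φ hφ hφs, ← hfg' φ hφ hφs, h_test]

theorem integral_divergence_mul {g : Fin d → E d → ℂ} (hf : LocallyIntegrable f)
    (hg : ∀ i, LocallyIntegrable (g i)) (hfg : ∀ i, IsWeakPartialDeriv i f (g i))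
    {X : E d → E d} (hX : ContDiff ℝ ∞ X) (hXs : HasCompactSupport X) :
    ∫ x, (divergence X x : ℂ) * f x = -∫ x, ∑ i, (X x i : ℂ) * g i x := by
  have hX_coord := contDiff_coord hX
  have hXs_coord := hasCompactSupport_coord hXs
  have h_int : ∀ i, Integrable fun x =>
      (fderiv ℝ (fun x => X x i) x (unitVec i) : ℂ) * f x := fun i =>
    integrable_ofReal_mul (contDiff_fderiv_apply (hX_coord i) _).continuous
      ((hXs_coord i).fderiv_apply ℝ _) hf
  calc ∫ x, (divergence X x : ℂ) * f x
      = ∫ x, ∑ i, (fderiv ℝ (fun x => X x i) x (unitVec i) : ℂ) * f x := by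
        simp only [divergence, traceCLM_apply, Complex.ofReal_sum, Finset.sum_mul,
          fderiv_coord (hX.differentiable (by simp) _)]
    _ = -∫ x, ∑ i, (X x i : ℂ) * g i x := by
        rw [integral_finsetSum _ fun i _ => h_int i, integral_finsetSum _ fun i _ =>
          integrable_ofReal_mul (hX_coord i).continuous (hXs_coord i) (hg i),
          ← Finset.sum_neg_distrib]
        exact Finset.sum_congr rfl fun i _ => hfg i _ (hX_coord i) (hXs_coord i)

/-- The weak chain rule: the Piola transform of `φ e_j` turns a test function `φ` for `f ∘ Φ⁻¹`
into an admissible vector field for `f`. -/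
theorem IsWeakPartialDeriv.comp_homeomorph {Φ : E d ≃ₜ E d} (hΦ : ContDiff ℝ ∞ Φ)
    (hΨ : ContDiff ℝ ∞ Φ.symm) (hJ : ∀ x, 0 < (fderiv ℝ Φ x).det) {g : Fin d → E d → ℂ}
    (hf : LocallyIntegrable f) (hg : ∀ i, LocallyIntegrable (g i))
    (hfg : ∀ i, IsWeakPartialDeriv i f (g i)) (j : Fin d) :
    IsWeakPartialDeriv j (fun y => f (Φ.symm y))
      (fun y => ∑ i, (fderiv ℝ Φ.symm y (unitVec j) i : ℂ) * g i (Φ.symm y)) := by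
  intro φ hφ hφs
  let X : E d → E d := fun y => φ y • unitVec j
  have hX : ContDiff ℝ ∞ X := hφ.smul contDiff_const
  have hXs : HasCompactSupport X := hφs.smul_right
  have hΦd := hΦ.differentiable (by simp)
  have h_div : ∀ y, divergence X y = fderiv ℝ φ y (unitVec j) := fun y => by
    rw [divergence, fderiv_smul_const (hφ.differentiable (by simp) y), traceCLM_apply]
    simp [unitVec]
  calc ∫ y, (fderiv ℝ φ y (unitVec j) : ℂ) * f (Φ.symm y)
      = ∫ x, (divergence (piola Φ X) x : ℂ) * f x := by
        rw [integral_eq_integral_det_smul_comp hΦd hJ]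
        simp only [divergence_piola hΦ hΨ hX hXs hJ, h_div, Φ.symm_apply_apply, Complex.real_smul,
          Complex.ofReal_mul, mul_assoc]
    _ = -∫ x, ∑ i, (piola Φ X x i : ℂ) * g i x :=
        integral_divergence_mul hf hg hfg (contDiff_piola hΦ hΨ hX) (hasCompactSupport_piola hXs)
    _ = -∫ y, (φ y : ℂ) * ∑ i, (fderiv ℝ Φ.symm y (unitVec j) i : ℂ) * g i (Φ.symm y) := by
        rw [integral_eq_integral_det_smul_comp hΦd hJ fun y =>
          (φ y : ℂ) * ∑ i, (fderiv ℝ Φ.symm y (unitVec j) i : ℂ) * g i (Φ.symm y)]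
        simp only [piola, X, map_smul, PiLp.smul_apply, smul_eq_mul, Φ.symm_apply_apply,
          Complex.real_smul, Complex.ofReal_mul, Finset.mul_sum, mul_assoc]

end WeakDerivative

/-! ### Sobolev maps and periodic diffeomorphisms -/

section MemL2Loc

variable {d : ℕ} {F : Type*} [NormedAddCommGroup F] {f : E d → F}

/-- Local square integrability. -/
def MemL2Loc (f : E d → F) : Prop :=
  ∀ K : Set (E d), IsCompact K → MemLp f 2 (volume.restrict K)

theorem MemL2Loc.locallyIntegrable (hf : MemL2Loc f) : LocallyIntegrable f := by
  refine locallyIntegrable_iff.2 fun K hK => ?_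
  have : IsFiniteMeasure ((volume : Measure (E d)).restrict K) :=
    isFiniteMeasure_restrict.2 hK.measure_ne_top
  exact (hf K hK).integrable one_le_two

theorem MemL2Loc.sum {ι : Type*} (s : Finset ι) {f : ι → E d → F}
    (hf : ∀ i ∈ s, MemL2Loc (f i)) : MemL2Loc fun x => ∑ i ∈ s, f i x :=
  fun K hK => memLp_finsetSum _ fun i hi => hf i hi K hK

theorem MemL2Loc.continuous_mul {c f : E d → ℂ} (hc : Continuous c) (hf : MemL2Loc f) :
    MemL2Loc fun x => c x * f x := by
  intro K hK
  obtain ⟨M, hM⟩ := hK.exists_bound_of_continuousOn hc.continuousOn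
  refine (hf K hK).of_le_mul (c := M) (hc.aestronglyMeasurable.mul (hf K hK).1) ?_
  filter_upwards [ae_restrict_mem hK.measurableSet] with x hx
  rw [norm_mul]
  gcongr
  exact hM x hx

theorem MemL2Loc.comp_symm {Φ : E d ≃ₜ E d} (hΦ : ContDiff ℝ ∞ Φ) (hf : MemL2Loc f) :
    MemL2Loc fun y => f (Φ.symm y) := by
  intro K hK
  have hK' : IsCompact (Φ.symm '' K) := hK.image Φ.symm.continuous
  have h_meas : Measurable Φ.symm := Φ.symm.continuous.measurable
  obtain ⟨C, hC⟩ :=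
    hK'.exists_bound_of_continuousOn (contDiff_det_fderiv hΦ).continuous.continuousOn
  have h_map_le : Measure.map Φ.symm ((volume : Measure (E d)).restrict K)
      ≤ ENNReal.ofReal C • (volume : Measure (E d)).restrict (Φ.symm '' K) := by
    refine Measure.le_iff.2 fun S hS => ?_
    have h_inter : Φ.symm ⁻¹' S ∩ K = Φ.symm ⁻¹' (S ∩ Φ.symm '' K) := by
      rw [Set.preimage_inter, Set.preimage_image_eq _ Φ.symm.injective]
    rw [Measure.map_apply h_meas hS, Measure.restrict_apply (h_meas hS), h_inter,
      measure_preimage_symm (hΦ.differentiable (by simp)) (hS.inter hK'.measurableSet),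
      Measure.smul_apply, Measure.restrict_apply hS, smul_eq_mul, ← setLIntegral_const]
    exact setLIntegral_mono measurable_const fun x hx => ENNReal.ofReal_le_ofReal (hC x hx.2)
  have h_lp := (hf _ hK').of_measure_le_smul ENNReal.ofReal_ne_top h_map_le
  exact (memLp_map_measure_iff h_lp.1 h_meas.aemeasurable).1 h_lp

end MemL2Loc

namespace SobolevMap

variable {d m : ℕ} {γ : Module.Basis (Fin d) ℝ (E d)}

/-- The composition `U ∘ Φ⁻¹` of a Sobolev map with a diffeomorphism of the torus, given by its
lift `Φ` to `ℝᵈ`. -/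
def compSymm (U : SobolevMap γ m) (Φ : E d ≃ₜ E d) (hΦ : ContDiff ℝ ∞ Φ)
    (hΨ : ContDiff ℝ ∞ Φ.symm) (hJ : ∀ x, 0 < (fderiv ℝ Φ x).det)
    (hper : ∀ l ∈ dualLattice γ, ∀ x, Φ (x + l) = Φ x + l) : SobolevMap γ m where
  toFun y := U.toFun (Φ.symm y)
  grad j y := ∑ i, (fderiv ℝ Φ.symm y (unitVec j) i : ℂ) • U.grad i (Φ.symm y)
  unitary := (quasiMeasurePreserving_symm (hΦ.differentiable (by simp))).ae U.unitary
  periodic l hl := by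
    filter_upwards [(quasiMeasurePreserving_symm (hΦ.differentiable (by simp))).ae
      (U.periodic l hl)] with y hy
    rw [← hy, (Homeomorph.symm_apply_eq Φ).2 (by rw [hper l hl, Φ.apply_symm_apply])]
  memLp a b := MemL2Loc.comp_symm hΦ (U.memLp a b)
  memLp_grad j a b := by
    simp only [Matrix.sum_apply, Matrix.smul_apply, smul_eq_mul]
    exact MemL2Loc.sum _ fun i _ => MemL2Loc.continuous_mul
      (Complex.continuous_ofReal.comp
        (contDiff_coord (contDiff_fderiv_apply hΨ (unitVec j)) i).continuous)
      (MemL2Loc.comp_symm hΦ (U.memLp_grad i a b))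
  isWeakPartialDeriv j a b := by
    simp only [Matrix.sum_apply, Matrix.smul_apply, smul_eq_mul]
    exact IsWeakPartialDeriv.comp_homeomorph hΦ hΨ hJ
      (f := fun k => U.toFun k a b) (g := fun i k => U.grad i k a b)
      (MemL2Loc.locallyIntegrable (U.memLp a b))
      (fun i => MemL2Loc.locallyIntegrable (U.memLp_grad i a b))
      (fun i => U.isWeakPartialDeriv i a b) j

theorem grad_ae_eq {U V : SobolevMap γ m} (h : U.toFun =ᵐ[volume] V.toFun) (j : Fin d) :
    U.grad j =ᵐ[volume] V.grad j := by
  have h_entry : ∀ a b, ∀ᵐ k, U.grad j k a b = V.grad j k a b := fun a b =>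
    (U.isWeakPartialDeriv j a b).ae_eq (V.isWeakPartialDeriv j a b)
      (h.mono fun k hk => congr($hk a b)) (MemL2Loc.locallyIntegrable (U.memLp_grad j a b))
      (MemL2Loc.locallyIntegrable (V.memLp_grad j a b))
  filter_upwards [ae_all_iff.2 fun a => ae_all_iff.2 (h_entry a)] with k hk
  exact Matrix.ext hk

/-- `U(· + l)` is a Sobolev map with gradient `∇U(· + l)`, and it agrees with `U`. -/
theorem grad_periodic (U : SobolevMap γ m) (j : Fin d) {l : E d} (hl : l ∈ dualLattice γ) :
    ∀ᵐ k : E d, U.grad j (k + l) = U.grad j k := by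
  let Φ : E d ≃ₜ E d := (Homeomorph.addRight l).symm
  have hΦ_apply : ∀ k, Φ k = k - l := fun k => (sub_eq_add_neg k l).symm
  have hΦ_fderiv : ∀ k, fderiv ℝ Φ k = ContinuousLinearMap.id ℝ (E d) := fun k => by
    rw [show ⇑Φ = fun k => k - l from funext hΦ_apply, fderiv_sub_const, fderiv_fun_id]
  have hΨ_fderiv : ∀ k, fderiv ℝ Φ.symm k = ContinuousLinearMap.id ℝ (E d) := fun k => by
    rw [show ⇑Φ.symm = fun k => k + l from rfl, fderiv_add_const, fderiv_fun_id]
  have hΦ : ContDiff ℝ ∞ Φ := contDiff_id.add contDiff_const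
  have hΨ : ContDiff ℝ ∞ Φ.symm := contDiff_id.add contDiff_const
  let V := U.compSymm Φ hΦ hΨ (fun k => by rw [hΦ_fderiv]; simp [ContinuousLinearMap.det])
    (fun l' _ k => by rw [hΦ_apply, hΦ_apply]; abel)
  have hV_grad : ∀ k, V.grad j k = U.grad j (k + l) := fun k => by
    change ∑ i, (fderiv ℝ Φ.symm k (unitVec j) i : ℂ) • U.grad i (k + l) = _
    simp [hΨ_fderiv, unitVec, ite_smul]
  filter_upwards [grad_ae_eq (U := V) (V := U) (U.periodic l hl) j] with k hk
  rw [← hV_grad, hk]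

end SobolevMap

open scoped Matrix.Norms.Frobenius

/-! ### The Hilbert–Schmidt pairing and gradients -/

section Pairing

variable {m : ℕ}

/-- The real inner product `Re tr(Mᴴ N)` on `M_m(ℂ)`, as a bilinear form. -/
def pairing : Matrix (Fin m) (Fin m) ℂ →ₗ[ℝ] Matrix (Fin m) (Fin m) ℂ →ₗ[ℝ] ℝ :=
  LinearMap.mk₂ ℝ (fun M N => ((Mᴴ * N).trace).re)
    (fun M M' N => by simp [add_mul]) (fun s M N => by simp)
    (fun M N N' => by simp [mul_add]) (fun s M N => by simp)

theorem pairing_apply (M N : Matrix (Fin m) (Fin m) ℂ) : pairing M N = ((Mᴴ * N).trace).re := rfl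

theorem pairing_self (M : Matrix (Fin m) (Fin m) ℂ) : pairing M M = matNormSq M := rfl

theorem pairing_comm (M N : Matrix (Fin m) (Fin m) ℂ) : pairing M N = pairing N M := by
  rw [pairing_apply, ← Complex.conj_re, ← Complex.star_def, ← Matrix.trace_conjTranspose,
    Matrix.conjTranspose_mul, Matrix.conjTranspose_conjTranspose, pairing_apply]

theorem frobenius_norm_sq (M : Matrix (Fin m) (Fin m) ℂ) : ‖M‖ ^ 2 = ∑ a, ∑ b, ‖M a b‖ ^ 2 := by
  rw [Matrix.frobenius_norm_def, ← Real.sqrt_eq_rpow, Real.sq_sqrt (by positivity)]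
  simp only [Real.rpow_two]

theorem matNormSq_eq_norm_sq (M : Matrix (Fin m) (Fin m) ℂ) : matNormSq M = ‖M‖ ^ 2 := by
  rw [frobenius_norm_sq, Finset.sum_comm, matNormSq, Matrix.trace, Complex.re_sum]
  refine Finset.sum_congr rfl fun b _ => ?_
  rw [Matrix.diag_apply, Matrix.mul_apply, Complex.re_sum]
  refine Finset.sum_congr rfl fun a _ => ?_
  rw [Matrix.conjTranspose_apply, Complex.star_def, mul_comm, Complex.mul_conj,
    Complex.ofReal_re, Complex.normSq_eq_norm_sq]

theorem matNormSq_nonneg (M : Matrix (Fin m) (Fin m) ℂ) : 0 ≤ matNormSq M := by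
  rw [matNormSq_eq_norm_sq]; positivity

theorem norm_entry_le (M : Matrix (Fin m) (Fin m) ℂ) (a b : Fin m) : ‖M a b‖ ≤ ‖M‖ := by
  refine abs_le_of_sq_le_sq' ?_ (norm_nonneg M) |>.2
  rw [frobenius_norm_sq]
  calc ‖M a b‖ ^ 2 ≤ ∑ b, ‖M a b‖ ^ 2 :=
        Finset.single_le_sum (f := fun b => ‖M a b‖ ^ 2) (fun _ _ => sq_nonneg _)
          (Finset.mem_univ b)
    _ ≤ _ := Finset.single_le_sum (f := fun a => ∑ b, ‖M a b‖ ^ 2)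
          (fun _ _ => Finset.sum_nonneg fun _ _ => sq_nonneg _) (Finset.mem_univ a)

theorem norm_trace_mul_le (M N : Matrix (Fin m) (Fin m) ℂ) : ‖(M * N).trace‖ ≤ ‖M‖ * ‖N‖ := by
  have h_norm : ∀ M : Matrix (Fin m) (Fin m) ℂ,
      √(∑ i : Fin m × Fin m, ‖M i.1 i.2‖ ^ 2) = ‖M‖ := fun M => by
    rw [Fintype.sum_prod_type' fun a b => ‖M a b‖ ^ 2, ← frobenius_norm_sq,
      Real.sqrt_sq (norm_nonneg M)]
  calc ‖(M * N).trace‖ = ‖∑ i : Fin m × Fin m, M i.1 i.2 * Nᵀ i.1 i.2‖ := by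
        simp only [Matrix.trace, Matrix.diag_apply, Matrix.mul_apply, Fintype.sum_prod_type,
          Matrix.transpose_apply]
    _ ≤ ∑ i : Fin m × Fin m, ‖M i.1 i.2‖ * ‖Nᵀ i.1 i.2‖ :=
        (norm_sum_le _ _).trans_eq (by simp only [norm_mul])
    _ ≤ √(∑ i : Fin m × Fin m, ‖M i.1 i.2‖ ^ 2) * √(∑ i : Fin m × Fin m, ‖Nᵀ i.1 i.2‖ ^ 2) :=
        Real.sum_mul_le_sqrt_mul_sqrt _ _ _
    _ = ‖M‖ * ‖N‖ := by rw [h_norm, h_norm, Matrix.frobenius_norm_transpose]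

theorem abs_pairing_le (M N : Matrix (Fin m) (Fin m) ℂ) : |pairing M N| ≤ ‖M‖ * ‖N‖ :=
  (Complex.abs_re_le_norm _).trans <|
    (norm_trace_mul_le _ _).trans_eq (by rw [Matrix.frobenius_norm_conjTranspose])

theorem norm_sq_of_mem_unitaryGroup {u : Matrix (Fin m) (Fin m) ℂ}
    (hu : u ∈ Matrix.unitaryGroup (Fin m) ℂ) : ‖u‖ ^ 2 = m := by
  rw [← matNormSq_eq_norm_sq, matNormSq, ← Matrix.star_eq_conjTranspose,
    Matrix.mem_unitaryGroup_iff'.1 hu]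
  simp

end Pairing

section Gradient

variable {d m : ℕ} (p : Fin d → Matrix (Fin m) (Fin m) ℂ)

/-- The differential `v ↦ ∑ᵢ vᵢ pᵢ` of a matrix-valued map with partial derivatives `pᵢ`. -/
def differential : E d →ₗ[ℝ] Matrix (Fin m) (Fin m) ℂ :=
  ∑ i, (EuclideanSpace.proj i : E d →L[ℝ] ℝ).toLinearMap.smulRight (p i)

theorem differential_apply (v : E d) : differential p v = ∑ i, v i • p i := by
  simp [differential]

theorem differential_unitVec (i : Fin d) : differential p (unitVec i) = p i := by
  simp [differential_apply, unitVec]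

theorem norm_differential_le (v : E d) : ‖differential p v‖ ≤ ‖v‖ * ∑ i, ‖p i‖ := by
  rw [differential_apply, Finset.mul_sum]
  refine (norm_sum_le _ _).trans (Finset.sum_le_sum fun i _ => ?_)
  rw [norm_smul]
  gcongr
  exact PiLp.norm_apply_le v i

/-- The quadratic form `∑ᵢ ⟨pᵢ, Dp(A eᵢ)⟩` of a gradient `p`, as a linear function of the
coefficient `A`. -/
def energyForm : (E d →L[ℝ] E d) →ₗ[ℝ] ℝ :=
  ∑ i, pairing (p i) ∘ₗ differential p ∘ₗ
    (ContinuousLinearMap.apply ℝ (E d) (unitVec i)).toLinearMap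

theorem energyForm_apply (A : E d →L[ℝ] E d) :
    energyForm p A = ∑ i, pairing (p i) (differential p (A (unitVec i))) := by
  simp [energyForm]

theorem energyForm_one : energyForm p 1 = ∑ i, matNormSq (p i) := by
  simp [energyForm_apply, differential_unitVec, pairing_self]

theorem star_apply_unitVec (A : E d →L[ℝ] E d) (i : Fin d) :
    star A (unitVec i) = ∑ j, A (unitVec j) i • unitVec j := by
  rw [← sum_smul_unitVec (star A (unitVec i))]
  refine Finset.sum_congr rfl fun j _ => ?_
  congr 1
  have h_coord : ∀ (v : E d) (k : Fin d), v k = ⟪v, unitVec k⟫_ℝ := fun v k => by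
    rw [unitVec, EuclideanSpace.inner_single_right]; simp
  rw [h_coord, h_coord, ContinuousLinearMap.star_eq_adjoint,
    ContinuousLinearMap.adjoint_inner_left, real_inner_comm]

theorem energyForm_mul_star (B : E d →L[ℝ] E d) :
    energyForm p (B * star B) = ∑ j, matNormSq (differential p (B (unitVec j))) := by
  simp only [energyForm_apply, mul_apply_eq_comp, star_apply_unitVec, map_sum, map_smul]
  rw [Finset.sum_comm]
  refine Finset.sum_congr rfl fun j _ => ?_
  rw [← pairing_self]
  conv_rhs => enter [1, 2]; rw [differential_apply]
  simp only [map_sum, map_smul, LinearMap.sum_apply, LinearMap.smul_apply]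

theorem energyForm_star (A : E d →L[ℝ] E d) : energyForm p (star A) = energyForm p A := by
  simp only [energyForm_apply, star_apply_unitVec, differential_apply p (A _), map_sum, map_smul,
    differential_unitVec]
  rw [Finset.sum_comm]
  simp only [pairing_comm]

theorem sq_sum_norm_le : (∑ i, ‖p i‖) ^ 2 ≤ d * ∑ i, matNormSq (p i) := by
  simpa [matNormSq_eq_norm_sq] using
    sq_sum_le_card_mul_sum_sq (s := Finset.univ) (f := fun i => ‖p i‖)

theorem norm_unitVec (i : Fin d) : ‖(unitVec i : E d)‖ = 1 := by
  simp [unitVec]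

theorem abs_energyForm_le (A : E d →L[ℝ] E d) :
    |energyForm p A| ≤ d * ‖A‖ * ∑ i, matNormSq (p i) := by
  calc |energyForm p A| ≤ ∑ i, ‖p i‖ * (‖A‖ * ∑ l, ‖p l‖) := by
        rw [energyForm_apply]
        refine (Finset.abs_sum_le_sum_abs _ _).trans (Finset.sum_le_sum fun i _ => ?_)
        refine (abs_pairing_le _ _).trans ?_
        gcongr
        refine (norm_differential_le p _).trans ?_
        gcongr
        simpa [norm_unitVec] using A.le_opNorm (unitVec i)
    _ = ‖A‖ * (∑ i, ‖p i‖) ^ 2 := by rw [← Finset.sum_mul]; ring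
    _ ≤ ‖A‖ * (d * ∑ i, matNormSq (p i)) := by gcongr; exact sq_sum_norm_le p
    _ = d * ‖A‖ * ∑ i, matNormSq (p i) := by ring

/-- The first variation of the Dirichlet density of a map with gradient `p` under a deformation
with linearization `A`: `tr A |p|² - 2 ∑ᵢ ⟨pᵢ, Dp(A eᵢ)⟩`. -/
def stress (A : E d →L[ℝ] E d) : ℝ :=
  traceCLM A * ∑ i, matNormSq (p i) - 2 * energyForm p A

theorem SobolevMap.grad_compSymm {γ : Module.Basis (Fin d) ℝ (E d)} (U : SobolevMap γ m)
    {Φ : E d ≃ₜ E d} (hΦ : ContDiff ℝ ∞ Φ) (hΨ : ContDiff ℝ ∞ Φ.symm)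
    (hJ : ∀ x, 0 < (fderiv ℝ Φ x).det)
    (hper : ∀ l ∈ dualLattice γ, ∀ x, Φ (x + l) = Φ x + l) (j : Fin d) (y : E d) :
    (U.compSymm Φ hΦ hΨ hJ hper).grad j y
      = differential (fun i => U.grad i (Φ.symm y)) (fderiv ℝ Φ.symm y (unitVec j)) := by
  simp only [differential_apply, ← Complex.coe_smul]
  rfl

end Gradient

/-! ### Expansion of the Jacobian at the identity -/

section Jacobian

variable {d : ℕ}

theorem hasDerivAt_det_one_add_smul {n : Type*} [Fintype n] [DecidableEq n] (M : Matrix n n ℝ) :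
    HasDerivAt (fun s : ℝ => (1 + s • M).det) M.trace 0 := by
  have h_eval : ∀ s : ℝ, (1 + s • M).det
      = (1 + (Polynomial.X : Polynomial ℝ) • M.map Polynomial.C).det.eval s := fun s => by
    simp [eval_det, ← Matrix.smul_eq_mul_diagonal]
  rw [← Matrix.derivative_det_one_add_X_smul, funext h_eval]
  exact Polynomial.hasDerivAt _ 0

theorem hasFDerivAt_det_one_add :
    HasFDerivAt (fun A : E d →L[ℝ] E d => (1 + A).det) traceCLM 0 := by
  have h_diff : DifferentiableAt ℝ (fun A : E d →L[ℝ] E d => (1 + A).det) 0 :=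
    ((contDiff_continuousLinearMap_det (n := 1)).comp
      (contDiff_const.add contDiff_id)).differentiable one_ne_zero 0
  refine h_diff.hasFDerivAt.congr_fderiv (ContinuousLinearMap.ext fun B => ?_)
  let b := (EuclideanSpace.basisFun (Fin d) ℝ).toBasis
  have h_toMatrix : ∀ s : ℝ, (1 + s • B).det = (1 + s • LinearMap.toMatrix b b B).det := fun s => by
    rw [ContinuousLinearMap.det, ← LinearMap.det_toMatrix b]
    congr 1
    simp [LinearMap.toMatrix_one]
  have h_trace : (LinearMap.toMatrix b b B).trace = traceCLM B := by
    simp [Matrix.trace, LinearMap.toMatrix_apply, traceCLM_apply, b, unitVec]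
  have h_line := h_diff.hasFDerivAt.hasLineDerivAt B
  simp only [HasLineDerivAt, zero_add, h_toMatrix] at h_line
  rw [← h_trace, (hasDerivAt_det_one_add_smul _).unique h_line]

theorem hasFDerivAt_inverse_one_add {R : Type*} [NormedRing R] [HasSummableGeomSeries R]
    [NormedAlgebra ℝ R] :
    HasFDerivAt (fun A : R => Ring.inverse (1 + A)) (-ContinuousLinearMap.id ℝ R) 0 := by
  have h_inv := hasFDerivAt_ringInverse (𝕜 := ℝ) (1 : Rˣ)
  rw [Units.val_one, ← add_zero (1 : R)] at h_inv
  refine (h_inv.comp 0 ((hasFDerivAt_id (0 : R)).const_add 1)).congr_fderiv ?_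
  ext B
  simp

theorem det_one : (1 : E d →L[ℝ] E d).det = 1 := LinearMap.det_id

theorem hasFDerivAt_inverse_one_add_mul_star {R : Type*} [NormedRing R] [HasSummableGeomSeries R]
    [NormedAlgebra ℝ R] [StarRing R] [StarModule ℝ R] [ContinuousStar R] :
    HasFDerivAt (fun A : R => Ring.inverse (1 + A) * star (Ring.inverse (1 + A)))
      (-ContinuousLinearMap.id ℝ R - (starL' ℝ).toContinuousLinearMap) 0 := by
  have h_inv := hasFDerivAt_inverse_one_add (R := R)
  refine (h_inv.mul' h_inv.star).congr_fderiv (ContinuousLinearMap.ext fun B => ?_)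
  simp [sub_eq_neg_add]

/-- The coefficient `det(1 + A) (1 + A)⁻¹ (1 + A)⁻ᵀ` of the Dirichlet energy in the coordinates
`x ↦ x + A x`. -/
def dirichletCoeff (A : E d →L[ℝ] E d) : E d →L[ℝ] E d :=
  (1 + A).det • (Ring.inverse (1 + A) * star (Ring.inverse (1 + A)))

theorem energyForm_dirichletCoeff {m : ℕ} (p : Fin d → Matrix (Fin m) (Fin m) ℂ)
    (A : E d →L[ℝ] E d) : energyForm p (dirichletCoeff A)
      = (1 + A).det * ∑ j, matNormSq (differential p (Ring.inverse (1 + A) (unitVec j))) := by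
  rw [dirichletCoeff, map_smul, energyForm_mul_star, smul_eq_mul]

theorem hasFDerivAt_dirichletCoeff : HasFDerivAt (dirichletCoeff (d := d))
    (traceCLM.smulRight 1 +
      (-ContinuousLinearMap.id ℝ _ - (starL' ℝ).toContinuousLinearMap)) 0 := by
  refine ((hasFDerivAt_det_one_add (d := d)).smul
    (hasFDerivAt_inverse_one_add_mul_star (R := E d →L[ℝ] E d))).congr_fderiv ?_
  rw [add_zero, det_one, one_smul, Ring.inverse_one, star_one, mul_one, add_comm]

theorem isLittleO_dirichletCoeff :
    (fun A : E d →L[ℝ] E d => dirichletCoeff A - 1 - (traceCLM A • 1 - A - star A))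
      =o[𝓝 0] fun A => A := by
  have h_zero : dirichletCoeff (0 : E d →L[ℝ] E d) = 1 := by
    rw [dirichletCoeff, add_zero, det_one, one_smul, Ring.inverse_one, star_one, mul_one]
  refine hasFDerivAt_dirichletCoeff.isLittleO.congr (fun A => ?_) fun A => sub_zero A
  rw [h_zero, sub_zero]
  congr 1
  exact (add_sub_assoc _ _ _).symm.trans (congrArg (· - star A) (sub_eq_add_neg _ _).symm)

theorem eventually_transformed_dirichlet_le (m : ℕ) {ε : ℝ} (hε : 0 < ε) :
    ∀ᶠ A : E d →L[ℝ] E d in 𝓝 0, ∀ p : Fin d → Matrix (Fin m) (Fin m) ℂ,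
      (1 + A).det * ∑ j, matNormSq (differential p (Ring.inverse (1 + A) (unitVec j)))
        ≤ ∑ j, matNormSq (p j) + stress p A + ε * ‖A‖ * ∑ j, matNormSq (p j) := by
  have hε' : 0 < ε / (d + 1) := by positivity
  filter_upwards [isLittleO_dirichletCoeff.def hε'] with A hA p
  have h_expand : energyForm p (dirichletCoeff A - 1 - (traceCLM A • 1 - A - star A))
      = (1 + A).det * ∑ j, matNormSq (differential p (Ring.inverse (1 + A) (unitVec j)))
        - ∑ j, matNormSq (p j) - stress p A := by
    simp only [map_sub, map_smul, energyForm_one, energyForm_star, energyForm_dirichletCoeff,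
      smul_eq_mul, stress]
    ring
  have h_rem : |energyForm p (dirichletCoeff A - 1 - (traceCLM A • 1 - A - star A))|
      ≤ ε * ‖A‖ * ∑ j, matNormSq (p j) :=
    calc _ ≤ d * (ε / (d + 1) * ‖A‖) * ∑ j, matNormSq (p j) := by
          refine (abs_energyForm_le p _).trans ?_
          gcongr
          exact Finset.sum_nonneg fun _ _ => matNormSq_nonneg _
      _ ≤ ε * ‖A‖ * ∑ j, matNormSq (p j) := by
          rw [← mul_assoc]
          gcongr
          · exact Finset.sum_nonneg fun _ _ => matNormSq_nonneg _
          · rw [mul_div_assoc', div_le_iff₀ (by positivity)]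
            linarith
  linarith [le_abs_self (energyForm p (dirichletCoeff A - 1 - (traceCLM A • 1 - A - star A)))]

/-- The estimates on an endomorphism `A` close to `0` under which the deformation with
linearization `1 + A` changes the densities of the functional in a controlled way. -/
structure HasJacobianBounds (m : ℕ) (C ε : ℝ) (A : E d →L[ℝ] E d) : Prop where
  abs_det_sub_one_le : |(1 + A).det - 1| ≤ C * ‖A‖
  norm_adjugate_sub_one_le : ‖(1 + A).det • Ring.inverse (1 + A) - 1‖ ≤ C * ‖A‖
  dirichlet_le : ∀ p : Fin d → Matrix (Fin m) (Fin m) ℂ,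
    (1 + A).det * ∑ j, matNormSq (differential p (Ring.inverse (1 + A) (unitVec j)))
      ≤ ∑ j, matNormSq (p j) + stress p A + ε * ‖A‖ * ∑ j, matNormSq (p j)

theorem exists_eventually_hasJacobianBounds (d m : ℕ) :
    ∃ C : ℝ, 0 ≤ C ∧
      ∀ ε > 0, ∀ᶠ A : E d →L[ℝ] E d in 𝓝 0, HasJacobianBounds m C ε A := by
  have h_det := hasFDerivAt_det_one_add (d := d)
  have h_adj := h_det.smul (hasFDerivAt_inverse_one_add (R := E d →L[ℝ] E d))
  obtain ⟨C₁, hC₁, h_det_bound⟩ := h_det.isBigO_sub.exists_nonneg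
  obtain ⟨C₂, -, h_adj_bound⟩ := h_adj.isBigO_sub.exists_nonneg
  refine ⟨max C₁ C₂, le_max_of_le_left hC₁, fun ε hε => ?_⟩
  filter_upwards [h_det_bound.bound, h_adj_bound.bound,
    eventually_transformed_dirichlet_le m hε] with A hA₁ hA₂ hA₃
  simp only [add_zero, det_one, Ring.inverse_one, one_smul, sub_zero, Pi.smul_apply',
    Real.norm_eq_abs] at hA₁ hA₂
  exact ⟨hA₁.trans (by gcongr; exact le_max_left _ _),
    hA₂.trans (by gcongr; exact le_max_right _ _), hA₃⟩

end Jacobian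

/-! ### The Berry connection -/

section Frame

variable {d m : ℕ} {γ : Module.Basis (Fin d) ℝ (E d)}

theorem norm_character (l y : E d) : ‖character l y‖ = 1 := by
  rw [character, mul_comm, Complex.norm_exp_ofReal_mul_I]

theorem inner_tau_tau (l : E d) (φ ψ : Hf γ) : ⟪tau γ l φ, tau γ l ψ⟫_ℂ = ⟪φ, ψ⟫_ℂ := by
  rw [L2.inner_def, L2.inner_def]
  refine integral_congr_ae ?_
  filter_upwards [coeFn_tau γ l φ, coeFn_tau γ l ψ] with y hφ hψ
  have h_unit : character l y * starRingEnd ℂ (character l y) = 1 := by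
    rw [Complex.mul_conj, Complex.normSq_eq_norm_sq, norm_character]
    simp
  simp only [hφ, hψ, RCLike.inner_apply, map_mul]
  linear_combination ψ y * starRingEnd ℂ (φ y) * h_unit

variable {χ : Fin m → E d → Hf γ} (hs : ∀ a, ContDiff ℝ ∞ (χ a))
include hs

theorem contDiff_frameDeriv (j : Fin d) (a : Fin m) : ContDiff ℝ ∞ (frameDeriv χ j a) :=
  contDiff_fderiv_apply (hs a) _

theorem contDiff_berry (j : Fin d) : ContDiff ℝ ∞ (berry χ j) := by
  have h_sum : berry χ j = fun k => ∑ a, ∑ b,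
      ⟪χ a k, frameDeriv χ j b k⟫_ℂ • Matrix.single a b (1 : ℂ) := by
    ext1 k
    rw [Matrix.matrix_eq_sum_single (berry χ j k)]
    simp [berry]
  rw [h_sum]
  exact ContDiff.sum fun a _ => ContDiff.sum fun b _ =>
    ((hs a).inner ℂ (contDiff_frameDeriv hs j b)).smul contDiff_const

variable (hτ : ∀ a, MemHTau γ (χ a))
include hτ

theorem frame_sub {l : E d} (hl : l ∈ dualLattice γ) (a : Fin m) (k : E d) :
    χ a (k - l) = tau γ l (χ a k) := by
  have h_left : Continuous fun k => χ a (k - l) := (hs a).continuous.comp (continuous_sub_right l)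
  have h_right : Continuous fun k => tau γ l (χ a k) :=
    (tau γ l).continuous.comp (hs a).continuous
  exact congrFun ((h_left.ae_eq_iff_eq volume h_right).1 ((hτ a).2 l hl)) k

theorem frameDeriv_sub {l : E d} (hl : l ∈ dualLattice γ) (j : Fin d) (a : Fin m) (k : E d) :
    frameDeriv χ j a (k - l) = tau γ l (frameDeriv χ j a k) := by
  have h_comp : HasFDerivAt (fun k => tau γ l (χ a k))
      (((tau γ l).restrictScalars ℝ).comp (fderiv ℝ (χ a) k)) k :=
    ((tau γ l).restrictScalars ℝ).hasFDerivAt.comp k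
      ((hs a).differentiable (by simp) k).hasFDerivAt
  rw [frameDeriv, ← fderiv_comp_sub, funext (frame_sub hs hτ hl a), h_comp.fderiv]
  rfl

theorem berry_add {l : E d} (hl : l ∈ dualLattice γ) (j : Fin d) (k : E d) :
    berry χ j (k + l) = berry χ j k := by
  ext a b
  rw [← add_sub_cancel_right k l]
  simp only [berry, Matrix.of_apply, frame_sub hs hτ hl, frameDeriv_sub hs hτ hl, inner_tau_tau,
    sub_add_cancel]

theorem exists_norm_berry_le : ∃ M, 0 ≤ M ∧ ∀ j k, ‖berry χ j k‖ ≤ M := by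
  choose M hM using fun j => exists_norm_le_of_continuous_of_periodic (dualBasis γ)
    (contDiff_berry hs j).continuous
    fun l hl k => berry_add hs hτ (mem_dualLattice_iff_mem_span.2 hl) j k
  obtain ⟨M', hM'⟩ := (Set.finite_range M).bddAbove
  exact ⟨max M' 0, le_max_right _ _,
    fun j k => (hM j k).trans (le_max_of_le_left (hM' ⟨j, rfl⟩))⟩

theorem exists_norm_berry_sub_le :
    ∃ L, 0 ≤ L ∧ ∀ j x y, ‖berry χ j x - berry χ j y‖ ≤ L * ‖x - y‖ := by
  choose L hL using fun j => exists_norm_sub_le_of_contDiff_of_periodic (dualBasis γ)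
    ((contDiff_berry hs j).of_le (by simp))
    fun l hl k => berry_add hs hτ (mem_dualLattice_iff_mem_span.2 hl) j k
  obtain ⟨L', hL'⟩ := (Set.finite_range L).bddAbove
  refine ⟨max L' 0, le_max_right _ _, fun j x y => (hL j x y).trans ?_⟩
  gcongr
  exact le_max_of_le_left (hL' ⟨j, rfl⟩)

end Frame

/-! ### The densities of the localization functional -/

section Forms

variable {m : ℕ} (u p q b b₁ : Matrix (Fin m) (Fin m) ℂ) (a : Fin m) (s : ℝ)

/-- The integrand `tr((u pᴴ - p uᴴ) b)` that couples `U` to the Berry connection. -/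
def berryForm : ℂ := ((u * pᴴ - p * uᴴ) * b).trace

/-- The integrand `[uᴴ (p + b u)]_{aa}` of the centre of the `a`-th Wannier function. -/
def centerForm : ℂ := (uᴴ * (p + b * u)) a a

theorem norm_berryForm_le : ‖berryForm u p b‖ ≤ 2 * ‖u‖ * ‖p‖ * ‖b‖ := by
  refine (norm_trace_mul_le _ _).trans ?_
  gcongr
  calc ‖u * pᴴ - p * uᴴ‖ ≤ ‖u‖ * ‖pᴴ‖ + ‖p‖ * ‖uᴴ‖ :=
        (norm_sub_le _ _).trans
          (add_le_add (Matrix.frobenius_norm_mul _ _) (Matrix.frobenius_norm_mul _ _))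
    _ = 2 * ‖u‖ * ‖p‖ := by simp only [Matrix.frobenius_norm_conjTranspose]; ring

theorem norm_centerForm_le : ‖centerForm u p b a‖ ≤ ‖u‖ * (‖p‖ + ‖b‖ * ‖u‖) := by
  calc ‖centerForm u p b a‖ ≤ ‖uᴴ‖ * ‖p + b * u‖ :=
        (norm_entry_le _ a a).trans (Matrix.frobenius_norm_mul _ _)
    _ ≤ ‖u‖ * (‖p‖ + ‖b‖ * ‖u‖) := by
        rw [Matrix.frobenius_norm_conjTranspose]
        gcongr
        exact (norm_add_le _ _).trans (by gcongr; exact Matrix.frobenius_norm_mul _ _)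

theorem smul_berryForm_sub_berryForm : s • berryForm u q b₁ - berryForm u p b
    = berryForm u (s • q - p) b₁ + berryForm u p (b₁ - b) := by
  simp only [berryForm, ← Matrix.trace_smul, ← Matrix.trace_sub, ← Matrix.trace_add,
    Matrix.conjTranspose_sub, Matrix.conjTranspose_smul, star_trivial]
  congr 1
  simp only [mul_sub, sub_mul, Matrix.mul_smul, Matrix.smul_mul, smul_sub]
  abel

theorem smul_centerForm_sub_centerForm : s • centerForm u q b₁ a - centerForm u p b a
    = centerForm u (s • q - p) (s • b₁ - b) a := by
  simp only [centerForm, ← Matrix.smul_apply, ← Matrix.sub_apply]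
  refine congrArg (fun N : Matrix (Fin m) (Fin m) ℂ => N a a) ?_
  simp only [mul_sub, sub_mul, mul_add, Matrix.mul_smul, Matrix.smul_mul, smul_add]
  abel

theorem trace_conjTranspose_mul_self : (pᴴ * p).trace = (matNormSq p : ℂ) := by
  refine Complex.ext rfl ?_
  rw [Complex.ofReal_im, ← Complex.conj_eq_iff_im, ← Complex.star_def,
    ← Matrix.trace_conjTranspose, Matrix.conjTranspose_mul, Matrix.conjTranspose_conjTranspose]

end Forms

theorem integrableOn_dualCell {d : ℕ} {γ : Module.Basis (Fin d) ℝ (E d)} {F : Type*}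
    [NormedAddCommGroup F] {f : E d → F}
    (hf : LocallyIntegrable f) : IntegrableOn f (dualCell γ) :=
  integrableOn_congr_set_ae dualCell_ae_eq_centeredCell |>.2 <|
    (hf.integrableOn_isCompact (isBounded_centeredCell _ _).isCompact_closure).mono_set
      subset_closure

namespace SobolevMap

variable {d m : ℕ} {γ : Module.Basis (Fin d) ℝ (E d)} (U : SobolevMap γ m)

theorem aestronglyMeasurable_of_entries
    {f : E d → Matrix (Fin m) (Fin m) ℂ} (hf : ∀ a b, MemL2Loc fun k => f k a b) :
    AEStronglyMeasurable f := by
  have h_sum : f = fun k => ∑ a, ∑ b, f k a b • Matrix.single a b (1 : ℂ) := by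
    refine funext fun k => (Matrix.matrix_eq_sum_single (f k)).trans ?_
    simp
  rw [h_sum]
  exact Finset.aestronglyMeasurable_fun_sum _ fun a _ =>
    Finset.aestronglyMeasurable_fun_sum _ fun b _ =>
      (MemL2Loc.locallyIntegrable (hf a b)).aestronglyMeasurable.smul_const _

@[fun_prop]
theorem aestronglyMeasurable_toFun : AEStronglyMeasurable U.toFun :=
  aestronglyMeasurable_of_entries U.memLp

@[fun_prop]
theorem aestronglyMeasurable_grad (j : Fin d) : AEStronglyMeasurable (U.grad j) :=
  aestronglyMeasurable_of_entries (U.memLp_grad j)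

theorem locallyIntegrable_matNormSq_grad (j : Fin d) :
    LocallyIntegrable fun k => matNormSq (U.grad j k) := by
  simp only [matNormSq_eq_norm_sq, frobenius_norm_sq]
  exact locallyIntegrable_finsetSum _ fun a _ => locallyIntegrable_finsetSum _ fun b _ =>
    locallyIntegrable_iff.2 fun K hK => (U.memLp_grad j a b K hK).integrable_norm_pow two_ne_zero

theorem locallyIntegrable_gradNormSq : LocallyIntegrable (gradNormSq U) :=
  locallyIntegrable_finsetSum _ fun j _ => U.locallyIntegrable_matNormSq_grad j

theorem gradNormSq_nonneg (k : E d) : 0 ≤ gradNormSq U k :=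
  Finset.sum_nonneg fun _ _ => matNormSq_nonneg _

theorem sq_norm_grad_le (j : Fin d) (k : E d) : ‖U.grad j k‖ ^ 2 ≤ gradNormSq U k := by
  rw [← matNormSq_eq_norm_sq]
  exact Finset.single_le_sum (f := fun j => matNormSq (U.grad j k))
    (fun _ _ => matNormSq_nonneg _) (Finset.mem_univ j)

theorem norm_grad_le (j : Fin d) (k : E d) : ‖U.grad j k‖ ≤ 1 + gradNormSq U k := by
  nlinarith [sq_nonneg (‖U.grad j k‖ - 1), U.sq_norm_grad_le j k]

theorem ae_norm_toFun : ∀ᵐ k, ‖U.toFun k‖ = √m := by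
  filter_upwards [U.unitary] with k hk
  rw [← norm_sq_of_mem_unitaryGroup hk, Real.sqrt_sq (norm_nonneg _)]

theorem locallyIntegrable_of_norm_le {F : Type*} [NormedAddCommGroup F] {f : E d → F} {C : ℝ}
    (hf : AEStronglyMeasurable f) (hC : ∀ᵐ k, ‖f k‖ ≤ C * (1 + gradNormSq U k)) :
    LocallyIntegrable f := by
  refine LocallyIntegrable.mono (f := fun k => C * (1 + gradNormSq U k)) ?_ hf
    (hC.mono fun k hk => hk.trans (le_abs_self _))
  exact ((locallyIntegrable_const (1 : ℝ)).add U.locallyIntegrable_gradNormSq).smul C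

theorem locallyIntegrable_norm_grad (j : Fin d) : LocallyIntegrable fun k => ‖U.grad j k‖ :=
  U.locallyIntegrable_of_norm_le (C := 1) (by fun_prop) <|
    Eventually.of_forall fun k => by simpa using U.norm_grad_le j k

variable {χ : Fin m → E d → Hf γ} (hs : ∀ a, ContDiff ℝ ∞ (χ a)) (hτ : ∀ a, MemHTau γ (χ a))
include hs hτ

theorem locallyIntegrable_berryForm (j : Fin d) :
    LocallyIntegrable fun k => berryForm (U.toFun k) (U.grad j k) (berry χ j k) := by
  obtain ⟨M, -, hM⟩ := exists_norm_berry_le hs hτ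
  have h_berry := (contDiff_berry hs j).continuous.aestronglyMeasurable (μ := volume)
  refine U.locallyIntegrable_of_norm_le (C := 2 * √m * M) ?_ ?_
  · unfold berryForm
    fun_prop
  · filter_upwards [U.ae_norm_toFun] with k hk
    refine (norm_berryForm_le _ _ _).trans ?_
    rw [hk, mul_assoc, mul_assoc (2 * √m), mul_comm M]
    gcongr
    exacts [by linarith [U.gradNormSq_nonneg k], U.norm_grad_le j k, hM j k]

theorem locallyIntegrable_centerForm (j : Fin d) (a : Fin m) :
    LocallyIntegrable fun k => centerForm (U.toFun k) (U.grad j k) (berry χ j k) a := by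
  obtain ⟨M, hM0, hM⟩ := exists_norm_berry_le hs hτ
  have h_berry := (contDiff_berry hs j).continuous.aestronglyMeasurable (μ := volume)
  refine U.locallyIntegrable_of_norm_le (C := √m * (1 + M * √m)) ?_ ?_
  · unfold centerForm
    exact (continuous_id.matrix_elem a a).comp_aestronglyMeasurable (by fun_prop)
  · filter_upwards [U.ae_norm_toFun] with k hk
    have hG := U.gradNormSq_nonneg k
    calc _ ≤ √m * (‖U.grad j k‖ + ‖berry χ j k‖ * √m) := hk ▸ norm_centerForm_le _ _ _ a
      _ ≤ √m * ((1 + gradNormSq U k) + M * √m * (1 + gradNormSq U k)) := by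
        refine mul_le_mul_of_nonneg_left (add_le_add (U.norm_grad_le j k) ?_) (Real.sqrt_nonneg _)
        calc ‖berry χ j k‖ * √m ≤ M * √m := by gcongr; exact hM j k
          _ ≤ M * √m * (1 + gradNormSq U k) :=
            le_mul_of_one_le_right (by positivity) (by linarith)
      _ = √m * (1 + M * √m) * (1 + gradNormSq U k) := by ring

omit hτ in
theorem locallyIntegrable_norm_frameDeriv_sq (j : Fin d) :
    LocallyIntegrable fun k => m * ∑ a, ‖frameDeriv χ j a k‖ ^ 2 :=
  (continuous_const.mul <| continuous_finsetSum _ fun a _ =>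
    (contDiff_frameDeriv hs j a).continuous.norm.pow 2).locallyIntegrable

omit hτ in
theorem exists_forall_localizationFunctional_eq (c : ℝ) : ∃ K : ℝ, ∀ V : SobolevMap γ m,
    localizationFunctional c χ V = c * (∫ k in dualCell γ, gradNormSq V k) + K
      + (∑ j, torusIntegral γ c fun k =>
          berryForm (V.toFun k) (V.grad j k) (berry χ j k)).re
      + (∑ a, ∑ j, (torusIntegral γ c fun k =>
          centerForm (V.toFun k) (V.grad j k) (berry χ j k) a) ^ 2).re := by
  refine ⟨c * ∑ j, ∫ k in dualCell γ, m * ∑ a, ‖frameDeriv χ j a k‖ ^ 2, fun V => ?_⟩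
  have h_dirichlet : ∀ j, (torusIntegral γ c fun k => ((V.grad j k)ᴴ * V.grad j k).trace
        + m * ∑ a, ((‖frameDeriv χ j a k‖ ^ 2 : ℝ) : ℂ))
      = ((c * ((∫ k in dualCell γ, matNormSq (V.grad j k))
        + ∫ k in dualCell γ, m * ∑ a, ‖frameDeriv χ j a k‖ ^ 2) : ℝ) : ℂ) := fun j => by
    rw [← integral_add (integrableOn_dualCell (V.locallyIntegrable_matNormSq_grad j))
      (integrableOn_dualCell (locallyIntegrable_norm_frameDeriv_sq hs j)), torusIntegral,
      Complex.ofReal_mul, ← integral_complex_ofReal]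
    simp only [trace_conjTranspose_mul_self, Complex.ofReal_add, Complex.ofReal_mul,
      Complex.ofReal_sum, Complex.ofReal_natCast]
  have h_sum : (∑ j, torusIntegral γ c fun k => ((V.grad j k)ᴴ * V.grad j k).trace
        + m * ∑ a, ((‖frameDeriv χ j a k‖ ^ 2 : ℝ) : ℂ)).re
      = c * (∫ k in dualCell γ, gradNormSq V k)
        + c * ∑ j, ∫ k in dualCell γ, m * ∑ a, ‖frameDeriv χ j a k‖ ^ 2 := by
    unfold gradNormSq
    rw [Finset.sum_congr rfl fun j _ => h_dirichlet j, ← Complex.ofReal_sum, Complex.ofReal_re,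
      ← Finset.mul_sum, Finset.sum_add_distrib, mul_add,
      integral_finsetSum _ fun j _ => integrableOn_dualCell (V.locallyIntegrable_matNormSq_grad j)]
  rw [← h_sum, localizationFunctional, Complex.add_re, Complex.add_re]
  rfl

end SobolevMap

/-! ### Periodic deformations -/

section Deformation

variable {ι V : Type*} [NormedAddCommGroup V] [NormedSpace ℝ V]

/-- The homeomorphism `Φ` is an orientation preserving diffeomorphism that commutes with the
translations by the lattice spanned by `b` and is equal to `x ↦ x + Y x` near the fundamental domain
centered at `k₀`. -/
structure IsPeriodicDeformation (b : Module.Basis ι ℝ V) (k₀ : V) (Y : V → V) (Φ : V ≃ₜ V) :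
    Prop where
  contDiff : ContDiff ℝ ∞ Φ
  contDiff_symm : ContDiff ℝ ∞ Φ.symm
  det_pos : ∀ x, 0 < (fderiv ℝ Φ x).det
  map_add : ∀ l ∈ Submodule.span ℤ (Set.range b), ∀ x, Φ (x + l) = Φ x + l
  eventuallyEq : ∀ x ∈ centeredCell b k₀, Φ =ᶠ[𝓝 x] fun y => y + Y y

variable {b : Module.Basis ι ℝ V} {k₀ : V} {Y : V → V} {ρ : ℝ}

theorem periodize_eventuallyEq_self (hρ : 0 < ρ)
    (hL : ∀ l ∈ Submodule.span ℤ (Set.range b), l ≠ 0 → 4 * ρ < ‖l‖)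
    (hB : Metric.closedBall k₀ ρ ⊆ centeredCell b k₀) (hY : ∀ x ∉ Metric.closedBall k₀ ρ, Y x = 0)
    {x : V} (hx : x ∈ centeredCell b k₀) :
    periodize (Submodule.span ℤ (Set.range b)).toAddSubgroup Y =ᶠ[𝓝 x] Y := by
  let L := (Submodule.span ℤ (Set.range b)).toAddSubgroup
  by_cases hxB : x ∈ Metric.closedBall k₀ ρ
  · have hx2 : x ∈ Metric.ball k₀ (2 * ρ) := Metric.closedBall_subset_ball (by linarith) hxB
    filter_upwards [Metric.isOpen_ball.mem_nhds hx2] with y hy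
    exact periodize_eq_self hY hL hy
  · obtain ⟨⟨l, hl⟩, h_eq⟩ := periodize_eventuallyEq (L := L) hY hL hρ x
    by_cases hl0 : l = 0
    · filter_upwards [h_eq] with y hy
      simpa only [hl0, add_zero] using hy
    · have hxl : x + l ∉ Metric.closedBall k₀ ρ := fun h =>
        hl0 (eq_zero_of_add_mem_centeredCell b k₀ hl hx (hB h))
      have h_near : ∀ᶠ y in 𝓝 x, y + l ∉ Metric.closedBall k₀ ρ :=
        (continuous_add_const l).continuousAt.eventually
          (Metric.isClosed_closedBall.isOpen_compl.mem_nhds hxl)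
      filter_upwards [h_eq, h_near, Metric.isClosed_closedBall.isOpen_compl.mem_nhds hxB]
        with y hy hyl hyB
      rw [hy, hY _ hyl, hY _ hyB]

theorem exists_isPeriodicDeformation [CompleteSpace V] (hρ : 0 < ρ)
    (hL : ∀ l ∈ Submodule.span ℤ (Set.range b), l ≠ 0 → 4 * ρ < ‖l‖)
    (hB : Metric.closedBall k₀ ρ ⊆ centeredCell b k₀) (hY : ∀ x ∉ Metric.closedBall k₀ ρ, Y x = 0)
    (hYs : ContDiff ℝ ∞ Y) {c : NNReal} (hc : c < 1) (hYc : ∀ x, ‖fderiv ℝ Y x‖ ≤ c)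
    (hJ : ∀ x, 0 < (1 + fderiv ℝ Y x).det) :
    ∃ Φ : V ≃ₜ V, IsPeriodicDeformation b k₀ Y Φ := by
  let L := (Submodule.span ℤ (Set.range b)).toAddSubgroup
  have hZ : ContDiff ℝ ∞ (periodize L Y) := contDiff_periodize (L := L) hY hL hρ hYs
  obtain ⟨Φ, hΦ, hΦs, hΨs⟩ :=
    exists_homeomorph_id_add (by simp) hZ hc (norm_fderiv_periodize_le (L := L) hY hL hρ hYc)
  have hΦ_eq : ⇑Φ = fun x => x + periodize L Y x := funext hΦ
  refine ⟨Φ, hΦs, hΨs, fun x => ?_, fun l hl x => ?_, fun x hx => ?_⟩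
  · obtain ⟨l, hl⟩ := periodize_eventuallyEq (L := L) hY hL hρ x
    rw [hΦ_eq, fderiv_fun_add differentiableAt_fun_id (hZ.differentiable (by simp) x),
      fderiv_fun_id, hl.fderiv_eq, fderiv_comp_add_right]
    exact hJ _
  · rw [hΦ, hΦ, periodize_add (L := L) Y hl]
    abel
  · filter_upwards [periodize_eventuallyEq_self hρ hL hB hY hx] with y hy
    rw [hΦ, hy]

theorem eventually_forall_smul {α F : Type*} [NormedAddCommGroup F] [NormedSpace ℝ F] {f : α → F}
    {M : ℝ} (hf : ∀ x, ‖f x‖ ≤ M) {p : F → Prop} (hp : ∀ᶠ v in 𝓝 0, p v) :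
    ∀ᶠ s : ℝ in 𝓝 0, ∀ x, p (s • f x) := by
  obtain ⟨δ, hδ, h_ball⟩ := Metric.eventually_nhds_iff_ball.1 hp
  have h_lim : Tendsto (fun s : ℝ => |s| * M) (𝓝 0) (𝓝 0) :=
    (continuous_abs.mul_const M).tendsto' 0 0 (by simp)
  filter_upwards [h_lim.eventually (gt_mem_nhds hδ)] with s hs x
  refine h_ball _ (mem_ball_zero_iff.2 (lt_of_le_of_lt ?_ hs))
  rw [norm_smul, Real.norm_eq_abs]
  gcongr
  exact hf x

theorem exists_norm_fderiv_le [FiniteDimensional ℝ V] {X : V → V}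
    (hX : ∀ x ∉ Metric.closedBall k₀ ρ, X x = 0) (hXs : ContDiff ℝ ∞ X) :
    ∃ M, ∀ x, ‖fderiv ℝ X x‖ ≤ M :=
  ((HasCompactSupport.intro (isCompact_closedBall k₀ ρ) fun _ hx => hX _ hx).fderiv ℝ
    ).exists_bound_of_continuous (hXs.continuous_fderiv (by simp))

theorem eventually_exists_isPeriodicDeformation [FiniteDimensional ℝ V] (hρ : 0 < ρ)
    (hL : ∀ l ∈ Submodule.span ℤ (Set.range b), l ≠ 0 → 4 * ρ < ‖l‖)
    (hB : Metric.closedBall k₀ ρ ⊆ centeredCell b k₀) {X : V → V}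
    (hX : ∀ x ∉ Metric.closedBall k₀ ρ, X x = 0) (hXs : ContDiff ℝ ∞ X) :
    ∀ᶠ s : ℝ in 𝓝 0, ∃ Φ : V ≃ₜ V, IsPeriodicDeformation b k₀ (fun x => s • X x) Φ := by
  have := FiniteDimensional.complete ℝ V
  obtain ⟨M, hM⟩ := exists_norm_fderiv_le hX hXs
  have h_norm : ∀ᶠ A : V →L[ℝ] V in 𝓝 0, ‖A‖ ≤ (1 / 2 : NNReal) := by
    filter_upwards [Metric.closedBall_mem_nhds (0 : V →L[ℝ] V) (ε := 1 / 2) (by norm_num)]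
      with A hA
    simpa using mem_closedBall_zero_iff.1 hA
  have h_det : ∀ᶠ A : V →L[ℝ] V in 𝓝 0, 0 < (1 + A).det := by
    have h_cont : Continuous fun A : V →L[ℝ] V => (1 + A).det :=
      (contDiff_continuousLinearMap_det (n := 0)).continuous.comp (continuous_const_add 1)
    refine h_cont.continuousAt.eventually (lt_mem_nhds ?_)
    simp only [add_zero]
    exact zero_lt_one.trans_eq LinearMap.det_id.symm
  filter_upwards [eventually_forall_smul hM (h_norm.and h_det)] with s hs
  have h_fderiv : ∀ x, fderiv ℝ (fun x => s • X x) x = s • fderiv ℝ X x := fun x =>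
    fderiv_fun_const_smul (hXs.differentiable (by simp) x) s
  exact exists_isPeriodicDeformation hρ hL hB (fun x hx => by rw [hX x hx, smul_zero])
    (hXs.const_smul s) (c := 1 / 2) (by norm_num [← NNReal.coe_lt_coe])
    (fun x => by rw [h_fderiv]; exact (hs x).1) (fun x => by rw [h_fderiv]; exact (hs x).2)

namespace IsPeriodicDeformation

variable {Φ : V ≃ₜ V} (h : IsPeriodicDeformation b k₀ Y Φ) {x : V} (hx : x ∈ centeredCell b k₀)
include h

theorem differentiable : Differentiable ℝ Φ := h.contDiff.differentiable (by simp)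

section Pointwise

include hx

theorem apply_eq : Φ x = x + Y x := (h.eventuallyEq x hx).eq_of_nhds

theorem fderiv_eq (hY : DifferentiableAt ℝ Y x) : fderiv ℝ Φ x = 1 + fderiv ℝ Y x := by
  rw [(h.eventuallyEq x hx).fderiv_eq, fderiv_fun_add differentiableAt_fun_id hY, fderiv_fun_id]
  rfl

end Pointwise

variable [FiniteDimensional ℝ V] [MeasurableSpace V] [BorelSpace V] (μ : Measure V)
  [μ.IsAddHaarMeasure]

theorem isAddFundamentalDomain_image [Finite ι] :
    IsAddFundamentalDomain (Submodule.span ℤ (Set.range b)).toAddSubgroup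
      (Φ '' centeredCell b k₀) μ :=
  (isAddFundamentalDomain_centeredCell b k₀ μ).image_of_equiv Φ.toEquiv
    (quasiMeasurePreserving_symm h.differentiable) (Equiv.refl _) fun l x => by
      change Φ (l.1 + x) = l.1 + Φ x
      rw [add_comm, h.map_add l.1 l.2, add_comm]

variable {F : Type*} [NormedAddCommGroup F] [NormedSpace ℝ F] {f : V → F}

theorem setIntegral_centeredCell_eq [Finite ι]
    (hf : ∀ l ∈ Submodule.span ℤ (Set.range b), ∀ᵐ x ∂μ, f (x + l) = f x) :
    ∫ x in centeredCell b k₀, f x ∂μ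
      = ∫ x in centeredCell b k₀, (fderiv ℝ Φ x).det • f (Φ x) ∂μ := by
  have h_cov := integral_image_eq_integral_abs_det_fderiv_smul μ
    (measurableSet_centeredCell b k₀)
    (fun x _ => (h.differentiable x).hasFDerivAt.hasFDerivWithinAt) Φ.injective.injOn f
  simp only [abs_of_pos (h.det_pos _)] at h_cov
  have : Countable (Submodule.span ℤ (Set.range b)).toAddSubgroup :=
    inferInstanceAs (Countable (Submodule.span ℤ (Set.range b)))
  rw [← h_cov]
  refine setIntegral_eq_of_ae_invariant (isAddFundamentalDomain_centeredCell b k₀ μ)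
    (h.isAddFundamentalDomain_image μ) fun l => ?_
  filter_upwards [hf l.1 l.2] with x hx
  change f (l.1 + x) = f x
  rw [add_comm, hx]

theorem integrableOn_centeredCell [Finite ι] (hf : LocallyIntegrable f μ) :
    IntegrableOn (fun x => (fderiv ℝ Φ x).det • f (Φ x)) (centeredCell b k₀) μ := by
  have h_int : IntegrableOn f (Φ '' centeredCell b k₀) μ := by
    have h_compact := (isBounded_centeredCell b k₀).isCompact_closure
    exact (hf.integrableOn_isCompact (h_compact.image Φ.continuous)).mono_set
      (Set.image_mono subset_closure)
  have h_abs := (integrableOn_image_iff_integrableOn_abs_det_fderiv_smul μ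
    (measurableSet_centeredCell b k₀)
    (fun x _ => (h.differentiable x).hasFDerivAt.hasFDerivWithinAt) Φ.injective.injOn f).1 h_int
  simpa only [abs_of_pos (h.det_pos _)] using h_abs

end IsPeriodicDeformation

end Deformation

/-! ### The first variation -/

section PointwiseBounds

variable {d m : ℕ} {p : Fin d → Matrix (Fin m) (Fin m) ℂ} {T : E d →L[ℝ] E d} {D δ η L M P : ℝ}

theorem norm_smul_differential_sub_le (hT : ‖D • T - 1‖ ≤ δ) (j : Fin d) :
    ‖D • differential p (T (unitVec j)) - p j‖ ≤ δ * ∑ i, ‖p i‖ := by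
  have h_sub : D • differential p (T (unitVec j)) - p j
      = differential p ((D • T - 1) (unitVec j)) := by
    rw [sub_apply, smul_apply, map_sub, map_smul, one_apply_eq_self,
      differential_unitVec]
  rw [h_sub]
  refine (norm_differential_le p _).trans ?_
  gcongr
  simpa [norm_unitVec] using (D • T - 1).le_of_opNorm_le hT (unitVec j)

variable {u q q₀ b₀ b₁ : Matrix (Fin m) (Fin m) ℂ} (hL : 0 ≤ L) (hδ : 0 ≤ δ)
  (hη : 0 ≤ η) (hq : ‖D • q - q₀‖ ≤ δ * P) (hb : ‖b₁ - b₀‖ ≤ L * η) (hM : ‖b₁‖ ≤ M)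
include hL hδ hη hq hb hM

theorem norm_smul_berryForm_sub_le (hP : ‖q₀‖ ≤ P) :
    ‖D • berryForm u q b₁ - berryForm u q₀ b₀‖ ≤ 2 * ‖u‖ * (M + L) * ((δ + η) * P) := by
  have hM0 : 0 ≤ M := (norm_nonneg _).trans hM
  have hP0 : 0 ≤ P := (norm_nonneg _).trans hP
  calc ‖D • berryForm u q b₁ - berryForm u q₀ b₀‖
      ≤ 2 * ‖u‖ * ‖D • q - q₀‖ * ‖b₁‖ + 2 * ‖u‖ * ‖q₀‖ * ‖b₁ - b₀‖ := by
        rw [smul_berryForm_sub_berryForm]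
        exact norm_add_le_of_le (norm_berryForm_le _ _ _) (norm_berryForm_le _ _ _)
    _ ≤ 2 * ‖u‖ * (δ * P) * M + 2 * ‖u‖ * P * (L * η) := by gcongr
    _ ≤ 2 * ‖u‖ * (M + L) * ((δ + η) * P) := by
        have h_cross : 0 ≤ 2 * ‖u‖ * (M * η + L * δ) * P := by positivity
        linarith

theorem norm_smul_centerForm_sub_le (hD : |D - 1| ≤ δ) (hP : 1 ≤ P) (a : Fin m) :
    ‖D • centerForm u q b₁ a - centerForm u q₀ b₀ a‖
      ≤ ‖u‖ * (1 + (M + L) * ‖u‖) * ((δ + η) * P) := by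
  have hM0 : 0 ≤ M := (norm_nonneg _).trans hM
  have h_berry : ‖D • b₁ - b₀‖ ≤ (M + L) * ((δ + η) * P) :=
    calc ‖D • b₁ - b₀‖ = ‖(D - 1) • b₁ + (b₁ - b₀)‖ := by congr 1; module
      _ ≤ δ * M + L * η := by
        refine norm_add_le_of_le ?_ hb
        rw [norm_smul, Real.norm_eq_abs]
        gcongr
      _ ≤ (M + L) * (δ + η) := by nlinarith [mul_nonneg hM0 hη, mul_nonneg hL hδ]
      _ ≤ (M + L) * ((δ + η) * P) := by
        gcongr
        exact le_mul_of_one_le_right (by positivity) hP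
  calc ‖D • centerForm u q b₁ a - centerForm u q₀ b₀ a‖
      ≤ ‖u‖ * (‖D • q - q₀‖ + ‖D • b₁ - b₀‖ * ‖u‖) := by
        rw [smul_centerForm_sub_centerForm]
        exact norm_centerForm_le _ _ _ a
    _ ≤ ‖u‖ * ((δ + η) * P + (M + L) * ((δ + η) * P) * ‖u‖) := by
        gcongr
        exact hq.trans (by gcongr; linarith)
    _ = ‖u‖ * (1 + (M + L) * ‖u‖) * ((δ + η) * P) := by ring

end PointwiseBounds

theorem stress_eq_sum {d m : ℕ} (p : Fin d → Matrix (Fin m) (Fin m) ℂ) (A : E d →L[ℝ] E d) :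
    stress p A = (∑ i, A (unitVec i) i) * ∑ i, matNormSq (p i)
      - 2 * ∑ i, ∑ l, A (unitVec i) l * pairing (p i) (p l) := by
  simp only [stress, traceCLM_apply, energyForm_apply, differential_apply, map_sum, map_smul,
    smul_eq_mul]

namespace SobolevMap

variable {d m : ℕ} {γ : Module.Basis (Fin d) ℝ (E d)} (U : SobolevMap γ m)

theorem locallyIntegrable_pairing (i l : Fin d) :
    LocallyIntegrable fun k => pairing (U.grad i k) (U.grad l k) := by
  refine U.locallyIntegrable_of_norm_le (C := 1) ?_ (Eventually.of_forall fun k => ?_)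
  · have h_trace : Continuous fun M : Matrix (Fin m) (Fin m) ℂ => M.trace.re :=
      Complex.continuous_re.comp continuous_id.matrix_trace
    exact h_trace.comp_aestronglyMeasurable (by fun_prop)
  · calc |pairing (U.grad i k) (U.grad l k)| ≤ ‖U.grad i k‖ * ‖U.grad l k‖ := abs_pairing_le _ _
      _ ≤ 1 * (1 + gradNormSq U k) := by
        nlinarith [U.sq_norm_grad_le i k, U.sq_norm_grad_le l k,
          sq_nonneg (‖U.grad i k‖ - ‖U.grad l k‖)]

theorem integrable_stress {A : E d → E d →L[ℝ] E d} (hA : Continuous A)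
    (hAs : HasCompactSupport A) : Integrable fun k => stress (fun i => U.grad i k) (A k) := by
  have h_entry : ∀ i l, Continuous fun k => A k (unitVec i) l := fun i l => by fun_prop
  have h_supp : ∀ i l, HasCompactSupport fun k => A k (unitVec i) l := fun i l =>
    hAs.comp_left (g := fun B : E d →L[ℝ] E d => B (unitVec i) l) (by simp)
  simp only [stress_eq_sum]
  refine .sub ?_ (.const_mul (integrable_finsetSum _ fun i _ => integrable_finsetSum _ fun l _ =>
    (U.locallyIntegrable_pairing i l).integrable_smul_left_of_hasCompactSupport
      (h_entry i l) (h_supp i l)) 2)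
  simp only [Finset.sum_mul]
  exact integrable_finsetSum _ fun i _ =>
    U.locallyIntegrable_gradNormSq.integrable_smul_left_of_hasCompactSupport
      (h_entry i i) (h_supp i i)

/-- The weight that controls the change of the lower order terms of the functional under a
deformation with displacement field `Y`. -/
def deformationWeight (Y : E d → E d) (k : E d) : ℝ :=
  (‖fderiv ℝ Y k‖ + ‖Y k‖) * (1 + ∑ j, ‖U.grad j k‖)

theorem integrable_norm_fderiv_mul_gradNormSq {Y : E d → E d} (hY : ContDiff ℝ ∞ Y)
    (hYs : HasCompactSupport Y) : Integrable fun k => ‖fderiv ℝ Y k‖ * gradNormSq U k :=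
  U.locallyIntegrable_gradNormSq.integrable_smul_left_of_hasCompactSupport
    (hY.continuous_fderiv (by simp)).norm (hYs.fderiv ℝ).norm

theorem integrable_deformationWeight {Y : E d → E d} (hY : ContDiff ℝ ∞ Y)
    (hYs : HasCompactSupport Y) : Integrable (U.deformationWeight Y) := by
  have h_loc : LocallyIntegrable fun k => 1 + ∑ j, ‖U.grad j k‖ :=
    (locallyIntegrable_const (1 : ℝ)).add <|
      locallyIntegrable_finsetSum _ fun j _ => U.locallyIntegrable_norm_grad j
  have h_cont : Continuous fun k => ‖fderiv ℝ Y k‖ + ‖Y k‖ :=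
    (hY.continuous_fderiv (by simp)).norm.add hY.continuous.norm
  exact h_loc.integrable_smul_left_of_hasCompactSupport h_cont ((hYs.fderiv ℝ).norm.add hYs.norm)

theorem deformationWeight_smul {s : ℝ} (hs : 0 ≤ s) (X : E d → E d) :
    U.deformationWeight (fun x => s • X x) = fun k => s * U.deformationWeight X k := by
  ext k
  rw [deformationWeight, show (fun x => s • X x) = s • X from rfl, fderiv_const_smul_field]
  simp only [Pi.smul_apply, norm_smul, Real.norm_of_nonneg hs, deformationWeight]
  ring

theorem norm_grad_le_one_add_sum (j : Fin d) (x : E d) :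
    ‖U.grad j x‖ ≤ 1 + ∑ i, ‖U.grad i x‖ := by
  linarith [Finset.single_le_sum (f := fun i => ‖U.grad i x‖) (fun _ _ => norm_nonneg _)
    (Finset.mem_univ j)]

theorem mul_weight_le_deformationWeight {C κ κ' : ℝ} (hC : 0 ≤ C) (hκ' : 0 ≤ κ') (hκ : κ ≤ κ')
    (Y : E d → E d) (x : E d) :
    κ * ((C * ‖fderiv ℝ Y x‖ + ‖Y x‖) * (1 + ∑ j, ‖U.grad j x‖))
      ≤ κ' * (C + 1) * U.deformationWeight Y x := by
  calc κ * ((C * ‖fderiv ℝ Y x‖ + ‖Y x‖) * (1 + ∑ j, ‖U.grad j x‖))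
      ≤ κ' * (((C + 1) * (‖fderiv ℝ Y x‖ + ‖Y x‖)) * (1 + ∑ j, ‖U.grad j x‖)) := by
        gcongr
        nlinarith [norm_nonneg (fderiv ℝ Y x), mul_nonneg hC (norm_nonneg (Y x))]
    _ = κ' * (C + 1) * U.deformationWeight Y x := by
        rw [deformationWeight]
        ring

end SobolevMap

section Push

variable {d m : ℕ} {γ : Module.Basis (Fin d) ℝ (E d)} {k₀ : E d} {Y : E d → E d} {Φ : E d ≃ₜ E d}

theorem inverse_fderiv (hΦ : Differentiable ℝ Φ) (hΨ : Differentiable ℝ Φ.symm) (x : E d) :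
    Ring.inverse (fderiv ℝ Φ x) = fderiv ℝ Φ.symm (Φ x) := by
  have h_left : fderiv ℝ Φ.symm (Φ x) * fderiv ℝ Φ x = 1 :=
    ContinuousLinearMap.ext fun v => fderiv_symm_apply_fderiv (hΦ x) (hΨ _) v
  have h_right : fderiv ℝ Φ x * fderiv ℝ Φ.symm (Φ x) = 1 := by
    refine ContinuousLinearMap.ext fun v => ?_
    simpa using fderiv_symm_apply_fderiv (Φ := Φ.symm) (x := Φ x) (hΨ _) (hΦ _) v
  exact Ring.inverse_unit ⟨_, _, h_right, h_left⟩

theorem IsPeriodicDeformation.setIntegral_dualCell_sub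
    (h : IsPeriodicDeformation (dualBasis γ) k₀ Y Φ) {F : Type*} [NormedAddCommGroup F]
    [NormedSpace ℝ F] {f g : E d → F} (hf : ∀ l ∈ dualLattice γ, ∀ᵐ k, f (k + l) = f k)
    (hg : ∀ l ∈ dualLattice γ, ∀ᵐ k, g (k + l) = g k) (hfi : LocallyIntegrable f)
    (hgi : LocallyIntegrable g) :
    (∫ k in dualCell γ, f k) - ∫ k in dualCell γ, g k
      = ∫ x in centeredCell (dualBasis γ) k₀, ((fderiv ℝ Φ x).det • f (Φ x) - g x) := by
  rw [setIntegral_dualCell_eq_setIntegral_centeredCell k₀ hf,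
    setIntegral_dualCell_eq_setIntegral_centeredCell k₀ hg,
    h.setIntegral_centeredCell_eq volume fun l hl => hf l (mem_dualLattice_iff_mem_span.2 hl),
    integral_sub (h.integrableOn_centeredCell volume hfi)]
  exact (hgi.integrableOn_isCompact (isBounded_centeredCell _ k₀).isCompact_closure).mono_set
    subset_closure

namespace SobolevMap

variable (U : SobolevMap γ m) (h : IsPeriodicDeformation (dualBasis γ) k₀ Y Φ)

/-- The deformed map `U ∘ Φ⁻¹`. -/
def deform : SobolevMap γ m :=
  U.compSymm Φ h.contDiff h.contDiff_symm h.det_pos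
    fun l hl => h.map_add l (mem_dualLattice_iff_mem_span.1 hl)

theorem deform_toFun_apply (x : E d) : (U.deform h).toFun (Φ x) = U.toFun x :=
  congrArg U.toFun (Φ.symm_apply_apply x)

theorem deform_grad_apply (hY : Differentiable ℝ Y) {x : E d}
    (hx : x ∈ centeredCell (dualBasis γ) k₀) (j : Fin d) :
    (U.deform h).grad j (Φ x)
      = differential (fun i => U.grad i x) (Ring.inverse (1 + fderiv ℝ Y x) (unitVec j)) := by
  rw [deform, grad_compSymm, Φ.symm_apply_apply, ← h.fderiv_eq hx (hY x),
    inverse_fderiv h.differentiable (h.contDiff_symm.differentiable (by simp))]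

theorem gradNormSq_periodic {l : E d} (hl : l ∈ dualLattice γ) :
    ∀ᵐ k, gradNormSq U (k + l) = gradNormSq U k := by
  filter_upwards [ae_all_iff.2 fun j => U.grad_periodic j hl] with k hk
  simp only [gradNormSq, hk]

variable {U h} {C ε : ℝ}

theorem dirichlet_deform_sub_le (hYs : ContDiff ℝ ∞ Y) (hYc : HasCompactSupport Y)
    (hJ : ∀ x, HasJacobianBounds m C ε (fderiv ℝ Y x)) :
    (∫ k in dualCell γ, gradNormSq (U.deform h) k) - ∫ k in dualCell γ, gradNormSq U k
      ≤ (∫ x in centeredCell (dualBasis γ) k₀, stress (fun i => U.grad i x) (fderiv ℝ Y x))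
        + ε * ∫ x in centeredCell (dualBasis γ) k₀, ‖fderiv ℝ Y x‖ * gradNormSq U x := by
  have h_stress := (U.integrable_stress (hYs.continuous_fderiv (by simp))
    (hYc.fderiv ℝ)).integrableOn (s := centeredCell (dualBasis γ) k₀)
  have h_weight := ((U.integrable_norm_fderiv_mul_gradNormSq hYs hYc).const_mul ε).integrableOn
    (s := centeredCell (dualBasis γ) k₀)
  rw [h.setIntegral_dualCell_sub (fun _ => (U.deform h).gradNormSq_periodic)
    (fun _ => U.gradNormSq_periodic) (U.deform h).locallyIntegrable_gradNormSq
    U.locallyIntegrable_gradNormSq, ← integral_const_mul, ← integral_add h_stress h_weight]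
  have h_int : IntegrableOn (fun x => (fderiv ℝ Φ x).det • gradNormSq (U.deform h) (Φ x)
      - gradNormSq U x) (centeredCell (dualBasis γ) k₀) :=
    (h.integrableOn_centeredCell volume (U.deform h).locallyIntegrable_gradNormSq).sub
      ((U.locallyIntegrable_gradNormSq.integrableOn_isCompact
        (isBounded_centeredCell _ k₀).isCompact_closure).mono_set subset_closure)
  refine setIntegral_mono_on h_int (h_stress.add h_weight)
    (measurableSet_centeredCell _ _) fun x hx => ?_
  have h_pointwise := (hJ x).dirichlet_le fun i => U.grad i x
  simp only [h.fderiv_eq hx (hYs.differentiable (by simp) x), smul_eq_mul]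
  simp only [← deform_grad_apply U h (hYs.differentiable (by simp)) hx] at h_pointwise
  unfold gradNormSq at *
  linarith

end SobolevMap

end Push

section FirstVariation

variable {d m : ℕ} {γ : Module.Basis (Fin d) ℝ (E d)} {k₀ : E d} {Y : E d → E d} {Φ : E d ≃ₜ E d}

theorem re_sum_sub_re_sum_le {ι : Type*} [Fintype ι] {v w : ι → ℂ} {r : ℝ}
    (h : ∀ i, ‖v i - w i‖ ≤ r) : (∑ i, v i).re - (∑ i, w i).re ≤ Fintype.card ι * r := by
  rw [← Complex.sub_re, ← Finset.sum_sub_distrib]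
  refine (Complex.re_le_norm _).trans ((norm_sum_le _ _).trans ?_)
  simpa using Finset.sum_le_card_nsmul _ _ r fun i (_ : i ∈ Finset.univ) => h i

theorem re_sum_sq_sub_re_sum_sq_le {ι κ : Type*} [Fintype ι] [Fintype κ] {v w : ι → κ → ℂ}
    {r : ℝ} (h : ∀ i j, ‖v i j - w i j‖ ≤ r) :
    (∑ i, ∑ j, v i j ^ 2).re - (∑ i, ∑ j, w i j ^ 2).re ≤ ∑ i, ∑ j, (r ^ 2 + 2 * ‖w i j‖ * r) := by
  simp only [← Complex.sub_re, ← Finset.sum_sub_distrib]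
  refine (Complex.re_le_norm _).trans ((norm_sum_le_of_le _ fun i _ =>
    norm_sum_le_of_le _ fun j _ => ?_))
  calc ‖v i j ^ 2 - w i j ^ 2‖ = ‖(v i j - w i j) ^ 2 + 2 * w i j * (v i j - w i j)‖ := by
        congr 1; ring
    _ ≤ ‖v i j - w i j‖ ^ 2 + 2 * ‖w i j‖ * ‖v i j - w i j‖ := by
        refine (norm_add_le _ _).trans_eq ?_
        simp
    _ ≤ r ^ 2 + 2 * ‖w i j‖ * r := by gcongr <;> exact h i j

namespace SobolevMap

variable {U : SobolevMap γ m} {h : IsPeriodicDeformation (dualBasis γ) k₀ Y Φ} {C ε : ℝ}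

theorem norm_smul_deform_grad_sub_le (hY : Differentiable ℝ Y)
    (hJ : ∀ x, HasJacobianBounds m C ε (fderiv ℝ Y x)) (hC : 0 ≤ C) {x : E d}
    (hx : x ∈ centeredCell (dualBasis γ) k₀) (j : Fin d) :
    ‖(fderiv ℝ Φ x).det • (U.deform h).grad j (Φ x) - U.grad j x‖
      ≤ C * ‖fderiv ℝ Y x‖ * (1 + ∑ i, ‖U.grad i x‖) := by
  rw [deform_grad_apply U h hY hx, h.fderiv_eq hx (hY x)]
  refine (norm_smul_differential_sub_le (hJ x).norm_adjugate_sub_one_le j).trans ?_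
  gcongr
  linarith

theorem density_periodic (V : SobolevMap γ m) {F : Type*} {χ : Fin m → E d → Hf γ}
    (hs : ∀ a, ContDiff ℝ ∞ (χ a)) (hτ : ∀ a, MemHTau γ (χ a)) (j : Fin d)
    (f : Matrix (Fin m) (Fin m) ℂ → Matrix (Fin m) (Fin m) ℂ → Matrix (Fin m) (Fin m) ℂ → F)
    {l : E d} (hl : l ∈ dualLattice γ) :
    ∀ᵐ k, f (V.toFun (k + l)) (V.grad j (k + l)) (berry χ j (k + l))
      = f (V.toFun k) (V.grad j k) (berry χ j k) := by
  filter_upwards [V.periodic l hl, V.grad_periodic j hl] with k hk hk'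
  rw [hk, hk', berry_add hs hτ hl]

theorem norm_setIntegral_dualCell_deform_sub_le {χ : Fin m → E d → Hf γ}
    (hs : ∀ a, ContDiff ℝ ∞ (χ a)) (hτ : ∀ a, MemHTau γ (χ a)) (j : Fin d)
    {f : Matrix (Fin m) (Fin m) ℂ → Matrix (Fin m) (Fin m) ℂ → Matrix (Fin m) (Fin m) ℂ → ℂ}
    (hf : ∀ V : SobolevMap γ m,
      LocallyIntegrable fun k => f (V.toFun k) (V.grad j k) (berry χ j k))
    (hYs : ContDiff ℝ ∞ Y) (hYc : HasCompactSupport Y) {κ : ℝ}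
    (hκ : ∀ x ∈ centeredCell (dualBasis γ) k₀, ‖U.toFun x‖ = √m →
      ‖(fderiv ℝ Φ x).det • f (U.toFun x) ((U.deform h).grad j (Φ x)) (berry χ j (Φ x))
        - f (U.toFun x) (U.grad j x) (berry χ j x)‖ ≤ κ * U.deformationWeight Y x) :
    ‖(∫ k in dualCell γ, f ((U.deform h).toFun k) ((U.deform h).grad j k) (berry χ j k))
        - ∫ k in dualCell γ, f (U.toFun k) (U.grad j k) (berry χ j k)‖
      ≤ κ * ∫ x in centeredCell (dualBasis γ) k₀, U.deformationWeight Y x := by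
  rw [h.setIntegral_dualCell_sub (fun _ => (U.deform h).density_periodic hs hτ j f)
    (fun _ => U.density_periodic hs hτ j f) (hf _) (hf U), ← integral_const_mul]
  refine norm_integral_le_of_norm_le
    ((U.integrable_deformationWeight hYs hYc).integrableOn.const_mul κ) ?_
  filter_upwards [ae_restrict_mem (measurableSet_centeredCell _ _),
    ae_restrict_of_ae U.ae_norm_toFun] with x hx hUx
  rw [deform_toFun_apply]
  exact hκ x hx hUx

variable (U) {χ : Fin m → E d → Hf γ} (hs : ∀ a, ContDiff ℝ ∞ (χ a))
  (hτ : ∀ a, MemHTau γ (χ a))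
include hs hτ

theorem exists_norm_lowerOrder_deform_sub_le (hC : 0 ≤ C) :
    ∃ κ, 0 ≤ κ ∧ ∀ (ε : ℝ) (k₀ : E d) (Y : E d → E d) (Φ : E d ≃ₜ E d)
      (h : IsPeriodicDeformation (dualBasis γ) k₀ Y Φ), ContDiff ℝ ∞ Y → HasCompactSupport Y →
      (∀ x, HasJacobianBounds m C ε (fderiv ℝ Y x)) →
      (∀ j, ‖(∫ k in dualCell γ,
            berryForm ((U.deform h).toFun k) ((U.deform h).grad j k) (berry χ j k))
          - ∫ k in dualCell γ, berryForm (U.toFun k) (U.grad j k) (berry χ j k)‖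
        ≤ κ * ∫ x in centeredCell (dualBasis γ) k₀, U.deformationWeight Y x) ∧
      ∀ j a, ‖(∫ k in dualCell γ,
            centerForm ((U.deform h).toFun k) ((U.deform h).grad j k) (berry χ j k) a)
          - ∫ k in dualCell γ, centerForm (U.toFun k) (U.grad j k) (berry χ j k) a‖
        ≤ κ * ∫ x in centeredCell (dualBasis γ) k₀, U.deformationWeight Y x := by
  obtain ⟨M, hM0, hM⟩ := exists_norm_berry_le hs hτ
  obtain ⟨L, hL0, hL⟩ := exists_norm_berry_sub_le hs hτ
  set κ₁ := 2 * √m * (M + L)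
  set κ₂ := √m * (1 + (M + L) * √m)
  refine ⟨(κ₁ + κ₂) * (C + 1), by positivity, fun ε k₀ Y Φ h hYs hYc hJ => ?_⟩
  have hY : Differentiable ℝ Y := hYs.differentiable (by simp)
  have h_berry : ∀ j, ∀ x ∈ centeredCell (dualBasis γ) k₀,
      ‖berry χ j (Φ x) - berry χ j x‖ ≤ L * ‖Y x‖ := fun j x hx => by
    simpa [h.apply_eq hx] using hL j (Φ x) x
  constructor
  · refine fun j => norm_setIntegral_dualCell_deform_sub_le hs hτ j
      (fun V => V.locallyIntegrable_berryForm hs hτ j) hYs hYc fun x hx hUx =>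
      le_trans ?_ (U.mul_weight_le_deformationWeight hC (by positivity)
        (le_add_of_nonneg_right (by positivity)) Y x)
    simpa only [hUx, κ₁] using norm_smul_berryForm_sub_le (u := U.toFun x) hL0 (by positivity)
      (norm_nonneg (Y x)) (norm_smul_deform_grad_sub_le (h := h) hY hJ hC hx j)
      (h_berry j x hx) (hM j _) (U.norm_grad_le_one_add_sum j x)
  · refine fun j a => norm_setIntegral_dualCell_deform_sub_le hs hτ j
      (f := fun u q b => centerForm u q b a)
      (fun V => V.locallyIntegrable_centerForm hs hτ j a) hYs hYc fun x hx hUx =>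
      le_trans ?_ (U.mul_weight_le_deformationWeight hC (by positivity)
        (le_add_of_nonneg_left (by positivity)) Y x)
    have h_one : 1 ≤ 1 + ∑ i, ‖U.grad i x‖ :=
      le_add_of_nonneg_right (Finset.sum_nonneg fun i _ => norm_nonneg (U.grad i x))
    have h_det : |(fderiv ℝ Φ x).det - 1| ≤ C * ‖fderiv ℝ Y x‖ := by
      rw [h.fderiv_eq hx (hY x)]
      exact (hJ x).abs_det_sub_one_le
    simpa only [hUx, κ₂] using norm_smul_centerForm_sub_le (u := U.toFun x) hL0 (by positivity)
      (norm_nonneg (Y x)) (norm_smul_deform_grad_sub_le (h := h) hY hJ hC hx j)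
      (h_berry j x hx) (hM j _) h_det h_one a

theorem exists_localizationFunctional_deform_sub_le {c : ℝ} (hc : 0 ≤ c) (hC : 0 ≤ C) :
    ∃ K, 0 ≤ K ∧ ∀ (ε : ℝ) (k₀ : E d) (Y : E d → E d) (Φ : E d ≃ₜ E d)
      (h : IsPeriodicDeformation (dualBasis γ) k₀ Y Φ), ContDiff ℝ ∞ Y → HasCompactSupport Y →
      (∀ x, HasJacobianBounds m C ε (fderiv ℝ Y x)) →
      localizationFunctional c χ (U.deform h) - localizationFunctional c χ U
        ≤ c * ((∫ x in centeredCell (dualBasis γ) k₀,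
              stress (fun i => U.grad i x) (fderiv ℝ Y x))
            + ε * ∫ x in centeredCell (dualBasis γ) k₀, ‖fderiv ℝ Y x‖ * gradNormSq U x)
          + K * ((∫ x in centeredCell (dualBasis γ) k₀, U.deformationWeight Y x)
            + (∫ x in centeredCell (dualBasis γ) k₀, U.deformationWeight Y x) ^ 2) := by
  obtain ⟨κ, hκ, h_lower⟩ := U.exists_norm_lowerOrder_deform_sub_le hs hτ hC
  obtain ⟨K₀, h_functional⟩ := exists_forall_localizationFunctional_eq (γ := γ) hs c
  set z : Fin m → Fin d → ℂ := fun a j =>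
    torusIntegral γ c fun k => centerForm (U.toFun k) (U.grad j k) (berry χ j k) a
  refine ⟨d * (c * κ) + ∑ a, ∑ j, (c * κ * (c * κ) + 2 * ‖z a j‖ * (c * κ)), by positivity,
    fun ε k₀ Y Φ h hYs hYc hJ => ?_⟩
  obtain ⟨h_berry, h_center⟩ := h_lower ε k₀ Y Φ h hYs hYc hJ
  set S := ∫ x in centeredCell (dualBasis γ) k₀, U.deformationWeight Y x
  have h_torus : ∀ f g : E d → ℂ, ‖(∫ k in dualCell γ, f k) - ∫ k in dualCell γ, g k‖ ≤ κ * S →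
      ‖torusIntegral γ c f - torusIntegral γ c g‖ ≤ c * κ * S := fun f g hfg => by
    rw [torusIntegral, torusIntegral, ← mul_sub, norm_mul, Complex.norm_real,
      Real.norm_of_nonneg hc, mul_assoc]
    gcongr
  have h_dirichlet :=
    mul_le_mul_of_nonneg_left (dirichlet_deform_sub_le (U := U) (h := h) hYs hYc hJ) hc
  have hS : 0 ≤ S := integral_nonneg fun x =>
    mul_nonneg (by positivity) (by positivity)
  have h_berry_sum := re_sum_sub_re_sum_le fun j => h_torus _ _ (h_berry j)
  have h_center_sum := re_sum_sq_sub_re_sum_sq_le fun a j => h_torus _ _ (h_center j a)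
  have h_quadratic : ∑ a, ∑ j, ((c * κ * S) ^ 2 + 2 * ‖z a j‖ * (c * κ * S))
      ≤ (∑ a, ∑ j, (c * κ * (c * κ) + 2 * ‖z a j‖ * (c * κ))) * (S + S ^ 2) := by
    simp only [Finset.sum_mul]
    gcongr with a _ j _
    have h_extra : 0 ≤ c * κ * (c * κ) * S + 2 * ‖z a j‖ * (c * κ) * S ^ 2 := by positivity
    linarith
  have h_linear : 0 ≤ d * (c * κ) * S ^ 2 := by positivity
  rw [Fintype.card_fin] at h_berry_sum
  rw [h_functional, h_functional]
  linarith

end SobolevMap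

theorem stress_add (p : Fin d → Matrix (Fin m) (Fin m) ℂ) (A B : E d →L[ℝ] E d) :
    stress p (A + B) = stress p A + stress p B := by
  simp only [stress, map_add]
  ring

theorem stress_smul (p : Fin d → Matrix (Fin m) (Fin m) ℂ) (s : ℝ) (A : E d →L[ℝ] E d) :
    stress p (s • A) = s * stress p A := by
  simp only [stress, map_smul, smul_eq_mul]
  ring

theorem nonneg_of_eventually_smul_add_sq {a b c : ℝ}
    (h : ∀ᶠ s : ℝ in 𝓝 0, 0 ≤ s → 0 ≤ s * a + b * (s * c + (s * c) ^ 2)) : 0 ≤ a + b * c := by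
  have h_lim : Tendsto (fun s : ℝ => a + b * (c + s * c ^ 2)) (𝓝[>] 0) (𝓝 (a + b * c)) := by
    have h_cont : Continuous fun s : ℝ => a + b * (c + s * c ^ 2) := by fun_prop
    exact (h_cont.tendsto' 0 _ (by simp)).mono_left nhdsWithin_le_nhds
  refine ge_of_tendsto h_lim ?_
  filter_upwards [nhdsWithin_le_nhds h, self_mem_nhdsWithin] with s hs (hs0 : 0 < s)
  refine nonneg_of_mul_nonneg_right ?_ hs0
  linarith [hs hs0.le]

theorem nonneg_of_forall_pos_add_mul {a t : ℝ} (h : ∀ ε > 0, 0 ≤ a + ε * t) : 0 ≤ a := by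
  have h_lim : Tendsto (fun ε : ℝ => a + ε * t) (𝓝[>] 0) (𝓝 a) :=
    ((by fun_prop : Continuous fun ε : ℝ => a + ε * t).tendsto' 0 _ (by simp)).mono_left
      nhdsWithin_le_nhds
  exact ge_of_tendsto h_lim (eventually_mem_nhdsWithin.mono h)

theorem fderiv_eq_zero_of_notMem_closedBall {V W : Type*} [NormedAddCommGroup V] [NormedSpace ℝ V]
    [NormedAddCommGroup W] [NormedSpace ℝ W] {f : V → W} {x₀ x : V} {r : ℝ}
    (hf : ∀ x ∉ Metric.closedBall x₀ r, f x = 0) (hx : x ∉ Metric.closedBall x₀ r) :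
    fderiv ℝ f x = 0 :=
  image_eq_zero_of_notMem_tsupport fun h => hx <|
    closure_minimal (Function.support_subset_iff'.2 hf) Metric.isClosed_closedBall
      (tsupport_fderiv_subset ℝ h)

/-- The Dirichlet energy of `U` is stationary up to the lower order term `K ∫ deformationWeight`
under inner variations supported in the ball of radius `ρ` around `k₀`. -/
def SobolevMap.IsAlmostStationary (U : SobolevMap γ m) (K ρ : ℝ) (k₀ : E d) : Prop :=
  ∀ X : E d → E d, ContDiff ℝ ∞ X → (∀ x ∉ Metric.closedBall k₀ ρ, X x = 0) →
    0 ≤ (∫ x, stress (fun i => U.grad i x) (fderiv ℝ X x)) + K * ∫ x, U.deformationWeight X x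

theorem IsMinimizer.exists_isAlmostStationary {U : SobolevMap γ m} {χ : Fin m → E d → Hf γ}
    (hs : ∀ a, ContDiff ℝ ∞ (χ a)) (hτ : ∀ a, MemHTau γ (χ a)) {c : ℝ} (hc : 0 < c)
    (hU : IsMinimizer c χ U) :
    ∃ ρ > 0, ∃ K, 0 ≤ K ∧ ∀ k₀, U.IsAlmostStationary K ρ k₀ := by
  obtain ⟨ρ, hρ, h_sep, h_ball⟩ := exists_closedBall_subset_centeredCell (dualBasis γ)
  obtain ⟨C, hC, h_jacobian⟩ := exists_eventually_hasJacobianBounds d m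
  obtain ⟨K, hK, h_deform⟩ := U.exists_localizationFunctional_deform_sub_le hs hτ hc.le hC
  refine ⟨ρ, hρ, K / c, by positivity, fun k₀ X hXs hX => ?_⟩
  have hXc : HasCompactSupport X := .intro (isCompact_closedBall k₀ ρ) hX
  obtain ⟨M, hM⟩ := exists_norm_fderiv_le hX hXs
  have h_notMem : ∀ x ∉ centeredCell (dualBasis γ) k₀, x ∉ Metric.closedBall k₀ ρ :=
    fun x hx h => hx (h_ball k₀ h)
  have h_stress_zero : ∀ x ∉ centeredCell (dualBasis γ) k₀,
      stress (fun i => U.grad i x) (fderiv ℝ X x) = 0 := fun x hx => by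
    simp [stress, fderiv_eq_zero_of_notMem_closedBall hX (h_notMem x hx)]
  have h_weight_zero : ∀ x ∉ centeredCell (dualBasis γ) k₀, U.deformationWeight X x = 0 :=
    fun x hx => by simp [SobolevMap.deformationWeight, hX x (h_notMem x hx),
      fderiv_eq_zero_of_notMem_closedBall hX (h_notMem x hx)]
  rw [← setIntegral_eq_integral_of_forall_compl_eq_zero h_stress_zero,
    ← setIntegral_eq_integral_of_forall_compl_eq_zero h_weight_zero,
    ← mul_nonneg_iff_of_pos_left hc, mul_add, ← mul_assoc c (K / c), mul_div_cancel₀ K hc.ne']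
  refine nonneg_of_forall_pos_add_mul
    (t := c * ∫ x in centeredCell (dualBasis γ) k₀, ‖fderiv ℝ X x‖ * gradNormSq U x) fun ε hε => ?_
  rw [add_right_comm]
  refine nonneg_of_eventually_smul_add_sq ?_
  filter_upwards [eventually_exists_isPeriodicDeformation hρ h_sep (h_ball k₀) hX hXs,
    eventually_forall_smul hM (h_jacobian ε hε)] with s ⟨Φ, h⟩ h_jac hs0
  have h_fderiv : ∀ x, fderiv ℝ (fun x => s • X x) x = s • fderiv ℝ X x := fun x =>
    fderiv_fun_const_smul (hXs.differentiable (by simp) x) s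
  have h_change := h_deform ε k₀ _ Φ h (hXs.const_smul s) (hXc.smul_left (f := fun _ => s))
    fun x => by rw [h_fderiv]; exact h_jac x
  have h_min := hU (U.deform h)
  simp only [h_fderiv, stress_smul, U.deformationWeight_smul hs0, norm_smul,
    Real.norm_of_nonneg hs0, mul_assoc, integral_const_mul] at h_change
  linarith

end FirstVariation

/-! ### Radial vector fields -/

section RadialField

variable {V : Type*} [NormedAddCommGroup V] [InnerProductSpace ℝ V]

/-- The vector field pointing towards `k₀` with profile `h(r)`, `r = ‖x - k₀‖`: the point `x` is
moved with velocity `h(r) r`. -/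
def radialField (k₀ : V) (h : ℝ → ℝ) (x : V) : V := -(h ‖x - k₀‖ • (x - k₀))

variable {k₀ : V} {h : ℝ → ℝ}

theorem norm_radialField (x : V) : ‖radialField k₀ h x‖ = |h ‖x - k₀‖| * ‖x - k₀‖ := by
  rw [radialField, norm_neg, norm_smul, Real.norm_eq_abs]

theorem radialField_eventuallyEq (h0 : h =ᶠ[𝓝 0] fun _ => h 0) :
    radialField k₀ h =ᶠ[𝓝 k₀] fun x => -(h 0 • (x - k₀)) := by
  have hnorm : Tendsto (fun x => ‖x - k₀‖) (𝓝 k₀) (𝓝 0) := tendsto_norm_sub_self k₀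
  filter_upwards [hnorm.eventually h0] with x hx
  rw [radialField, hx]

theorem contDiff_radialField (hh : ContDiff ℝ ∞ h) (h0 : h =ᶠ[𝓝 0] fun _ => h 0) :
    ContDiff ℝ ∞ (radialField k₀ h) := by
  refine contDiff_iff_contDiffAt.2 fun x => ?_
  rcases eq_or_ne x k₀ with rfl | hx
  · refine ContDiffAt.congr_of_eventuallyEq ?_ (radialField_eventuallyEq h0)
    fun_prop
  · have hnorm : ContDiffAt ℝ ∞ (fun y => ‖y - k₀‖) x :=
      (contDiffAt_id.sub contDiffAt_const).norm ℝ (sub_ne_zero.2 hx)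
    exact ((hh.contDiffAt.comp x hnorm).smul (contDiffAt_id.sub contDiffAt_const)).neg

theorem hasFDerivAt_norm_sub {x : V} (hx : x ≠ k₀) :
    HasFDerivAt (fun y => ‖y - k₀‖) (‖x - k₀‖⁻¹ • innerSL ℝ (x - k₀)) x := by
  have hpos : 0 < ‖x - k₀‖ := norm_pos_iff.2 (sub_ne_zero.2 hx)
  have hsqrt := (((hasFDerivAt_id x).sub_const k₀).norm_sq).sqrt (pow_pos hpos 2).ne'
  simp only [id, Real.sqrt_sq (norm_nonneg _)] at hsqrt
  convert hsqrt using 1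
  ext v
  simp
  field_simp

theorem fderiv_radialField (hh : Differentiable ℝ h) (h0 : h =ᶠ[𝓝 0] fun _ => h 0) (x : V) :
    fderiv ℝ (radialField k₀ h) x = -(h ‖x - k₀‖ • 1
      + (deriv h ‖x - k₀‖ / ‖x - k₀‖) • (innerSL ℝ (x - k₀)).smulRight (x - k₀)) := by
  have hsub : HasFDerivAt (fun y => y - k₀) (1 : V →L[ℝ] V) x := (hasFDerivAt_id x).sub_const k₀
  rcases eq_or_ne x k₀ with rfl | hx
  · have hlinear : HasFDerivAt (fun y => -(h 0 • (y - x))) (-(h 0 • (1 : V →L[ℝ] V))) x :=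
      (hsub.const_smul (h 0)).neg
    rw [(radialField_eventuallyEq h0).fderiv_eq, hlinear.fderiv]
    simp
  · have hprofile := (hh ‖x - k₀‖).hasDerivAt.comp_hasFDerivAt x (hasFDerivAt_norm_sub hx)
    have hfield : HasFDerivAt (radialField k₀ h) _ x := (hprofile.smul hsub).neg
    rw [hfield.fderiv]
    ext v
    simp [smul_smul, div_eq_mul_inv]

theorem norm_fderiv_radialField_le (hh : Differentiable ℝ h) (h0 : h =ᶠ[𝓝 0] fun _ => h 0)
    (x : V) : ‖fderiv ℝ (radialField k₀ h) x‖
      ≤ |h ‖x - k₀‖| + |‖x - k₀‖ * deriv h ‖x - k₀‖| := by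
  rw [fderiv_radialField hh h0, norm_neg]
  refine (norm_add_le _ _).trans (add_le_add ?_ (le_of_eq ?_))
  · rw [norm_smul, Real.norm_eq_abs]
    exact mul_le_of_le_one_right (abs_nonneg _) ContinuousLinearMap.norm_id_le
  · rw [norm_smul, ContinuousLinearMap.norm_smulRight_apply, innerSL_apply_norm, Real.norm_eq_abs,
      abs_div, abs_norm, abs_mul, abs_norm]
    rcases eq_or_ne ‖x - k₀‖ 0 with hr | hr
    · simp [hr]
    · field_simp

end RadialField

section Stress

variable {d m : ℕ} (p : Fin d → Matrix (Fin m) (Fin m) ℂ)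

theorem matNormSq_differential_le (v : E d) :
    matNormSq (differential p v) ≤ ‖v‖ ^ 2 * ∑ i, matNormSq (p i) := by
  simp only [matNormSq_eq_norm_sq]
  have hnorm : ‖differential p v‖ ≤ ∑ i, |v i| * ‖p i‖ := by
    rw [differential_apply]
    exact (norm_sum_le _ _).trans_eq (by simp only [norm_smul, Real.norm_eq_abs])
  calc ‖differential p v‖ ^ 2 ≤ (∑ i, |v i| * ‖p i‖) ^ 2 := by gcongr
    _ ≤ (∑ i, |v i| ^ 2) * ∑ i, ‖p i‖ ^ 2 := Finset.sum_mul_sq_le_sq_mul_sq _ _ _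
    _ = ‖v‖ ^ 2 * ∑ i, ‖p i‖ ^ 2 := by simp only [sq_abs, EuclideanSpace.real_norm_sq_eq]

theorem stress_one : stress p 1 = (d - 2) * ∑ i, matNormSq (p i) := by
  rw [stress, energyForm_one, traceCLM_apply]
  simp [unitVec]
  ring

theorem stress_smulRight_innerSL (v : E d) :
    stress p ((innerSL ℝ v).smulRight v)
      = ‖v‖ ^ 2 * ∑ i, matNormSq (p i) - 2 * matNormSq (differential p v) := by
  have h_unit : ∀ i, innerSL ℝ v (unitVec i) = v i := fun i => by
    simp [unitVec, EuclideanSpace.inner_single_right]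
  have h_trace : traceCLM ((innerSL ℝ v).smulRight v) = ‖v‖ ^ 2 := by
    rw [EuclideanSpace.real_norm_sq_eq, traceCLM_apply]
    simp only [ContinuousLinearMap.smulRight_apply, h_unit, PiLp.smul_apply, smul_eq_mul, sq]
  have h_energy : energyForm p ((innerSL ℝ v).smulRight v) = matNormSq (differential p v) := by
    rw [← pairing_self]
    conv_rhs => enter [1, 2]; rw [differential_apply]
    simp only [energyForm_apply, ContinuousLinearMap.smulRight_apply, h_unit, map_smul, map_sum,
      LinearMap.sum_apply, LinearMap.smul_apply]
  rw [stress, h_trace, h_energy]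

variable {γ : Module.Basis (Fin d) ℝ (E d)} (U : SobolevMap γ m) (k₀ x : E d)

theorem radialDeriv_eq_differential :
    radialDeriv U k₀ x = differential (fun i => U.grad i x) (‖x - k₀‖⁻¹ • (x - k₀)) := by
  simp only [radialDeriv, differential_apply, PiLp.smul_apply, smul_eq_mul, Complex.coe_smul,
    inv_mul_eq_div]

theorem matNormSq_radialDeriv_le : matNormSq (radialDeriv U k₀ x) ≤ gradNormSq U x := by
  rw [radialDeriv_eq_differential]
  refine (matNormSq_differential_le _ _).trans
    (mul_le_of_le_one_left (U.gradNormSq_nonneg x) (pow_le_one₀ (norm_nonneg _) ?_))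
  rw [norm_smul, norm_inv, norm_norm]
  exact inv_mul_le_one

theorem matNormSq_differential_sub :
    matNormSq (differential (fun i => U.grad i x) (x - k₀))
      = ‖x - k₀‖ ^ 2 * matNormSq (radialDeriv U k₀ x) := by
  rcases eq_or_ne x k₀ with rfl | hx
  · simp [matNormSq_eq_norm_sq]
  · have hr : ‖x - k₀‖ ≠ 0 := norm_ne_zero_iff.2 (sub_ne_zero.2 hx)
    rw [radialDeriv_eq_differential, map_smul, matNormSq_eq_norm_sq, matNormSq_eq_norm_sq,
      norm_smul, norm_inv, norm_norm]
    field_simp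

theorem stress_radialField {h : ℝ → ℝ} (hh : Differentiable ℝ h) (h0 : h =ᶠ[𝓝 0] fun _ => h 0) :
    stress (fun i => U.grad i x) (fderiv ℝ (radialField k₀ h) x)
      = 2 * (‖x - k₀‖ * deriv h ‖x - k₀‖) * matNormSq (radialDeriv U k₀ x)
        - ((d - 2) * h ‖x - k₀‖ + ‖x - k₀‖ * deriv h ‖x - k₀‖) * gradNormSq U x := by
  rw [fderiv_radialField hh h0, ← neg_one_smul ℝ, stress_smul, stress_add, stress_smul, stress_smul,
    stress_one, stress_smulRight_innerSL, matNormSq_differential_sub]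
  rw [show gradNormSq U x = ∑ i, matNormSq (U.grad i x) from rfl]
  by_cases hr : ‖x - k₀‖ = 0
  · rw [hr]; ring
  · field_simp
    ring

end Stress

namespace SobolevMap

variable {d m : ℕ} {γ : Module.Basis (Fin d) ℝ (E d)} (U : SobolevMap γ m)

theorem locallyIntegrable_matNormSq_radialDeriv (k₀ : E d) :
    LocallyIntegrable fun x => matNormSq (radialDeriv U k₀ x) := by
  refine U.locallyIntegrable_of_norm_le (C := 1) ?_ (.of_forall fun x => ?_)
  · have hcoord : ∀ j, Measurable fun x : E d => (x - k₀) j / ‖x - k₀‖ := fun j => by fun_prop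
    simp only [matNormSq_eq_norm_sq, radialDeriv, Complex.coe_smul]
    exact (Finset.aestronglyMeasurable_fun_sum _ fun j _ =>
      (hcoord j).aestronglyMeasurable.smul (U.aestronglyMeasurable_grad j)).norm.pow 2
  · rw [Real.norm_of_nonneg (matNormSq_nonneg _), one_mul]
    linarith [matNormSq_radialDeriv_le U k₀ x]

/-- An upper bound for the integrand of the inner variation along a radial field at a point where
its profile `h` satisfies `h = f` and `r h' = g`. -/
def radialIntegrand (K : ℝ) (k₀ : E d) (f g : ℝ) (x : E d) : ℝ :=
  2 * g * matNormSq (radialDeriv U k₀ x) - ((d - 2) * f + g) * gradNormSq U x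
    + K * ((|f| * (1 + ‖x - k₀‖) + |g|) * (1 + ∑ j, ‖U.grad j x‖))

theorem aestronglyMeasurable_radialIntegrand {f g : E d → ℝ} (hf : Measurable f)
    (hg : Measurable g) (K : ℝ) (k₀ : E d) :
    AEStronglyMeasurable fun x => U.radialIntegrand K k₀ (f x) (g x) x := by
  have hN := (U.locallyIntegrable_matNormSq_radialDeriv k₀).aestronglyMeasurable
  have hG := U.locallyIntegrable_gradNormSq.aestronglyMeasurable
  unfold radialIntegrand
  simp only [← Real.norm_eq_abs]
  fun_prop

theorem one_add_sum_norm_grad_le (x : E d) :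
    1 + ∑ j, ‖U.grad j x‖ ≤ (d + 1) * (1 + gradNormSq U x) := by
  have hsum : ∑ j, ‖U.grad j x‖ ≤ d * (1 + gradNormSq U x) := by
    simpa [mul_add] using Finset.sum_le_sum fun j (_ : j ∈ Finset.univ) => U.norm_grad_le j x
  linarith [U.gradNormSq_nonneg x]

theorem abs_radialIntegrand_le {K R : ℝ} (hK : 0 ≤ K) {k₀ x : E d} (hx : ‖x - k₀‖ ≤ R) (f g : ℝ) :
    |U.radialIntegrand K k₀ f g x|
      ≤ (d + 5 + K * (1 + R) * (d + 1)) * (|f| + |g|) * (1 + gradNormSq U x) := by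
  have hG := U.gradNormSq_nonneg x
  have hR : 0 ≤ R := (norm_nonneg _).trans hx
  have hradial : |2 * g * matNormSq (radialDeriv U k₀ x)| ≤ 2 * |g| * gradNormSq U x := by
    rw [abs_mul, abs_mul, abs_two, abs_of_nonneg (matNormSq_nonneg _)]
    gcongr
    exact matNormSq_radialDeriv_le U k₀ x
  have hcoeff : |(d - 2) * f + g| ≤ (d + 2) * (|f| + |g|) := by
    refine (abs_add_le _ _).trans ?_
    have hd : |(d : ℝ) - 2| ≤ d + 2 := abs_sub _ _ |>.trans_eq (by simp)
    rw [abs_mul]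
    nlinarith [abs_nonneg f, abs_nonneg g, Nat.cast_nonneg (α := ℝ) d]
  have hweight : |K * ((|f| * (1 + ‖x - k₀‖) + |g|) * (1 + ∑ j, ‖U.grad j x‖))|
      ≤ K * (((1 + R) * (|f| + |g|)) * ((d + 1) * (1 + gradNormSq U x))) := by
    rw [abs_of_nonneg (by positivity)]
    gcongr
    · nlinarith [abs_nonneg f, abs_nonneg g]
    · exact U.one_add_sum_norm_grad_le x
  calc |U.radialIntegrand K k₀ f g x|
      ≤ 2 * |g| * gradNormSq U x + (d + 2) * (|f| + |g|) * gradNormSq U x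
        + K * (((1 + R) * (|f| + |g|)) * ((d + 1) * (1 + gradNormSq U x))) := by
        refine (abs_add_le _ _).trans (add_le_add ((abs_sub _ _).trans (add_le_add hradial ?_))
          hweight)
        rw [abs_mul, abs_of_nonneg hG]
        gcongr
    _ ≤ _ := by
        nlinarith [mul_nonneg (abs_nonneg f) hG, mul_nonneg (abs_nonneg g) hG, abs_nonneg f,
          abs_nonneg g, mul_nonneg (Nat.cast_nonneg (α := ℝ) d) (abs_nonneg f),
          mul_nonneg (Nat.cast_nonneg (α := ℝ) d) (abs_nonneg g)]

theorem integrable_radialBound (k₀ : E d) (R C : ℝ) :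
    Integrable ((Metric.closedBall k₀ R).indicator fun x => C * (1 + gradNormSq U x)) :=
  (integrable_indicator_iff Metric.isClosed_closedBall.measurableSet).2 <|
    (((locallyIntegrable_const (1 : ℝ)).add U.locallyIntegrable_gradNormSq).integrableOn_isCompact
      (isCompact_closedBall k₀ R)).const_mul C

theorem abs_radialIntegrand_le_indicator {K R M : ℝ} (hK : 0 ≤ K) {k₀ x : E d} {f g : ℝ}
    (hfg : |f| + |g| ≤ M) (hzero : R < ‖x - k₀‖ → f = 0 ∧ g = 0) :
    |U.radialIntegrand K k₀ f g x| ≤ (Metric.closedBall k₀ R).indicator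
      (fun x => (d + 5 + K * (1 + R) * (d + 1)) * M * (1 + gradNormSq U x)) x := by
  by_cases hx : ‖x - k₀‖ ≤ R
  · rw [Set.indicator_of_mem (mem_closedBall_iff_norm.2 hx)]
    have hR : 0 ≤ R := (norm_nonneg _).trans hx
    have hG := U.gradNormSq_nonneg x
    refine (U.abs_radialIntegrand_le hK hx f g).trans ?_
    gcongr
  · obtain ⟨rfl, rfl⟩ := hzero (not_le.1 hx)
    rw [Set.indicator_of_notMem fun h => hx (mem_closedBall_iff_norm.1 h)]
    simp [radialIntegrand]

theorem integrable_radialIntegrand {K R M : ℝ} (hK : 0 ≤ K) {k₀ : E d} {f g : E d → ℝ}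
    (hf : Measurable f) (hg : Measurable g) (hfg : ∀ x, |f x| + |g x| ≤ M)
    (hzero : ∀ x, R < ‖x - k₀‖ → f x = 0 ∧ g x = 0) :
    Integrable fun x => U.radialIntegrand K k₀ (f x) (g x) x :=
  (U.integrable_radialBound k₀ R _).mono' (U.aestronglyMeasurable_radialIntegrand hf hg K k₀)
    (.of_forall fun x => U.abs_radialIntegrand_le_indicator hK (hfg x) (hzero x))

variable {U} {K ρ : ℝ} {k₀ : E d}

theorem IsAlmostStationary.integral_radialIntegrand_nonneg (hU : U.IsAlmostStationary K ρ k₀)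
    (hK : 0 ≤ K) {h : ℝ → ℝ} (hh : ContDiff ℝ ∞ h) (h0 : h =ᶠ[𝓝 0] fun _ => h 0)
    (hρ : ∀ r, ρ ≤ r → h r = 0) :
    0 ≤ ∫ x, U.radialIntegrand K k₀ (h ‖x - k₀‖) (‖x - k₀‖ * deriv h ‖x - k₀‖) x := by
  have hX : ContDiff ℝ ∞ (radialField k₀ h) := contDiff_radialField hh h0
  have hdiff : Differentiable ℝ h := hh.differentiable (by simp)
  have hh' : Continuous (deriv h) := hh.continuous_deriv (by simp)
  have hzero : ∀ x, ρ < ‖x - k₀‖ → h ‖x - k₀‖ = 0 ∧ ‖x - k₀‖ * deriv h ‖x - k₀‖ = 0 := by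
    refine fun x hx => ⟨hρ _ hx.le, ?_⟩
    have hlocal : h =ᶠ[𝓝 ‖x - k₀‖] fun _ => 0 := by
      filter_upwards [lt_mem_nhds hx] with r hr using hρ r hr.le
    rw [hlocal.deriv_eq, deriv_const, mul_zero]
  have hX0 : ∀ x ∉ Metric.closedBall k₀ ρ, radialField k₀ h x = 0 := fun x hx => by
    rw [mem_closedBall_iff_norm, not_le] at hx
    rw [radialField, (hzero x hx).1, zero_smul, neg_zero]
  have hXs : HasCompactSupport (radialField k₀ h) := .intro (isCompact_closedBall k₀ ρ) hX0
  have hhc : Continuous h := hh.continuous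
  have hcont : Continuous fun x => |h ‖x - k₀‖| + |‖x - k₀‖ * deriv h ‖x - k₀‖| := by fun_prop
  obtain ⟨M, hM⟩ := hcont.bounded_above_of_compact_support <|
    .intro (isCompact_closedBall k₀ ρ) fun x hx => by
      rw [mem_closedBall_iff_norm, not_le] at hx
      rw [(hzero x hx).1, (hzero x hx).2, abs_zero, add_zero]
  have hstress := U.integrable_stress (hX.continuous_fderiv (by simp)) (hXs.fderiv ℝ)
  have hweight := (U.integrable_deformationWeight hX hXs).const_mul K
  refine (hU _ hX hX0).trans ?_
  rw [← integral_const_mul, ← integral_add hstress hweight]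
  refine integral_mono (hstress.add hweight) ?_ fun x => ?_
  · exact U.integrable_radialIntegrand hK
      (Continuous.measurable (by fun_prop)) (Continuous.measurable (by fun_prop))
      (fun x => (le_abs_self _).trans (hM x)) hzero
  · simp only [stress_radialField U k₀ x hdiff h0, radialIntegrand, deformationWeight]
    have hnorm : ‖fderiv ℝ (radialField k₀ h) x‖ + ‖radialField k₀ h x‖
        ≤ |h ‖x - k₀‖| * (1 + ‖x - k₀‖) + |‖x - k₀‖ * deriv h ‖x - k₀‖| := by
      rw [norm_radialField]
      linarith [norm_fderiv_radialField_le hdiff h0 x (k₀ := k₀)]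
    gcongr

end SobolevMap

/-! ### Truncated profiles -/

section Cutoff

variable {R₁ R₂ : ℝ}

/-- A sequence of smooth approximations of the indicator function of the interval `(R₁, R₂)`. -/
def cutoff (R₁ R₂ : ℝ) (j : ℕ) (t : ℝ) : ℝ :=
  Real.smoothTransition (j * (t - R₁)) * Real.smoothTransition (j * (R₂ - t))

theorem contDiff_cutoff (j : ℕ) : ContDiff ℝ ∞ (cutoff R₁ R₂ j) := by
  have hst : ContDiff ℝ ∞ Real.smoothTransition := Real.smoothTransition.contDiff
  exact (hst.comp (by fun_prop)).mul (hst.comp (by fun_prop))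

theorem cutoff_mem_Icc (j : ℕ) (t : ℝ) : cutoff R₁ R₂ j t ∈ Set.Icc (0 : ℝ) 1 :=
  ⟨mul_nonneg (Real.smoothTransition.nonneg _) (Real.smoothTransition.nonneg _),
    mul_le_one₀ (Real.smoothTransition.le_one _) (Real.smoothTransition.nonneg _)
      (Real.smoothTransition.le_one _)⟩

theorem cutoff_of_notMem {t : ℝ} (ht : t ∉ Set.Ioo R₁ R₂) (j : ℕ) : cutoff R₁ R₂ j t = 0 := by
  rw [cutoff, mul_eq_zero]
  rcases le_or_gt t R₁ with h | h
  · exact .inl (Real.smoothTransition.zero_of_nonpos <|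
      mul_nonpos_of_nonneg_of_nonpos j.cast_nonneg (by linarith))
  · have hR₂ : R₂ ≤ t := not_lt.1 fun h' => ht ⟨h, h'⟩
    exact .inr (Real.smoothTransition.zero_of_nonpos <|
      mul_nonpos_of_nonneg_of_nonpos j.cast_nonneg (by linarith))

theorem eventually_smoothTransition_natCast_mul {t : ℝ} (ht : 0 < t) :
    ∀ᶠ j : ℕ in atTop, Real.smoothTransition (j * t) = 1 := by
  filter_upwards [(tendsto_natCast_atTop_atTop.atTop_mul_const ht).eventually_ge_atTop 1] with j hj
  exact Real.smoothTransition.one_of_one_le hj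

theorem tendsto_cutoff (R₁ R₂ t : ℝ) :
    Tendsto (fun j => cutoff R₁ R₂ j t) atTop (𝓝 ((Set.Ioo R₁ R₂).indicator 1 t)) := by
  refine tendsto_const_nhds.congr' ?_
  by_cases ht : t ∈ Set.Ioo R₁ R₂
  · filter_upwards [eventually_smoothTransition_natCast_mul (sub_pos.2 ht.1),
      eventually_smoothTransition_natCast_mul (sub_pos.2 ht.2)] with j h₁ h₂
    rw [cutoff, h₁, h₂, Set.indicator_of_mem ht, Pi.one_apply, mul_one]
  · refine .of_forall fun j => ?_
    simp only [cutoff_of_notMem ht, Set.indicator_of_notMem ht]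

theorem contDiff_cutoff_mul {ψ : ℝ → ℝ} (hψ : ContDiffOn ℝ ∞ ψ (Set.Ioi 0)) (hR₁ : 0 < R₁) (j : ℕ) :
    ContDiff ℝ ∞ fun t => cutoff R₁ R₂ j t * ψ t := by
  refine contDiff_iff_contDiffAt.2 fun t => ?_
  rcases lt_or_ge 0 t with ht | ht
  · exact (contDiff_cutoff j).contDiffAt.mul (hψ.contDiffAt (Ioi_mem_nhds ht))
  · refine (contDiffAt_const (c := (0 : ℝ))).congr_of_eventuallyEq ?_
    filter_upwards [gt_mem_nhds (ht.trans_lt hR₁)] with s hs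
    rw [cutoff_of_notMem fun h => h.1.not_gt hs, zero_mul]

theorem tendsto_cutoff_mul (ψ : ℝ → ℝ) (t : ℝ) :
    Tendsto (fun j => cutoff R₁ R₂ j t * ψ t) atTop (𝓝 ((Set.Ioo R₁ R₂).indicator ψ t)) := by
  simpa [Set.indicator_apply] using (tendsto_cutoff R₁ R₂ t).mul_const (ψ t)

theorem exists_abs_indicator_Ioo_le {ψ : ℝ → ℝ} (hψ : ContinuousOn ψ (Set.Icc R₁ R₂)) :
    ∃ M, ∀ t, |(Set.Ioo R₁ R₂).indicator ψ t| ≤ M := by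
  obtain ⟨M, hM⟩ := isCompact_Icc.exists_bound_of_continuousOn hψ
  refine ⟨|M|, fun t => ?_⟩
  by_cases ht : t ∈ Set.Ioo R₁ R₂
  · rw [Set.indicator_of_mem ht]
    exact (hM t (Set.Ioo_subset_Icc_self ht)).trans (le_abs_self M)
  · rw [Set.indicator_of_notMem ht, abs_zero]
    exact abs_nonneg M

theorem abs_cutoff_mul_le (ψ : ℝ → ℝ) (j : ℕ) (t : ℝ) :
    |cutoff R₁ R₂ j t * ψ t| ≤ |(Set.Ioo R₁ R₂).indicator ψ t| := by
  by_cases ht : t ∈ Set.Ioo R₁ R₂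
  · rw [Set.indicator_of_mem ht, abs_mul, abs_of_nonneg (cutoff_mem_Icc j t).1]
    exact mul_le_of_le_one_left (abs_nonneg _) (cutoff_mem_Icc j t).2
  · rw [cutoff_of_notMem ht, zero_mul, abs_zero]
    exact abs_nonneg _

end Cutoff

section Primitive

variable {φ : ℝ → ℝ} {R₁ R₂ : ℝ}

theorem intervalIntegral_eq_zero_of_le (hφ : ∀ t ∉ Set.Ioo R₁ R₂, φ t = 0) {r : ℝ} (hr : R₂ ≤ r) :
    ∫ t in R₂..r, φ t = 0 := by
  rw [intervalIntegral.integral_congr (g := fun _ => 0) fun t ht => hφ t ?_,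
    intervalIntegral.integral_zero]
  rw [Set.uIcc_of_le hr] at ht
  exact fun h => h.2.not_ge ht.1

theorem abs_intervalIntegral_le {M : ℝ} (hM : ∀ t, |φ t| ≤ M)
    (hφ : ∀ t ∉ Set.Ioo R₁ R₂, φ t = 0) {r : ℝ} (hr : 0 ≤ r) : |∫ t in R₂..r, φ t| ≤ M * |R₂| := by
  have hM0 : 0 ≤ M := (abs_nonneg _).trans (hM 0)
  rcases le_or_gt R₂ r with h | h
  · rw [intervalIntegral_eq_zero_of_le hφ h, abs_zero]
    positivity
  · refine (intervalIntegral.norm_integral_le_of_norm_le_const (f := φ) (C := M)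
      fun t _ => hM t).trans ?_
    rw [abs_of_nonpos (sub_nonpos.2 h.le), abs_of_pos (hr.trans_lt h)]
    gcongr
    linarith

theorem abs_mul_le_of_forall_notMem_Ioo {M : ℝ} (hM : ∀ t, |φ t| ≤ M)
    (hφ : ∀ t ∉ Set.Ioo R₁ R₂, φ t = 0) {r : ℝ} (hr : 0 ≤ r) : |r * φ r| ≤ M * |R₂| := by
  have hM0 : 0 ≤ M := (abs_nonneg _).trans (hM 0)
  by_cases h : r ∈ Set.Ioo R₁ R₂
  · rw [abs_mul, mul_comm, abs_of_nonneg hr, abs_of_pos (hr.trans_lt h.2)]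
    exact mul_le_mul (hM r) h.2.le hr hM0
  · rw [hφ r h, mul_zero, abs_zero]
    positivity

theorem contDiff_primitive (hφ : ContDiff ℝ ∞ φ) (a : ℝ) :
    ContDiff ℝ ∞ fun r => ∫ t in a..r, φ t := by
  have hderiv : ∀ r, HasDerivAt (fun r => ∫ t in a..r, φ t) (φ r) r := fun r =>
    hφ.continuous.integral_hasStrictDerivAt a r |>.hasDerivAt
  rw [contDiff_infty_iff_deriv]
  exact ⟨fun r => (hderiv r).differentiableAt, by rwa [funext fun r => (hderiv r).deriv]⟩

end Primitive

namespace SobolevMap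

variable {d m : ℕ} {γ : Module.Basis (Fin d) ℝ (E d)} {U : SobolevMap γ m} {K ρ : ℝ} {k₀ : E d}
  {R₁ R₂ : ℝ}

theorem IsAlmostStationary.integral_radialIntegrand_primitive_nonneg
    (hU : U.IsAlmostStationary K ρ k₀) (hK : 0 ≤ K) (hR₁ : 0 < R₁) (hR₂ : R₂ ≤ ρ) {φ : ℝ → ℝ}
    (hφs : ContDiff ℝ ∞ φ) (hφ : ∀ t ∉ Set.Ioo R₁ R₂, φ t = 0) :
    0 ≤ ∫ x, U.radialIntegrand K k₀ (∫ t in R₂..‖x - k₀‖, φ t) (‖x - k₀‖ * φ ‖x - k₀‖) x := by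
  have hconst : (fun r => ∫ t in R₂..r, φ t) =ᶠ[𝓝 0] fun _ => ∫ t in R₂..0, φ t := by
    filter_upwards [gt_mem_nhds hR₁] with r hr
    rw [← sub_eq_zero, intervalIntegral.integral_interval_sub_left
      (hφs.continuous.intervalIntegrable _ _) (hφs.continuous.intervalIntegrable _ _),
      intervalIntegral.integral_congr (g := fun _ => 0) fun t ht => hφ t ?_,
      intervalIntegral.integral_zero]
    exact fun h => (ht.2.trans_lt (max_lt hR₁ hr)).not_gt h.1
  have h := hU.integral_radialIntegrand_nonneg hK (contDiff_primitive hφs R₂) hconst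
    fun r hr => intervalIntegral_eq_zero_of_le hφ (hR₂.trans hr)
  simpa only [hφs.continuous.deriv_integral] using h

theorem continuous_radialIntegrand (U : SobolevMap γ m) (K : ℝ) (k₀ x : E d) :
    Continuous fun q : ℝ × ℝ => U.radialIntegrand K k₀ q.1 q.2 x := by
  unfold radialIntegrand
  fun_prop

theorem IsAlmostStationary.integral_radialIntegrand_indicator_nonneg
    (hU : U.IsAlmostStationary K ρ k₀) (hK : 0 ≤ K) (hR₁ : 0 < R₁) (hR₂ : R₂ ≤ ρ)
    {ψ : ℝ → ℝ} (hψ : ContDiffOn ℝ ∞ ψ (Set.Ioi 0)) :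
    0 ≤ ∫ x, U.radialIntegrand K k₀ (∫ t in R₂..‖x - k₀‖, (Set.Ioo R₁ R₂).indicator ψ t)
      (‖x - k₀‖ * (Set.Ioo R₁ R₂).indicator ψ ‖x - k₀‖) x := by
  set χ : ℕ → ℝ → ℝ := fun j t => cutoff R₁ R₂ j t * ψ t
  have hχs : ∀ j, ContDiff ℝ ∞ (χ j) := contDiff_cutoff_mul hψ hR₁
  have hχ0 : ∀ j, ∀ t ∉ Set.Ioo R₁ R₂, χ j t = 0 := fun j t ht => by
    simp only [χ, cutoff_of_notMem ht, zero_mul]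
  have hχ_lim : ∀ t, Tendsto (fun j => χ j t) atTop (𝓝 ((Set.Ioo R₁ R₂).indicator ψ t)) :=
    tendsto_cutoff_mul ψ
  obtain ⟨M, hM⟩ := exists_abs_indicator_Ioo_le (R₁ := R₁) (R₂ := R₂)
    (hψ.continuousOn.mono fun t ht => hR₁.trans_le ht.1)
  have hχM : ∀ j t, |χ j t| ≤ M := fun j t => (abs_cutoff_mul_le ψ j t).trans (hM t)
  have hprofile_lim : ∀ r, Tendsto (fun j => ∫ t in R₂..r, χ j t) atTop
      (𝓝 (∫ t in R₂..r, (Set.Ioo R₁ R₂).indicator ψ t)) := fun r =>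
    intervalIntegral.tendsto_integral_filter_of_dominated_convergence (fun _ => M)
      (.of_forall fun j => (hχs j).continuous.aestronglyMeasurable)
      (.of_forall fun j => .of_forall fun t _ => hχM j t) intervalIntegrable_const
      (.of_forall fun t _ => hχ_lim t)
  have hintegral_lim := tendsto_integral_of_dominated_convergence (μ := volume)
    (F := fun j x => U.radialIntegrand K k₀ (∫ t in R₂..‖x - k₀‖, χ j t)
      (‖x - k₀‖ * χ j ‖x - k₀‖) x) _ (fun j => ?_) (U.integrable_radialBound k₀ R₂ _)
    (fun j => .of_forall fun x => U.abs_radialIntegrand_le_indicator hK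
      (add_le_add (abs_intervalIntegral_le (hχM j) (hχ0 j) (norm_nonneg _))
        (abs_mul_le_of_forall_notMem_Ioo (hχM j) (hχ0 j) (norm_nonneg _))) fun hx => ?_)
    (.of_forall fun x => ((U.continuous_radialIntegrand K k₀ x).tendsto _).comp <|
      (hprofile_lim _).prodMk_nhds ((hχ_lim _).const_mul _))
  · exact ge_of_tendsto' hintegral_lim fun j =>
      hU.integral_radialIntegrand_primitive_nonneg hK hR₁ hR₂ (hχs j) (hχ0 j)
  · have hχc : Continuous (χ j) := (hχs j).continuous
    exact U.aestronglyMeasurable_radialIntegrand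
      (Continuous.measurable (by fun_prop)) (Continuous.measurable (by fun_prop)) K k₀
  · exact ⟨intervalIntegral_eq_zero_of_le (hχ0 j) hx.le,
      by rw [hχ0 j _ fun h => h.2.not_gt hx, mul_zero]⟩

end SobolevMap

/-! ### The monotonicity inequality -/

section Profile

variable {n : ℕ} {Λ : ℝ}

/-- The radial profile `t⁻ⁿ (1 + Λ t)` of the vector fields that yield the monotonicity inequality
in dimension `n + 2`; the factor `1 + Λ t` absorbs the error terms of an almost stationary map. -/
def monotoneProfile (n : ℕ) (Λ t : ℝ) : ℝ := (t ^ n)⁻¹ * (1 + Λ * t)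

/-- The derivative of `monotoneProfile n Λ` away from the origin. -/
def monotoneProfileDeriv (n : ℕ) (Λ t : ℝ) : ℝ := -((t ^ (n + 1))⁻¹ * (n + (n - 1) * (Λ * t)))

theorem hasDerivAt_monotoneProfile {t : ℝ} (ht : t ≠ 0) :
    HasDerivAt (monotoneProfile n Λ) (monotoneProfileDeriv n Λ t) t := by
  have hpow := (hasDerivAt_pow n t).fun_inv (pow_ne_zero n ht)
  have hlin : HasDerivAt (fun t => 1 + Λ * t) Λ t := by
    simpa using ((hasDerivAt_id t).const_mul Λ).const_add 1
  refine (hpow.mul hlin).congr_deriv ?_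
  rw [monotoneProfileDeriv]
  rcases n with _ | n
  · simp
    field_simp
  · rw [Nat.add_sub_cancel]
    field_simp
    push_cast
    ring

theorem contDiffOn_monotoneProfileDeriv (n : ℕ) (Λ : ℝ) :
    ContDiffOn ℝ ∞ (monotoneProfileDeriv n Λ) (Set.Ioi 0) := by
  have hpow : ContDiffOn ℝ ∞ (fun t : ℝ => (t ^ (n + 1))⁻¹) (Set.Ioi 0) :=
    ContDiffOn.inv (by fun_prop) fun t ht => pow_ne_zero _ (ne_of_gt ht)
  exact (hpow.mul (by fun_prop)).neg

theorem mul_monotoneProfileDeriv {t : ℝ} (ht : t ≠ 0) :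
    t * monotoneProfileDeriv n Λ t = -((t ^ n)⁻¹ * (n + (n - 1) * (Λ * t))) := by
  rw [monotoneProfileDeriv, pow_succ]
  field_simp

theorem monotoneProfile_nonneg {t : ℝ} (hΛ : 0 ≤ Λ) (ht : 0 ≤ t) : 0 ≤ monotoneProfile n Λ t := by
  rw [monotoneProfile]
  positivity

theorem antitoneOn_monotoneProfile (hn : 1 ≤ n) (hΛ : 0 ≤ Λ) :
    AntitoneOn (monotoneProfile n Λ) (Set.Ioi 0) := by
  obtain ⟨n, rfl⟩ := Nat.exists_eq_add_of_le' hn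
  have hsplit : ∀ t ∈ Set.Ioi (0 : ℝ), monotoneProfile (n + 1) Λ t
      = (t ^ (n + 1))⁻¹ + Λ * (t ^ n)⁻¹ := fun t ht => by
    have ht0 : t ≠ 0 := ne_of_gt ht
    rw [monotoneProfile, pow_succ]
    field_simp
  intro s (hs : 0 < s) t ht hst
  rw [hsplit s hs, hsplit t ht]
  gcongr

theorem intervalIntegral_indicator_Ioo {R₁ R₂ r : ℝ} {w ψ : ℝ → ℝ} (hR : R₁ ≤ R₂)
    (hw : ∀ t ∈ Set.Icc R₁ R₂, HasDerivAt w (ψ t) t) (hψ : ContinuousOn ψ (Set.Icc R₁ R₂))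
    (hr : r ≤ R₂) :
    ∫ t in R₂..r, (Set.Ioo R₁ R₂).indicator ψ t = w (max r R₁) - w R₂ := by
  have hle : max r R₁ ≤ R₂ := max_le hr hR
  have hsub : Set.uIcc (max r R₁) R₂ ⊆ Set.Icc R₁ R₂ := by
    rw [Set.uIcc_of_le hle]
    exact Set.Icc_subset_Icc_left (le_max_right _ _)
  have hset : Set.Ioo r R₂ ∩ Set.Ioo R₁ R₂ = Set.Ioo (max r R₁) R₂ := by
    rw [Set.Ioo_inter_Ioo, min_self]
  rw [intervalIntegral.integral_symm, intervalIntegral.integral_of_le hr,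
    integral_Ioc_eq_integral_Ioo, setIntegral_indicator measurableSet_Ioo, hset,
    ← integral_Ioc_eq_integral_Ioo, ← intervalIntegral.integral_of_le hle,
    intervalIntegral.integral_eq_sub_of_hasDerivAt (fun t ht => hw t (hsub ht))
      (hψ.mono hsub).intervalIntegrable, neg_sub]

end Profile

section NormInvPow

theorem indicator_ball_norm_inv_pow_eq {F : Type*} [SeminormedAddCommGroup F] (c : F) (R : ℝ)
    (k : ℕ) :
    (Metric.ball c R).indicator (fun x => (‖x - c‖ ^ k)⁻¹)
      = fun x => (Set.Iio R).indicator (fun t => (t ^ k)⁻¹) ‖x - c‖ := by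
  classical
  ext x
  simp only [Set.indicator_apply, mem_ball_iff_norm, Set.mem_Iio]

theorem pow_smul_indicator_inv_pow_eqOn (k : ℕ) (R : ℝ) :
    Set.EqOn (fun t => t ^ k • (Set.Iio R).indicator (fun t => (t ^ k)⁻¹) t)
      ((Set.Iio R).indicator 1) (Set.Ioi 0) := by
  intro t ht
  have ht0 : t ≠ 0 := ne_of_gt ht
  by_cases h : t ∈ Set.Iio R <;> simp [h, ht0]

variable {F : Type*} [NormedAddCommGroup F] [NormedSpace ℝ F] [FiniteDimensional ℝ F]
  [MeasurableSpace F] [BorelSpace F] [Nontrivial F] (μ : Measure F) [μ.IsAddHaarMeasure]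

theorem integrableOn_ball_norm_inv_pow (c : F) (R : ℝ) :
    IntegrableOn (fun x => (‖x - c‖ ^ (Module.finrank ℝ F - 1))⁻¹) (Metric.ball c R) μ := by
  rw [← integrable_indicator_iff measurableSet_ball, indicator_ball_norm_inv_pow_eq]
  refine Integrable.comp_sub_right (f := fun x => Set.indicator _ _ ‖x‖) ?_ c
  rw [integrable_fun_norm_addHaar,
    integrableOn_congr_fun (pow_smul_indicator_inv_pow_eqOn _ R) measurableSet_Ioi, IntegrableOn,
    integrable_indicator_iff measurableSet_Iio, IntegrableOn,
    Measure.restrict_restrict measurableSet_Iio, Set.Iio_inter_Ioi]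
  exact integrable_const 1

theorem integral_ball_norm_inv_pow (c : F) {R : ℝ} (hR : 0 ≤ R) :
    ∫ x in Metric.ball c R, (‖x - c‖ ^ (Module.finrank ℝ F - 1))⁻¹ ∂μ
      = Module.finrank ℝ F * μ.real (Metric.ball 0 1) * R := by
  rw [← integral_indicator measurableSet_ball, indicator_ball_norm_inv_pow_eq,
    integral_sub_right_eq_self (fun x => Set.indicator _ _ ‖x‖) c, integral_fun_norm_addHaar,
    setIntegral_congr_fun measurableSet_Ioi (pow_smul_indicator_inv_pow_eqOn _ R),
    setIntegral_indicator measurableSet_Iio, Set.Ioi_inter_Iio]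
  simp [hR, mul_assoc]

end NormInvPow

namespace SobolevMap

variable {d m : ℕ} {γ : Module.Basis (Fin d) ℝ (E d)} (U : SobolevMap γ m)

theorem one_add_sum_norm_grad_le_add_div {t : ℝ} (ht : 0 < t) (ht1 : t ≤ 1) (x : E d) :
    1 + ∑ j, ‖U.grad j x‖ ≤ t * gradNormSq U x + (d + 1) / t := by
  have hyoung : ∀ j, ‖U.grad j x‖ ≤ t * matNormSq (U.grad j x) + 1 / t := fun j => by
    rw [matNormSq_eq_norm_sq, ← sub_nonneg]
    have hsq : t * ‖U.grad j x‖ ^ 2 + 1 / t - ‖U.grad j x‖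
        = ((t * ‖U.grad j x‖ - 1) ^ 2 + t * ‖U.grad j x‖) / t := by
      field_simp
      ring
    rw [hsq]
    positivity
  have hsum : ∑ j, ‖U.grad j x‖ ≤ t * gradNormSq U x + d * (1 / t) := by
    simpa [gradNormSq, Finset.sum_add_distrib, Finset.mul_sum] using
      Finset.sum_le_sum fun j (_ : j ∈ Finset.univ) => hyoung j
  have hone : 1 ≤ 1 / t := by rwa [le_div_iff₀ ht, one_mul]
  calc 1 + ∑ j, ‖U.grad j x‖ ≤ 1 / t + (t * gradNormSq U x + d * (1 / t)) := add_le_add hone hsum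
    _ = _ := by ring

end SobolevMap

theorem zpow_two_sub_natCast_add_two (n : ℕ) (r : ℝ) : r ^ (2 - ((n + 2 : ℕ) : ℤ)) = (r ^ n)⁻¹ := by
  rw [← zpow_natCast, ← zpow_neg]
  congr 1
  push_cast
  ring

/-- The open spherical shell of inner radius `R₁` and outer radius `R₂` centred at `k₀`. -/
def shell {d : ℕ} (k₀ : E d) (R₁ R₂ : ℝ) : Set (E d) := {k | R₁ < ‖k - k₀‖ ∧ ‖k - k₀‖ < R₂}

theorem mem_shell {d : ℕ} {k₀ x : E d} {R₁ R₂ : ℝ} :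
    x ∈ shell k₀ R₁ R₂ ↔ R₁ < ‖x - k₀‖ ∧ ‖x - k₀‖ < R₂ :=
  Iff.rfl

theorem measurableSet_shell {d : ℕ} (k₀ : E d) (R₁ R₂ : ℝ) : MeasurableSet (shell k₀ R₁ R₂) := by
  have hnorm : Measurable fun k : E d => ‖k - k₀‖ := by fun_prop
  exact hnorm measurableSet_Ioo

namespace SobolevMap

variable {n m : ℕ} {γ : Module.Basis (Fin (n + 2)) ℝ (E (n + 2))} (U : SobolevMap γ m)
  {K Λ : ℝ} {k₀ x : E (n + 2)}

theorem radialDensity_eq_mul_inv_pow (k₀ x : E (n + 2)) :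
    radialDensity U k₀ x = matNormSq (radialDeriv U k₀ x) * (‖x - k₀‖ ^ n)⁻¹ := by
  rw [radialDensity, zpow_two_sub_natCast_add_two]

theorem scaledEnergy_eq_inv_pow_mul (k₀ : E (n + 2)) (R : ℝ) :
    scaledEnergy U k₀ R = (R ^ n)⁻¹ * ∫ x in Metric.ball k₀ R, gradNormSq U x := by
  rw [scaledEnergy, zpow_two_sub_natCast_add_two]

theorem aestronglyMeasurable_radialDensity (k₀ : E (n + 2)) :
    AEStronglyMeasurable (radialDensity U k₀) := by
  have hN := (U.locallyIntegrable_matNormSq_radialDeriv k₀).aestronglyMeasurable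
  have hpow : Measurable fun x : E (n + 2) => (‖x - k₀‖ ^ n)⁻¹ := by fun_prop
  simpa only [← radialDensity_eq_mul_inv_pow] using hN.fun_mul hpow.aestronglyMeasurable

theorem integrableOn_radialDensity_shell (k₀ : E (n + 2)) {R₁ : ℝ} (hR₁ : 0 < R₁) (R₂ : ℝ) :
    IntegrableOn (radialDensity U k₀) (shell k₀ R₁ R₂) := by
  have hsub : shell k₀ R₁ R₂ ⊆ Metric.closedBall k₀ R₂ := fun x hx =>
    mem_closedBall_iff_norm.2 hx.2.le
  have hbound := (((U.locallyIntegrable_matNormSq_radialDeriv k₀).integrableOn_isCompact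
    (isCompact_closedBall k₀ R₂)).mono_set hsub).mul_const (R₁ ^ n)⁻¹
  refine hbound.mono' (U.aestronglyMeasurable_radialDensity k₀).restrict ?_
  filter_upwards [ae_restrict_mem (measurableSet_shell k₀ R₁ R₂)] with x hx
  have hN := matNormSq_nonneg (radialDeriv U k₀ x)
  rw [radialDensity_eq_mul_inv_pow, Real.norm_of_nonneg (by positivity)]
  gcongr
  exact hx.1.le

theorem weight_mul_one_add_sum_norm_grad_le (hK : 0 ≤ K) {t q : ℝ} (ht : 0 < t) (ht1 : t ≤ 1)
    (hq : q ≤ 6 * n * (t ^ n)⁻¹) :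
    K * (q * (1 + ∑ j, ‖U.grad j x‖))
      ≤ 6 * n * K * ((t ^ n)⁻¹ * (t * gradNormSq U x) + (n + 3) * (t ^ (n + 1))⁻¹) := by
  calc K * (q * (1 + ∑ j, ‖U.grad j x‖))
      ≤ K * (6 * n * (t ^ n)⁻¹ * (t * gradNormSq U x + ((n + 2 : ℕ) + 1) / t)) := by
        have hsum := U.one_add_sum_norm_grad_le_add_div ht ht1 x
        gcongr K * ?_
        exact mul_le_mul hq hsum (by positivity) (by positivity)
    _ = _ := by
        push_cast
        field_simp
        ring

theorem radialIntegrand_le_of_shell (hn : 1 ≤ n) (hK : 0 ≤ K) (hΛ : Λ = 6 * n * K)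
    (hr : 0 < ‖x - k₀‖) (hr1 : ‖x - k₀‖ ≤ 1) (hΛr : Λ * ‖x - k₀‖ ≤ 1) {W : ℝ} (hW : 0 ≤ W)
    (hWr : W ≤ monotoneProfile n Λ ‖x - k₀‖) :
    U.radialIntegrand K k₀ (monotoneProfile n Λ ‖x - k₀‖ - W)
        (‖x - k₀‖ * monotoneProfileDeriv n Λ ‖x - k₀‖) x
      ≤ n * W * gradNormSq U x - 2 * n * radialDensity U k₀ x
        + Λ * (n + 3) * (‖x - k₀‖ ^ (n + 1))⁻¹ := by
  have hN := matNormSq_nonneg (radialDeriv U k₀ x)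
  have hn1 : (1 : ℝ) ≤ n := by exact_mod_cast hn
  rw [mul_monotoneProfileDeriv hr.ne', radialIntegrand, radialDensity_eq_mul_inv_pow]
  set r := ‖x - k₀‖
  set a := (r ^ n)⁻¹
  have ha : 0 < a := by positivity
  have hprofile : monotoneProfile n Λ r = a * (1 + Λ * r) := rfl
  have hΛ0 : 0 ≤ Λ * r := by rw [hΛ]; positivity
  have hcoeff : 0 ≤ (n - 1) * (Λ * r) ∧ (n - 1) * (Λ * r) ≤ n - 1 :=
    ⟨mul_nonneg (by linarith) hΛ0, mul_le_of_le_one_right (by linarith) hΛr⟩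
  have hf : |monotoneProfile n Λ r - W| * (1 + r) ≤ a * 4 := by
    rw [abs_of_nonneg (sub_nonneg.2 hWr), hprofile]
    nlinarith [mul_nonneg ha.le hΛ0]
  have hg : |-(a * (n + (n - 1) * (Λ * r)))| ≤ a * (2 * n - 1) := by
    rw [abs_neg, abs_of_nonneg (mul_nonneg ha.le (by linarith))]
    gcongr
    linarith
  have hweight := U.weight_mul_one_add_sum_norm_grad_le (x := x) hK hr hr1
    (q := |monotoneProfile n Λ r - W| * (1 + r) + |-(a * (n + (n - 1) * (Λ * r)))|)
    (by nlinarith)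
  have hradial : 0 ≤ a * ((n - 1) * (Λ * r)) * matNormSq (radialDeriv U k₀ x) :=
    mul_nonneg (mul_nonneg ha.le hcoeff.1) hN
  rw [← hΛ] at hweight
  rw [hprofile] at hweight ⊢
  push_cast
  linarith

theorem radialIntegrand_le_of_inner (hn : 1 ≤ n) (hK : 0 ≤ K) (hΛ : Λ = 6 * n * K) {t : ℝ}
    (hr : 0 < ‖x - k₀‖) (hrt : ‖x - k₀‖ ≤ t) (ht1 : t ≤ 1) (hΛt : Λ * t ≤ 1) {W : ℝ} (hW : 0 ≤ W)
    (hWt : W ≤ monotoneProfile n Λ t) :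
    U.radialIntegrand K k₀ (monotoneProfile n Λ t - W) 0 x
      ≤ n * W * gradNormSq U x - n * ((t ^ n)⁻¹ * gradNormSq U x)
        + Λ * (n + 3) * (‖x - k₀‖ ^ (n + 1))⁻¹ := by
  have hn1 : (1 : ℝ) ≤ n := by exact_mod_cast hn
  have hG := U.gradNormSq_nonneg x
  have ht : 0 < t := hr.trans_le hrt
  have hprofile : monotoneProfile n Λ t = (t ^ n)⁻¹ * (1 + Λ * t) := rfl
  have hΛ0 : 0 ≤ Λ := by rw [hΛ]; positivity
  have hpow : (t ^ (n + 1))⁻¹ ≤ (‖x - k₀‖ ^ (n + 1))⁻¹ := by gcongr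
  have hpow' := mul_le_mul_of_nonneg_left hpow (show 0 ≤ Λ * (n + 3) by positivity)
  rw [radialIntegrand]
  set a := (t ^ n)⁻¹
  have ha : 0 < a := by positivity
  have hf : |monotoneProfile n Λ t - W| * (1 + ‖x - k₀‖) ≤ a * 4 := by
    rw [abs_of_nonneg (sub_nonneg.2 hWt), hprofile]
    nlinarith [mul_nonneg ha.le (mul_nonneg hΛ0 ht.le)]
  have hweight := U.weight_mul_one_add_sum_norm_grad_le (x := x) hK ht ht1
    (q := |monotoneProfile n Λ t - W| * (1 + ‖x - k₀‖) + |0|) (by rw [abs_zero]; nlinarith)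
  have habsorb : 0 ≤ (n - 1) * (Λ * t * a * gradNormSq U x) :=
    mul_nonneg (by linarith) (by positivity)
  rw [← hΛ] at hweight
  rw [hprofile] at hweight ⊢
  push_cast
  linarith

variable {R₁ R₂ : ℝ}

theorem radialIntegrand_le_indicator (hn : 1 ≤ n) (hK : 0 ≤ K) (hΛ : Λ = 6 * n * K)
    (hR₁ : 0 < R₁) (hR : R₁ ≤ R₂) (hR₂ : R₂ ≤ 1) (hΛR : Λ * R₂ ≤ 1) (hx : x ≠ k₀) :
    U.radialIntegrand K k₀
        (∫ t in R₂..‖x - k₀‖, (Set.Ioo R₁ R₂).indicator (monotoneProfileDeriv n Λ) t)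
        (‖x - k₀‖ * (Set.Ioo R₁ R₂).indicator (monotoneProfileDeriv n Λ) ‖x - k₀‖) x
      ≤ (Metric.ball k₀ R₂).indicator (fun y => n * monotoneProfile n Λ R₂ * gradNormSq U y
          + Λ * (n + 3) * (‖y - k₀‖ ^ (n + 1))⁻¹) x
        - (Metric.ball k₀ R₁).indicator (fun y => n * ((R₁ ^ n)⁻¹ * gradNormSq U y)) x
        - (shell k₀ R₁ R₂).indicator (fun y => 2 * n * radialDensity U k₀ y) x := by
  have hr : 0 < ‖x - k₀‖ := norm_sub_pos_iff.2 hx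
  have hΛ0 : 0 ≤ Λ := by rw [hΛ]; positivity
  have hR₂0 : 0 < R₂ := hR₁.trans_le hR
  have hW : 0 ≤ monotoneProfile n Λ R₂ := monotoneProfile_nonneg hΛ0 hR₂0.le
  have hWt : ∀ t, 0 < t → t ≤ R₂ → monotoneProfile n Λ R₂ ≤ monotoneProfile n Λ t :=
    fun t ht htR => antitoneOn_monotoneProfile hn hΛ0 ht hR₂0 htR
  have hΛt : ∀ t ≤ R₂, Λ * t ≤ 1 := fun t ht => (mul_le_mul_of_nonneg_left ht hΛ0).trans hΛR
  have hprimitive : ∀ r ≤ R₂, ∫ t in R₂..r, (Set.Ioo R₁ R₂).indicator (monotoneProfileDeriv n Λ) t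
      = monotoneProfile n Λ (max r R₁) - monotoneProfile n Λ R₂ := fun r =>
    intervalIntegral_indicator_Ioo hR
      (fun t ht => hasDerivAt_monotoneProfile (hR₁.trans_le ht.1).ne')
      ((contDiffOn_monotoneProfileDeriv n Λ).continuousOn.mono fun t ht => hR₁.trans_le ht.1)
  rcases le_or_gt R₂ ‖x - k₀‖ with houter | hball₂
  · rw [intervalIntegral_eq_zero_of_le (fun t ht => Set.indicator_of_notMem ht _) houter]
    simp [dist_eq_norm, mem_shell, houter.not_gt,
      (hR.trans houter).not_gt, radialIntegrand]
  rw [hprimitive _ hball₂.le, Set.indicator_of_mem (mem_ball_iff_norm.2 hball₂)]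
  rcases lt_or_ge R₁ ‖x - k₀‖ with hshell | hinner
  · rw [max_eq_left hshell.le, Set.indicator_of_mem (Set.mem_Ioo.2 ⟨hshell, hball₂⟩),
      Set.indicator_of_notMem (fun h => hshell.not_gt (mem_ball_iff_norm.1 h)),
      Set.indicator_of_mem (mem_shell.2 ⟨hshell, hball₂⟩)]
    linarith [U.radialIntegrand_le_of_shell hn hK hΛ hr (hball₂.le.trans hR₂) (hΛt _ hball₂.le) hW
      (hWt _ hr hball₂.le)]
  · rw [max_eq_right hinner, Set.indicator_of_notMem (fun h => hinner.not_gt h.1), mul_zero,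
      Set.indicator_of_notMem (s := shell k₀ R₁ R₂) (fun h => hinner.not_gt h.1)]
    have hle := Set.indicator_le_self' (s := Metric.ball k₀ R₁)
      (f := fun y => n * ((R₁ ^ n)⁻¹ * gradNormSq U y))
      (fun y _ => by have := U.gradNormSq_nonneg y; positivity) x
    linarith [U.radialIntegrand_le_of_inner hn hK hΛ hr hinner (hR.trans hR₂) (hΛt _ hR) hW
      (hWt _ hR₁ hR)]

theorem integrable_radialIntegrand_monotoneProfile (hK : 0 ≤ K) (hR₁ : 0 < R₁) (k₀ : E (n + 2)) :
    Integrable fun x => U.radialIntegrand K k₀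
      (∫ t in R₂..‖x - k₀‖, (Set.Ioo R₁ R₂).indicator (monotoneProfileDeriv n Λ) t)
      (‖x - k₀‖ * (Set.Ioo R₁ R₂).indicator (monotoneProfileDeriv n Λ) ‖x - k₀‖) x := by
  set φ := (Set.Ioo R₁ R₂).indicator (monotoneProfileDeriv n Λ)
  have hφ0 : ∀ t ∉ Set.Ioo R₁ R₂, φ t = 0 := fun t ht => Set.indicator_of_notMem ht _
  have hφ : Measurable φ := by
    refine Measurable.indicator ?_ measurableSet_Ioo
    unfold monotoneProfileDeriv
    fun_prop
  obtain ⟨M, hM⟩ : ∃ M, ∀ t, |φ t| ≤ M := exists_abs_indicator_Ioo_le <|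
    (contDiffOn_monotoneProfileDeriv n Λ).continuousOn.mono fun t ht => hR₁.trans_le ht.1
  have hprimitive : Continuous fun r => ∫ t in R₂..r, φ t :=
    intervalIntegral.continuous_primitive (fun a b => (intervalIntegrable_const (c := M)).mono_fun
      hφ.aestronglyMeasurable (.of_forall fun t => (hM t).trans (le_abs_self M))) R₂
  exact U.integrable_radialIntegrand hK (hprimitive.measurable.comp (by fun_prop))
    (Measurable.mul (by fun_prop) (hφ.comp (by fun_prop)))
    (fun x => add_le_add (abs_intervalIntegral_le hM hφ0 (norm_nonneg _))
      (abs_mul_le_of_forall_notMem_Ioo hM hφ0 (norm_nonneg _)))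
    fun x hx => ⟨intervalIntegral_eq_zero_of_le hφ0 hx.le,
      by rw [hφ0 _ fun h => h.2.not_gt hx, mul_zero]⟩

variable {U}

theorem IsAlmostStationary.scaledEnergy_add_integral_shell_le {ρ : ℝ}
    (hU : U.IsAlmostStationary K ρ k₀) (hn : 1 ≤ n) (hK : 0 ≤ K) (hΛ : Λ = 6 * n * K)
    (hR₁ : 0 < R₁) (hR : R₁ ≤ R₂) (hρ : R₂ ≤ ρ) (hR₂ : R₂ ≤ 1) (hΛR : Λ * R₂ ≤ 1) :
    scaledEnergy U k₀ R₁ + ∫ k in shell k₀ R₁ R₂, 2 * radialDensity U k₀ k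
      ≤ (1 + Λ * R₂) * scaledEnergy U k₀ R₂ + 6 * K * (n + 3)
        * ((n + 2) * (volume : Measure (E (n + 2))).real (Metric.ball 0 1) * R₂) := by
  have hn0 : (0 : ℝ) < n := by exact_mod_cast hn
  have hG : ∀ R, IntegrableOn (gradNormSq U) (Metric.ball k₀ R) := fun R =>
    (U.locallyIntegrable_gradNormSq.integrableOn_isCompact (isCompact_closedBall k₀ R)).mono_set
      Metric.ball_subset_closedBall
  have hpow : IntegrableOn (fun x => (‖x - k₀‖ ^ (n + 1))⁻¹) (Metric.ball k₀ R₂) := by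
    simpa using integrableOn_ball_norm_inv_pow volume k₀ R₂
  have hpow_eq : ∫ x in Metric.ball k₀ R₂, (‖x - k₀‖ ^ (n + 1))⁻¹
      = (n + 2) * (volume : Measure (E (n + 2))).real (Metric.ball 0 1) * R₂ := by
    simpa using integral_ball_norm_inv_pow (volume : Measure (E (n + 2))) k₀ (hR₁.le.trans hR)
  have houter := (integrable_indicator_iff measurableSet_ball).2 <|
    ((hG R₂).const_mul (n * monotoneProfile n Λ R₂)).add (hpow.const_mul (Λ * (n + 3)))
  have hinner := (integrable_indicator_iff measurableSet_ball).2 <|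
    ((hG R₁).const_mul (R₁ ^ n)⁻¹).const_mul (n : ℝ)
  have hshell := (integrable_indicator_iff (measurableSet_shell k₀ R₁ R₂)).2 <|
    (U.integrableOn_radialDensity_shell k₀ hR₁ R₂).const_mul (2 * (n : ℝ))
  have hnonneg := (hU.integral_radialIntegrand_indicator_nonneg hK hR₁ hρ
    (contDiffOn_monotoneProfileDeriv n Λ)).trans <|
    integral_mono_ae (U.integrable_radialIntegrand_monotoneProfile hK hR₁ k₀)
      ((houter.sub hinner).sub hshell) <| by
        filter_upwards [Measure.ae_ne volume k₀] with x hx using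
          U.radialIntegrand_le_indicator hn hK hΛ hR₁ hR hR₂ hΛR hx
  rw [integral_sub' (houter.sub hinner) hshell, integral_sub' houter hinner,
    integral_indicator measurableSet_ball, integral_indicator measurableSet_ball,
    integral_indicator (measurableSet_shell k₀ R₁ R₂),
    integral_add' ((hG R₂).const_mul _) (hpow.const_mul _)] at hnonneg
  simp only [integral_const_mul, hpow_eq, monotoneProfile] at hnonneg
  simp only [scaledEnergy_eq_inv_pow_mul, integral_const_mul]
  refine le_of_mul_le_mul_left ?_ hn0
  rw [hΛ] at hnonneg ⊢
  linarith

end SobolevMap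

section SmallBalls

theorem exists_tendsto_nhdsGT_zero_of_le_add_mul {f : ℝ → ℝ} {a R : ℝ} (ha : 0 ≤ a) (hR : 0 < R)
    (hf : ∀ x, 0 < x → 0 ≤ f x)
    (hle : ∀ x y, 0 < x → x ≤ y → y ≤ R → f x ≤ a * y + (1 + a * y) * f y) :
    ∃ L, Tendsto f (𝓝[>] 0) (𝓝 L) := by
  set B := a * R + (1 + a * R) * f R
  have hfB : ∀ x, 0 < x → x ≤ R → f x ≤ B := fun x hx hxR => hle x R hx hxR le_rfl
  have hIoc : ∀ y : ℝ, 0 < y → ∀ᶠ x in 𝓝[>] (0 : ℝ), 0 < x ∧ x ≤ y := fun y hy =>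
    Ioc_mem_nhdsGT hy
  have hbdd : IsBoundedUnder (· ≤ ·) (𝓝[>] 0) f :=
    isBoundedUnder_of_eventually_le ((hIoc R hR).mono fun x hx => hfB x hx.1 hx.2)
  have hcobdd : IsCoboundedUnder (· ≤ ·) (𝓝[>] 0) f :=
    (isBoundedUnder_of_eventually_ge ((hIoc R hR).mono fun x hx => hf x hx.1)).isCoboundedUnder_le
  refine ⟨limsup f (𝓝[>] 0), tendsto_order.2 ⟨fun b hb => ?_, fun b hb =>
    eventually_lt_of_limsup_lt hb hbdd⟩⟩
  have hlower : ∀ y, 0 < y → y ≤ R → limsup f (𝓝[>] 0) - a * (1 + B) * y ≤ f y := by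
    intro y hy hyR
    have hlimsup : limsup f (𝓝[>] 0) ≤ a * y + (1 + a * y) * f y :=
      limsup_le_of_le hcobdd ((hIoc y hy).mono fun x hx => hle x y hx.1 hx.2 hyR)
    have herror : a * y * f y ≤ a * y * B :=
      mul_le_mul_of_nonneg_left (hfB y hy hyR) (mul_nonneg ha hy.le)
    linarith
  have hlim : Tendsto (fun y : ℝ => limsup f (𝓝[>] 0) - a * (1 + B) * y) (𝓝[>] 0)
      (𝓝 (limsup f (𝓝[>] 0))) :=
    tendsto_nhdsWithin_of_tendsto_nhds (Continuous.tendsto' (by fun_prop) _ _ (by simp))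
  filter_upwards [hlim.eventually_const_lt hb, hIoc R hR] with y hby hy
  exact hby.trans_le (hlower y hy.1 hy.2)

theorem tendsto_setIntegral_ball_nhdsGT_zero {X : Type*} [MetricSpace X] [MeasurableSpace X]
    [OpensMeasurableSpace X] {μ : Measure X} [NullSingletonClass μ] {f : X → ℝ} {c : X} {r : ℝ}
    (hr : 0 < r) (hf : IntegrableOn f (Metric.ball c r) μ) :
    Tendsto (fun R => ∫ x in Metric.ball c R, f x ∂μ) (𝓝[>] 0) (𝓝 0) := by
  have hle : ∀ᶠ R in 𝓝[>] 0, R ≤ r := mem_of_superset (Ioc_mem_nhdsGT hr) fun R hR => hR.2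
  suffices Tendsto (fun R => ∫ x, (Metric.ball c R).indicator f x ∂μ) (𝓝[>] 0)
      (𝓝 (∫ _, (0 : ℝ) ∂μ)) by
    simpa only [integral_indicator measurableSet_ball, integral_zero] using this
  refine tendsto_integral_filter_of_dominated_convergence
    ((Metric.ball c r).indicator fun x => ‖f x‖) ?_ ?_
    ((integrable_indicator_iff measurableSet_ball).2 hf.norm) ?_
  · filter_upwards [hle] with R hR
    exact ((integrable_indicator_iff measurableSet_ball).2
      (hf.mono_set (Metric.ball_subset_ball hR))).aestronglyMeasurable
  · filter_upwards [hle] with R hR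
    refine .of_forall fun x => ?_
    rw [norm_indicator_eq_indicator_norm]
    exact Set.indicator_le_indicator_of_subset (Metric.ball_subset_ball hR)
      (fun x => norm_nonneg _) x
  · filter_upwards [Measure.ae_ne μ c] with x hx
    refine tendsto_nhds_of_eventually_eq ?_
    filter_upwards [Ioo_mem_nhdsGT (dist_pos.2 hx)] with R hR
    have hxR : x ∉ Metric.ball c R := fun h => hR.2.not_gt h
    exact Set.indicator_of_notMem hxR f

theorem integrableOn_ball_of_integral_shell_le {d : ℕ} [NullSingletonClass (volume : Measure (E d))]
    {f : E d → ℝ} {k₀ : E d} {R I : ℝ} (hf : ∀ x, 0 ≤ f x)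
    (hint : ∀ r, 0 < r → IntegrableOn f (shell k₀ r R))
    (hle : ∀ r, 0 < r → ∫ x in shell k₀ r R, f x ≤ I) : IntegrableOn f (Metric.ball k₀ R) := by
  have hpos : ∀ i : ℕ, (0 : ℝ) < 1 / ((i : ℝ) + 1) := fun i => by positivity
  have hsub : ∀ r, shell k₀ r R ⊆ Metric.ball k₀ R := fun r k hk => mem_ball_iff_norm.2 hk.2
  have hcover : AECover (volume.restrict (Metric.ball k₀ R)) atTop
      fun i : ℕ => shell k₀ (1 / ((i : ℝ) + 1)) R := by
    refine ⟨?_, fun i => measurableSet_shell k₀ _ R⟩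
    filter_upwards [ae_restrict_mem measurableSet_ball,
      ae_restrict_of_ae (Measure.ae_ne volume k₀)] with x hxR hx
    filter_upwards [(tendsto_one_div_add_atTop_nhds_zero_nat (𝕜 := ℝ)).eventually_lt_const
      (norm_sub_pos_iff.2 hx)] with i hi
    exact ⟨hi, mem_ball_iff_norm.1 hxR⟩
  refine hcover.integrable_of_integral_bounded_of_nonneg_ae I
    (fun i => (hint _ (hpos i)).mono_measure Measure.restrict_le_self)
    (.of_forall hf) (.of_forall fun i => ?_)
  rw [Measure.restrict_restrict_of_subset (hsub _)]
  exact hle _ (hpos i)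

theorem integrableOn_ball_of_integrableOn_shell {d : ℕ} {f : E d → ℝ} {k₀ : E d} {r : ℝ}
    (hr : 0 < r) (hball : IntegrableOn f (Metric.ball k₀ r))
    (hshell : ∀ r R, 0 < r → IntegrableOn f (shell k₀ r R)) (R : ℝ) :
    IntegrableOn f (Metric.ball k₀ R) := by
  refine (hball.union (hshell (r / 2) R (half_pos hr))).mono_set fun x hx => ?_
  rcases lt_or_ge ‖x - k₀‖ r with hxr | hxr
  · exact .inl (mem_ball_iff_norm.2 hxr)
  · exact .inr ⟨(half_lt_self hr).trans_le hxr, mem_ball_iff_norm.1 hx⟩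

end SmallBalls

section Nonneg

variable {d m : ℕ} {γ : Module.Basis (Fin d) ℝ (E d)} (U : SobolevMap γ m)

theorem SobolevMap.radialDensity_nonneg (k₀ x : E d) : 0 ≤ radialDensity U k₀ x :=
  mul_nonneg (matNormSq_nonneg _) (zpow_nonneg (norm_nonneg _) _)

theorem SobolevMap.scaledEnergy_nonneg (k₀ : E d) {R : ℝ} (hR : 0 ≤ R) : 0 ≤ scaledEnergy U k₀ R :=
  mul_nonneg (zpow_nonneg hR _) (integral_nonneg U.gradNormSq_nonneg)

end Nonneg

/-- The monotonicity inequality for the scaled energies of `U` on all balls of radius at most `R'`,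
up to an error of order `C R₂` that is uniform in the centre. -/
def SobolevMap.IsAlmostMonotone {d m : ℕ} {γ : Module.Basis (Fin d) ℝ (E d)} (U : SobolevMap γ m)
    (C R' : ℝ) : Prop :=
  ∀ (k₀ : E d) (R₁ R₂ : ℝ), 0 < R₁ → R₁ ≤ R₂ → R₂ ≤ R' →
    scaledEnergy U k₀ R₁ + ∫ k in shell k₀ R₁ R₂, 2 * radialDensity U k₀ k
      ≤ 2 * C * R₂ + (1 + 2 * C * R₂) * scaledEnergy U k₀ R₂

section AlmostMonotone

variable {n m : ℕ} {γ : Module.Basis (Fin (n + 2)) ℝ (E (n + 2))} {U : SobolevMap γ m}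

theorem IsMinimizer.exists_isAlmostMonotone (hn : 1 ≤ n) {χ : Fin m → E (n + 2) → Hf γ}
    (hs : ∀ a, ContDiff ℝ ∞ (χ a)) (hτ : ∀ a, MemHTau γ (χ a)) {c : ℝ} (hc : 0 < c)
    (hU : IsMinimizer c χ U) : ∃ C R' : ℝ, 0 < C ∧ 0 < R' ∧ U.IsAlmostMonotone C R' := by
  obtain ⟨ρ, hρ, K, hK, hstationary⟩ := hU.exists_isAlmostStationary hs hτ hc
  set Λ : ℝ := 6 * n * K with hΛ
  set D : ℝ := 6 * K * (n + 3) * ((n + 2) * (volume : Measure (E (n + 2))).real (Metric.ball 0 1))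
  have hΛ0 : 0 ≤ Λ := by positivity
  have hD0 : 0 ≤ D := by positivity
  refine ⟨Λ + D + 1, min ρ (min 1 (Λ + 1)⁻¹), by positivity, by positivity,
    fun k₀ R₁ R₂ hR₁ hR hR₂ => ?_⟩
  obtain ⟨hR₂ρ, hR₂1, hR₂Λ⟩ : R₂ ≤ ρ ∧ R₂ ≤ 1 ∧ R₂ ≤ (Λ + 1)⁻¹ := by
    simpa only [le_min_iff] using hR₂
  have hR₂0 : 0 < R₂ := hR₁.trans_le hR
  have hΛR : Λ * R₂ ≤ 1 := by
    rw [le_inv_comm₀ hR₂0 (by positivity), ← one_div, le_div_iff₀ hR₂0] at hR₂Λ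
    linarith
  have hE := U.scaledEnergy_nonneg k₀ hR₂0.le
  calc scaledEnergy U k₀ R₁ + ∫ k in shell k₀ R₁ R₂, 2 * radialDensity U k₀ k
      ≤ (1 + Λ * R₂) * scaledEnergy U k₀ R₂ + D * R₂ := by
        refine ((hstationary k₀).scaledEnergy_add_integral_shell_le hn hK hΛ hR₁ hR hR₂ρ hR₂1
          hΛR).trans_eq ?_
        simp only [D]
        ring
    _ ≤ (1 + 2 * (Λ + D + 1) * R₂) * scaledEnergy U k₀ R₂ + 2 * (Λ + D + 1) * R₂ := by
        gcongr <;> linarith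
    _ = _ := add_comm _ _

namespace SobolevMap.IsAlmostMonotone

variable {C R' : ℝ}

theorem exists_tendsto_scaledEnergy (hU : U.IsAlmostMonotone C R') (hC : 0 ≤ C) (hR' : 0 < R')
    (k₀ : E (n + 2)) : ∃ L, Tendsto (scaledEnergy U k₀) (𝓝[>] 0) (𝓝 L) := by
  refine exists_tendsto_nhdsGT_zero_of_le_add_mul (a := 2 * C) (by positivity) hR'
    (fun x hx => U.scaledEnergy_nonneg k₀ hx.le) fun x y hx hxy hy => ?_
  refine (le_add_of_nonneg_right ?_).trans (hU k₀ x y hx hxy hy)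
  exact integral_nonneg fun k => mul_nonneg zero_le_two (U.radialDensity_nonneg k₀ k)

theorem integral_shell_le (hU : U.IsAlmostMonotone C R') (hC : 0 ≤ C) (hR' : 0 < R')
    (k₀ : E (n + 2)) {r : ℝ} (hr : 0 < r) :
    ∫ k in shell k₀ r R', radialDensity U k₀ k
      ≤ 2 * C * R' + (1 + 2 * C * R') * scaledEnergy U k₀ R' := by
  rcases le_or_gt r R' with hrR | hrR
  · have hmono := hU k₀ r R' hr hrR le_rfl
    have hE := U.scaledEnergy_nonneg k₀ hr.le
    have hshell : 0 ≤ ∫ k in shell k₀ r R', radialDensity U k₀ k :=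
      integral_nonneg (U.radialDensity_nonneg k₀)
    rw [integral_const_mul] at hmono
    linarith
  · have hempty : shell k₀ r R' = ∅ :=
      Set.eq_empty_of_forall_notMem fun k hk => lt_asymm hrR (hk.1.trans hk.2)
    have hE := U.scaledEnergy_nonneg k₀ hR'.le
    rw [hempty, setIntegral_empty]
    positivity

theorem integrableOn_radialDensity (hU : U.IsAlmostMonotone C R') (hC : 0 ≤ C) (hR' : 0 < R')
    (k₀ : E (n + 2)) (R : ℝ) : IntegrableOn (radialDensity U k₀) (Metric.ball k₀ R) :=
  have hshell : ∀ r R, 0 < r → IntegrableOn (radialDensity U k₀) (shell k₀ r R) :=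
    fun _ R hr => U.integrableOn_radialDensity_shell k₀ hr R
  integrableOn_ball_of_integrableOn_shell hR'
    (integrableOn_ball_of_integral_shell_le (U.radialDensity_nonneg k₀)
      (fun r hr => hshell r R' hr) fun _ hr => hU.integral_shell_le hC hR' k₀ hr) hshell R

end SobolevMap.IsAlmostMonotone

end AlmostMonotone

end

end MarzariVanderbilt

open MarzariVanderbilt in
theorem mainTheorem11_general (d m : ℕ) (hd : 3 ≤ d) (γ : Module.Basis (Fin d) ℝ (E d))
    (χ : Fin m → E d → Hf γ) (hχ_smooth : ∀ a, ContDiff ℝ ∞ (χ a)) (hχ_tau : ∀ a, MemHTau γ (χ a))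
    (c : ℝ) (hc : 0 < c) (U : SobolevMap γ m) (hU : IsMinimizer c χ U) :
    (∃ C R' : ℝ, 0 < C ∧ 0 < R' ∧
      ∀ (k₀ : E d) (R₁ R₂ : ℝ), 0 < R₁ → R₁ ≤ R₂ → R₂ ≤ R' →
        scaledEnergy U k₀ R₁
            + ∫ k in {k | R₁ < ‖k - k₀‖ ∧ ‖k - k₀‖ < R₂}, 2 * radialDensity U k₀ k
          ≤ 2 * C * R₂ + (1 + 2 * C * R₂) * scaledEnergy U k₀ R₂) ∧
    ∀ k₀ : E d,
      (∃ L : ℝ, Tendsto (fun R => scaledEnergy U k₀ R) (𝓝[>] 0) (𝓝 L)) ∧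
      (∀ R : ℝ, 0 < R → IntegrableOn (radialDensity U k₀) (Metric.ball k₀ R)) ∧
      Tendsto (fun R => ∫ k in Metric.ball k₀ R, radialDensity U k₀ k) (𝓝[>] 0) (𝓝 0) := by
  obtain ⟨n, rfl⟩ : ∃ n, d = n + 2 := ⟨d - 2, by lia⟩
  obtain ⟨C, R', hC, hR', hmono⟩ := hU.exists_isAlmostMonotone (by lia) hχ_smooth hχ_tau hc
  have hint := hmono.integrableOn_radialDensity hC.le hR'
  exact ⟨⟨C, R', hC, hR', hmono⟩, fun k₀ => ⟨hmono.exists_tendsto_scaledEnergy hC.le hR' k₀,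
    fun R _ => hint k₀ R, tendsto_setIntegral_ball_nhdsGT_zero one_pos (hint k₀ 1)⟩⟩

theorem mainTheorem11 (d m : ℕ) (hd : 3 ≤ d)
    (γ : Module.Basis (Fin d) ℝ (MarzariVanderbilt.E d))
    (P : MarzariVanderbilt.E d → (MarzariVanderbilt.Hf γ →L[ℂ] MarzariVanderbilt.Hf γ))
    (hP : MarzariVanderbilt.IsProjectorFamily γ m P)
    (χ : Fin m → MarzariVanderbilt.E d → MarzariVanderbilt.Hf γ)
    (hχ : MarzariVanderbilt.IsBlochFrame γ P χ)
    (hχ_analytic : ∀ a, AnalyticOnNhd ℝ (χ a) Set.univ)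
    (c : ℝ) (hc : 0 < c)
    (U : MarzariVanderbilt.SobolevMap γ m)
    (hU : MarzariVanderbilt.IsMinimizer c χ U) :
    (∃ C R' : ℝ, 0 < C ∧ 0 < R' ∧
      ∀ (k₀ : MarzariVanderbilt.E d) (R₁ R₂ : ℝ), 0 < R₁ → R₁ ≤ R₂ → R₂ ≤ R' →
        MarzariVanderbilt.scaledEnergy U k₀ R₁
            + ∫ k in {k | R₁ < ‖k - k₀‖ ∧ ‖k - k₀‖ < R₂},
                2 * MarzariVanderbilt.radialDensity U k₀ k
          ≤ 2 * C * R₂ + (1 + 2 * C * R₂) * MarzariVanderbilt.scaledEnergy U k₀ R₂) ∧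
    ∀ k₀ : MarzariVanderbilt.E d,
      (∃ L : ℝ, Tendsto (fun R => MarzariVanderbilt.scaledEnergy U k₀ R) (𝓝[>] 0) (𝓝 L)) ∧
      (∀ R : ℝ, 0 < R →
        IntegrableOn (MarzariVanderbilt.radialDensity U k₀) (Metric.ball k₀ R)) ∧
      Tendsto (fun R => ∫ k in Metric.ball k₀ R, MarzariVanderbilt.radialDensity U k₀ k)
        (𝓝[>] 0) (𝓝 0) :=
  mainTheorem11_general d m hd γ χ (fun a => (hχ_analytic a).contDiff) hχ.mem_HTau c hc U hU
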